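/- Let $G$ be a planar bicolored trivalent perfect graph in the disk with boundary vertices $b_1,\dots,b_n$: $G$ is finite, has no component isolated from the boundary, internal vertices are bivalent or trivalent and colored black or white, each $b_i$ is univalent and joined by its edge to an internal bivalent white vertex. A perfect orientation is one with one incoming and one outgoing edge at each bivalent vertex, exactly one incoming edge at each trivalent white vertex and exactly one outgoing edge at each trivalent black vertex; its base $I\subset[n]$ is its set of boundary sources. Assume that $G$ represents an irreducible positroid cell, i.e. every $j\in[n]$ belongs to the base of some perfect orientation and is missing from the base of some perfect orientation, and that $G$ has an acyclic perfect orientation $\mathcal O_0$, with base $I_0$. Each edge $e=(U,V)$ carries a weight $w_e>0$; reversing an edge replaces its weight by the reciprocal. Let $[A]\subset\mathbb R^n$ be the row space of the boundary measurement matrix in the orientation $\mathcal O_0$: for $i\in I_0$ its row has entry $1$ at $i$, and at $j\ne i$ the entry $(-1)^{\#\{s\in I_0:\ s \text{ strictly between } i \text{ and } j\}}\sum_P w(P)$, the sum running over the directed walks from $b_i$ to $b_j$ and $w(P)$ being the product of the weights along $P$. Draw $G$ with straight edges, without crossings, in the closed upper half plane (our model of the disk), with $b_1,\dots,b_n$ on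 the real axis from right to left, internal vertices in the open half plane, and such that each internal face (bounded and not touching the real axis) has trivalent vertices of both colors. A gauge ray direction is a vector $\mathfrak l$ pointing into the upper half plane, not parallel to any internal edge, such that no ray in direction $\mathfrak l$ from a boundary vertex contains an internal vertex. Call a choice $c=(\mathcal O,\text{drawing},\mathfrak l)$ of a perfect orientation, a drawing and a gauge ray direction a frame. With $s(a,b)=\operatorname{sign}(a\times b)$, put $\mathrm{wind}(e,f)=\pm1$ if $s(e,f)=s(e,\mathfrak l)=s(\mathfrak l,f)=\pm1$ and $0$ otherwise. For a directed walk $P=(e_1,\dots,e_m)$ let $\mathrm{wind}(P)=\sum_k\mathrm{wind}(e_k,e_{k+1})$, and let $\mathrm{int}(P)$ be the sum over $k$ of the number of intersections of $e_k$ with the rays in direction $\mathfrak l$ starting at the boundary sources (the starting point of a ray is not counted). The edge vector $E^c_e\in\mathbb R^n$ has $j$-th component $$(E^c_e)_j=\sum_{P:\,e\to b_j}(-1)^{\mathrm{wind}(P)+\mathrm{int}(P)}\,w(P),$$ the sum over all directed walks with first edge $e$ ending at the boundary sink $b_j$ (and $0$ if there is none), understood as a formal power series in the weights that represents a rational function,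 and evaluated as that function at $w$. For perfect orientations $\mathcal O,\mathcal O'$ with bases $I,I'$, the adapted basis from $\mathcal O$ to $\mathcal O'$ is a basis $(v_j)_{j\notin I}$ of the coordinate subspace $\mathrm{span}\{E_l: l\notin I'\}$ with $v_j-E_j\in[A]$ for all $j\notin I$, where $E_j$ are the canonical basis vectors. Then the following hold. 1. For every frame, the formal sums are rational functions of the weights (in the orientation of the frame) with integer numerator coefficients and subtraction-free denominators. 2. If the orientation of the frame $c$ is acyclic, then $(-1)^{\mathrm{wind}(P)+\mathrm{int}(P)}=:(-1)^{\sigma(e,b_j)}$ is the same for all walks $P:e\to b_j$, and for all positive weights $(E^c_e)_j=(-1)^{\sigma(e,b_j)}\sum_{P:e\to b_j}w(P)$. 3. For every frame $c$, with arbitrary perfect orientation $\mathcal O$, there are signs $\sigma_{e,j}\in\{\pm1\}$ and functions $R_{e,j}$ that are subtraction-free rational in the weights (quotients of polynomials with nonnegative integer coefficients, possibly zero) such that for all positive weights $w$ an adapted basis $(v_j)$ from $\mathcal O_0$ to $\mathcal O$ exists with $E^c_e=\sum_{j\notin I_0}\sigma_{e,j}R_{e,j}(w)\,v_j$ for all edges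 $e$. 4. Let $c,c'$ be any two frames, with orientations $\mathcal O,\mathcal O'$ and bases $I,I'$, let $w$ be positive weights and let $w'$ be obtained from $w$ by a weight gauge $w_{(U,V)}\mapsto w_{(U,V)}t_Ut_V^{-1}$, with $t>0$ at internal vertices and $t=1$ at the boundary. Then there are nonzero numbers $\alpha_e$, one for each edge, and an adapted basis $(v_j)$ from $\mathcal O$ to $\mathcal O'$ such that $E^{c'}_e(w')=\alpha_e\sum_{j\notin I}(E^c_e(w))_j\,v_j$ for all edges $e$. Thus every change of orientation, gauge ray direction, vertex gauge or weight gauge acts by a nonzero factor depending only on the edge. 5. For every frame, all positive weights and every edge $e$, $E^c_e\neq0$. -/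

import Mathlib

open scoped BigOperators

noncomputable section

/-- The combinatorial data of a planar bicolored trivalent perfect graph with `n` boundary vertices.
Vertices are `Sum.inl v` (internal) and `Sum.inr i` (the boundary vertex `b_i`).  Each edge carries
two ends; the order `fst, snd` of the ends is a bookkeeping reference and not an orientation of the
network. -/
structure PBDTPGraph (n : ℕ) (V E : Type*) where
  fst : E → V ⊕ Fin n
  snd : E → V ⊕ Fin n
  isWhite : V → Prop
  /-- Internal vertices are bivalent or trivalent. -/
  deg_internal : ∀ v : V,
    {e | fst e = Sum.inl v}.ncard + {e | snd e = Sum.inl v}.ncard = 2 ∨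
    {e | fst e = Sum.inl v}.ncard + {e | snd e = Sum.inl v}.ncard = 3
  /-- Boundary vertices are univalent. -/
  deg_boundary : ∀ i : Fin n,
    {e | fst e = Sum.inr i}.ncard + {e | snd e = Sum.inr i}.ncard = 1
  /-- The edge at `b_i` joins it to an internal bivalent white vertex. -/
  boundary_neighbor : ∀ i : Fin n, ∃ (e : E) (v : V),
    ((fst e = Sum.inr i ∧ snd e = Sum.inl v) ∨ (snd e = Sum.inr i ∧ fst e = Sum.inl v)) ∧
    {e | fst e = Sum.inl v}.ncard + {e | snd e = Sum.inl v}.ncard = 2 ∧ isWhite v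
  /-- No component is isolated from the boundary. -/
  connected_to_boundary : ∀ v : V, ∃ i : Fin n,
    Relation.ReflTransGen
      (fun a b => ∃ e, (fst e = a ∧ snd e = b) ∨ (fst e = b ∧ snd e = a))
      (Sum.inl v) (Sum.inr i)

namespace PBDTPGraph

variable {n : ℕ} {V E : Type*} (G : PBDTPGraph n V E)

/-! ### Orientations -/

/-- The degree of an internal vertex. -/
def deg (v : V) : ℕ :=
  {e | G.fst e = Sum.inl v}.ncard + {e | G.snd e = Sum.inl v}.ncard

/-- Initial vertex of `e` in the orientation `O` (`true` = from `fst` to `snd`). -/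
def src (O : E → Bool) (e : E) : V ⊕ Fin n := if O e then G.fst e else G.snd e

/-- Final vertex of `e` in the orientation `O`. -/
def tgt (O : E → Bool) (e : E) : V ⊕ Fin n := if O e then G.snd e else G.fst e

/-- Perfect orientations compatible with the coloring: a bivalent vertex has one incoming and one
outgoing edge, a trivalent white vertex has exactly one incoming edge, and a trivalent black vertex
has exactly one outgoing edge. -/
def IsPerfect (O : E → Bool) : Prop :=
  ∀ v : V,
    (G.deg v = 2 → {e | G.tgt O e = Sum.inl v}.ncard = 1 ∧ {e | G.src O e = Sum.inl v}.ncard = 1) ∧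
    (G.deg v = 3 → G.isWhite v → {e | G.tgt O e = Sum.inl v}.ncard = 1) ∧
    (G.deg v = 3 → ¬ G.isWhite v → {e | G.src O e = Sum.inl v}.ncard = 1)

/-- No directed cycles. -/
def IsAcyclic (O : E → Bool) : Prop :=
  ∀ x, ¬ Relation.TransGen (fun a b => ∃ e, G.src O e = a ∧ G.tgt O e = b) x x

/-- The set of (labels of) boundary sources of `O`. -/
def sources (O : E → Bool) : Set (Fin n) := {i | ∃ e, G.src O e = Sum.inr i}

/-- The (labels of) boundary sinks of `O`. -/
abbrev Sink (O : E → Bool) : Type := {j : Fin n // j ∉ G.sources O}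

instance (O : E → Bool) : Fintype (G.Sink O) := Fintype.ofFinite _

/-- The matroid of the graph: the source sets of all its perfect orientations. -/
def matroid : Set (Set (Fin n)) := {I | ∃ O, G.IsPerfect O ∧ I = G.sources O}

/-- The positroid cell of the graph is irreducible: every label lies in some base and is missing
from some base. -/
def IsIrreducible : Prop :=
  ∀ j : Fin n, (∃ I ∈ G.matroid, j ∈ I) ∧ (∃ J ∈ G.matroid, j ∉ J)

/-! ### Weights

A weight function `w` records the weight of each edge in its reference direction; the weight of an
edge traversed in the opposite direction is the reciprocal. -/

/-- Edge weights in the orientation `O`. -/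
def weight (O : E → Bool) (w : E → ℝ) (e : E) : ℝ := if O e then w e else (w e)⁻¹

/-- The weight gauge: `w_{(U,V)} ↦ w_{(U,V)} t_U t_V⁻¹` with `t = 1` at the boundary. -/
def regauge (t : V → ℝ) (w : E → ℝ) (e : E) : ℝ :=
  w e * Sum.elim t (fun _ => 1) (G.fst e) * (Sum.elim t (fun _ => 1) (G.snd e))⁻¹

/-! ### Directed walks and the boundary measurement -/

/-- `P` is a directed walk whose first edge is `e` and whose last edge ends at `b_j`. -/
def IsWalk (O : E → Bool) (e : E) (j : Fin n) (P : List E) : Prop :=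
  P.head? = some e ∧ P.IsChain (fun a b => G.tgt O a = G.src O b) ∧
    ∃ f, P.getLast? = some f ∧ G.tgt O f = Sum.inr j

/-- Sum of the weights of the directed walks in `S` (used for finite families of walks). -/
def weightSum (O : E → Bool) (w : E → ℝ) (S : Set (List E)) : ℝ :=
  ∑ᶠ P ∈ S, (P.map (weight O w)).prod

/-- Number of boundary sources strictly between `b_i` and `b_j`. -/
def sourcesBetween (O : E → Bool) (i j : Fin n) : ℕ :=
  {s ∈ G.sources O | min i j < s ∧ s < max i j}.ncard

/-- The row of the boundary measurement matrix at the source `b_i`, for an acyclic orientation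
`O`: entry `1` at `i`, and `(-1)^σ(i,j)` times the sum of the weights of the walks from `b_i` to
`b_j` at `j ≠ i` (it is `0` at the other sources).  In an acyclic orientation every walk is
self-avoiding, so no winding sign occurs. -/
def measurementRow (O : E → Bool) (w : E → ℝ) (i : Fin n) : Fin n → ℝ := by
  classical
  exact fun j => if j = i then 1 else
    (-1) ^ G.sourcesBetween O i j *
      weightSum O w {P | ∃ e, G.src O e = Sum.inr i ∧ G.IsWalk O e j P}

/-- The `k`-plane `[A]` represented by the network, computed in the acyclic orientation `O`: the row
space of the boundary measurement matrix. -/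
def measurementPlane (O : E → Bool) (w : E → ℝ) : Submodule ℝ (Fin n → ℝ) :=
  Submodule.span ℝ (Set.range fun i : G.sources O => G.measurementRow O w i)

/-- `v` is the basis, adapted to the orientation `O'`, that corresponds to the canonical basis
vectors at the sinks of `O`: it is a basis of the coordinate subspace of the sinks of `O'`, and
each `v j` is congruent to the canonical vector `E_j` modulo the plane `W`. -/
def IsAdaptedBasis (W : Submodule ℝ (Fin n → ℝ)) (O O' : E → Bool)
    (v : G.Sink O → Fin n → ℝ) : Prop :=
  LinearIndependent ℝ v ∧
  (Submodule.span ℝ (Set.range v) : Set (Fin n → ℝ)) = {x | ∀ i ∈ G.sources O', x i = 0} ∧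
  ∀ j : G.Sink O, v j - (fun i => if i = (j : Fin n) then 1 else 0) ∈ W

/-! ### Planar drawings and gauge ray directions

The disk is modelled by the closed upper half plane (equivalently, by a large half disk whose
diameter is the common interval of the boundary containing the boundary vertices). -/

/-- The union of the drawn edges, which are straight segments. -/
def drawing (pos : V ⊕ Fin n → ℝ × ℝ) : Set (ℝ × ℝ) :=
  ⋃ e, segment ℝ (pos (G.fst e)) (pos (G.snd e))

/-- Straight-line planar drawing in the disk. -/
structure IsPlanarDrawing (pos : V ⊕ Fin n → ℝ × ℝ) : Prop where
  injective : Function.Injective pos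
  boundary_line : ∀ i : Fin n, (pos (Sum.inr i)).2 = 0
  /-- Clockwise along the boundary of the upper half plane is from right to left. -/
  boundary_clockwise : StrictAnti fun i : Fin n => (pos (Sum.inr i)).1
  internal_inside : ∀ v : V, 0 < (pos (Sum.inl v)).2
  vertex_not_mem_edge : ∀ x e, pos x ∉ openSegment ℝ (pos (G.fst e)) (pos (G.snd e))
  edges_disjoint : ∀ e f, e ≠ f →
    Disjoint (openSegment ℝ (pos (G.fst e)) (pos (G.snd e)))
      (openSegment ℝ (pos (G.fst f)) (pos (G.snd f)))
  /-- Each internal face (a bounded face not touching the boundary of the disk) has trivalent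
  vertices of both colors. -/
  face_colors : ∀ p ∈ {q : ℝ × ℝ | 0 < q.2} \ G.drawing pos,
    let F := connectedComponentIn ({q : ℝ × ℝ | 0 < q.2} \ G.drawing pos) p
    Bornology.IsBounded F → (∀ q ∈ closure F, q.2 ≠ 0) →
      (∃ v, G.deg v = 3 ∧ G.isWhite v ∧ pos (Sum.inl v) ∈ closure F) ∧
      (∃ v, G.deg v = 3 ∧ ¬ G.isWhite v ∧ pos (Sum.inl v) ∈ closure F)

/-- `a × b`: positive iff the ordered pair `(a, b)` is positively oriented. -/
def cross (a b : ℝ × ℝ) : ℝ := a.1 * b.2 - a.2 * b.1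

/-- `l` is a gauge ray direction for the drawing. -/
structure IsGaugeDirection (pos : V ⊕ Fin n → ℝ × ℝ) (l : ℝ × ℝ) : Prop where
  points_inside : 0 < l.2
  not_parallel : ∀ (e : E) (u v : V), G.fst e = Sum.inl u → G.snd e = Sum.inl v →
    cross (pos (G.snd e) - pos (G.fst e)) l ≠ 0
  ray_avoids_vertices : ∀ (i : Fin n) (v : V) (s : ℝ), 0 ≤ s →
    pos (Sum.inl v) ≠ pos (Sum.inr i) + s • l

/-- A choice of perfect orientation, of drawing (vertex gauge) and of gauge ray direction. -/
structure Frame where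
  orient : E → Bool
  perfect : G.IsPerfect orient
  pos : V ⊕ Fin n → ℝ × ℝ
  planar : G.IsPlanarDrawing pos
  ray : ℝ × ℝ
  gauge : G.IsGaugeDirection pos ray

namespace Frame

variable {G} (c : G.Frame)

/-- The edge `e` as a vector, directed by the orientation. -/
def dir (e : E) : ℝ × ℝ := c.pos (G.tgt c.orient e) - c.pos (G.src c.orient e)

/-- Orientation sign `s(a, b)` of an ordered pair of vectors.  (Consecutive edges of a straight-line
planar drawing are never antiparallel.) -/
def orientationSign (a b : ℝ × ℝ) : SignType := SignType.sign (cross a b)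

open Classical in
/-- Local winding number of an ordered pair of edges with respect to the gauge ray direction. -/
def localWind (e f : E) : ℤ :=
  if orientationSign (c.dir e) (c.dir f) = 1 ∧ orientationSign (c.dir e) c.ray = 1 ∧
      orientationSign c.ray (c.dir f) = 1 then 1
  else if orientationSign (c.dir e) (c.dir f) = -1 ∧ orientationSign (c.dir e) c.ray = -1 ∧
      orientationSign c.ray (c.dir f) = -1 then -1
  else 0

/-- Generalized winding number of a walk. -/
def wind : List E → ℤ
  | e :: f :: P => c.localWind e f + wind (f :: P)
  | _ => 0

/-- Number of intersections of the edge `e` with the gauge rays starting at the boundary sources.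
Each ray meets an edge at most once, in the interior of the edge. -/
def edgeInt (e : E) : ℕ :=
  {i ∈ G.sources c.orient | ∃ s : ℝ, 0 < s ∧
    c.pos (Sum.inr i) + s • c.ray ∈ openSegment ℝ (c.pos (G.fst e)) (c.pos (G.snd e))}.ncard

/-- Number of intersections of a walk with the gauge rays at the boundary sources. -/
def walkInt (P : List E) : ℤ := (P.map fun e => (c.edgeInt e : ℤ)).sum

/-- The `j`-th component of the edge vector at `e` as a formal power series in the edge weights of
the oriented network: the sum over all directed walks `P` from `e` to `b_j` of
`(-1)^(wind P + int P) w(P)`. -/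
def edgeSeries (e : E) (j : Fin n) : MvPowerSeries E ℤ := fun m =>
  ∑ᶠ P ∈ {P : List E | G.IsWalk c.orient e j P ∧ (P.map fun a => Finsupp.single a 1).sum = m},
    ((c.wind P + c.walkInt P).negOnePow : ℤ)

end Frame

end PBDTPGraph

/-! ### Rational functions -/

/-- `y` is the value at `x` of the rational function represented by the formal power series `F`:
`F = P / Q` with polynomials `P`, `Q`, `Q(x) ≠ 0`, and `y = P(x) / Q(x)`. -/
def IsRationalValue {E : Type*} (F : MvPowerSeries E ℤ) (x : E → ℝ) (y : ℝ) : Prop :=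
  ∃ P Q : MvPolynomial E ℤ, (Q : MvPowerSeries E ℤ) * F = (P : MvPowerSeries E ℤ) ∧
    MvPolynomial.aeval x Q ≠ 0 ∧ y = MvPolynomial.aeval x P / MvPolynomial.aeval x Q

theorem IsRationalValue.unique {E : Type*} {F : MvPowerSeries E ℤ} {x : E → ℝ} {y z : ℝ}
    (hy : IsRationalValue F x y) (hz : IsRationalValue F x z) : y = z := by
  obtain ⟨P, Q, h, hQ, rfl⟩ := hy
  obtain ⟨P', Q', h', hQ', rfl⟩ := hz
  have key : P * Q' = P' * Q := by
    apply MvPolynomial.coe_injective E ℤ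
    push_cast
    rw [← h, ← h']
    ring
  have := congrArg (MvPolynomial.aeval x) key
  simp only [map_mul] at this
  rw [div_eq_div_iff hQ hQ']
  exact this

open Classical in
/-- The value at `x` of the rational function represented by `F` (and `0` if there is none). -/
def rationalValue {E : Type*} (F : MvPowerSeries E ℤ) (x : E → ℝ) : ℝ :=
  if h : ∃ y, IsRationalValue F x y then h.choose else 0

/-- `f` is, on the positive orthant, a subtraction-free rational function (possibly `0`): a quotient
of polynomials with nonnegative integer coefficients. -/
def IsSubtractionFree {E : Type*} (f : (E → ℝ) → ℝ) : Prop :=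
  ∃ P Q : MvPolynomial E ℕ, Q ≠ 0 ∧ ∀ w : E → ℝ, (∀ e, 0 < w e) →
    f w = MvPolynomial.aeval w P / MvPolynomial.aeval w Q

/-- The edge vector `E_e` of the network with weights `w`, in the given orientation, drawing and
gauge ray direction. -/
def PBDTPGraph.Frame.edgeVector {n : ℕ} {V E : Type*} {G : PBDTPGraph n V E} (c : G.Frame)
    (w : E → ℝ) (e : E) : Fin n → ℝ :=
  fun j => rationalValue (c.edgeSeries e j) (PBDTPGraph.weight c.orient w)

end

/-! All signs are computed modulo two, in coordinates in which the gauge ray direction is vertical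
(`coord`). For two edges, `under e f` adds up the ends of `e` lying below `f` and the ends of `f`
lying above `e`. It vanishes for edges without a common end, and for consecutive edges it is the
local winding number (`localWind_cast`). Sums of `under` therefore telescope: a simple directed
cycle has odd winding (`sum_under_cycle`), and the winding of a path is determined by its two ends
(`sum_under_path`). The number of crossings of an edge with the rays is a difference of values at
its two ends, which `gamma` and `rho` remove. Consequently a walk from a source to a sink in an
acyclic orientation has exactly the sign of the measurement matrix (`sign_of_source_walk`).

Rationality: splitting off the first edge of a walk gives a linear system with a transfer matrix T.
In the Leibniz expansion of det(1 - T), a surviving permutation is a disjoint union of simple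
directed cycles; its permutation sign, the minus signs of the entries and the odd windings cancel
(`sign_mul_prod_flow`). The determinant thus has natural coefficients and constant term one.
Cramer's rule yields the rational functions, and at positive weights the system is uniquely
solvable.

Change of orientation: after removal of the crossings, the system becomes a set of local relations
at the internal vertices (`IsSolution`). Let `side` be the parity of the number of reversed edges
over a given edge. Multiplying by (-1)^`side`, and on reversed edges also by the weight, carries
solutions for one perfect orientation to solutions for another (`isSolution_flip`). Expanding such a
solution at the sinks gives a linear map Φ that sends the edge vectors of the acyclic orientation to
nonzero multiples of those of the frame. Φ fixes the coordinate vectors at the sinks of the frame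
and kills the measurement rows, so by a dimension count it is the projection along [A]
(`exists_isSinkProjection`).

Adapted bases are the images of canonical vectors under such projections (`isAdaptedBasis`).
Positivity, invariance and nonvanishing are then transported from the acyclic orientation, where all
walks from an edge to a given sink have the same sign. -/

noncomputable section

/-! ### Points, segments and the lexicographic order in the plane -/

open Classical in
/-- The truth value of a proposition modulo two. -/
def bit (p : Prop) : ZMod 2 := if p then 1 else 0

theorem bit_true {p : Prop} (h : p) : bit p = 1 := if_pos h

theorem bit_false {p : Prop} (h : ¬ p) : bit p = 0 := if_neg h

theorem bit_congr {p q : Prop} (h : p ↔ q) : bit p = bit q := by rw [propext h]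

theorem add_self_zmod_two (a : ZMod 2) : a + a = 0 := CharTwo.add_self_eq_zero a

theorem mul_neg_iff_of_pos_left' {a b : ℝ} (h : 0 < a) : a * b < 0 ↔ b < 0 :=
  ⟨fun h' => by by_contra hb; exact absurd h' (mul_nonneg h.le (not_lt.1 hb)).not_gt,
    mul_neg_of_pos_of_neg h⟩

/-! ### Parity relations between segments in the plane. -/

namespace Plane

open PBDTPGraph (cross)

/-- Lexicographic order of the points of the plane. -/
def LexLt (x y : ℝ × ℝ) : Prop := x.1 < y.1 ∨ (x.1 = y.1 ∧ x.2 < y.2)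

theorem LexLt.le {x y : ℝ × ℝ} (h : LexLt x y) : x.1 ≤ y.1 := by
  rcases h with h | h
  · exact h.le
  · exact h.1.le

theorem LexLt.trans {x y z : ℝ × ℝ} (h : LexLt x y) (h' : LexLt y z) : LexLt x z := by
  rcases h with h | h <;> rcases h' with h' | h'
  · exact Or.inl (h.trans h')
  · exact Or.inl (h'.1 ▸ h)
  · exact Or.inl (h.1 ▸ h')
  · exact Or.inr ⟨h.1.trans h'.1, h.2.trans h'.2⟩

theorem LexLt.asymm {x y : ℝ × ℝ} (h : LexLt x y) : ¬ LexLt y x := by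
  intro h'
  rcases h with h | h <;> rcases h' with h' | h' <;> linarith [h, h']

theorem LexLt.irrefl (x : ℝ × ℝ) : ¬ LexLt x x := fun h => h.asymm h

theorem LexLt.total {x y : ℝ × ℝ} (h : x ≠ y) : LexLt x y ∨ LexLt y x := by
  unfold LexLt
  rcases lt_trichotomy x.1 y.1 with h1 | h1 | h1
  · exact Or.inl (Or.inl h1)
  · rcases lt_trichotomy x.2 y.2 with h2 | h2 | h2
    · exact Or.inl (Or.inr ⟨h1, h2⟩)
    · exact absurd (Prod.ext h1 h2) h
    · exact Or.inr (Or.inr ⟨h1.symm, h2⟩)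
  · exact Or.inr (Or.inl h1)

theorem bit_lexLt_add {x y : ℝ × ℝ} (h : x ≠ y) : bit (LexLt x y) + bit (LexLt y x) = 1 := by
  rcases LexLt.total h with h' | h'
  · rw [bit_true h', bit_false h'.asymm, add_zero]
  · rw [bit_true h', bit_false h'.asymm, zero_add]

/-- Whether `x` lies in the vertical strip of the segment `ab`. -/
def strip (x a b : ℝ × ℝ) : ZMod 2 := bit (LexLt a x) + bit (LexLt b x)

/-- The height of `x` over the line `ab`, up to a positive factor. -/
def height (a b x : ℝ × ℝ) : ℝ := (b.1 - a.1) * cross (b - a) (x - a)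

/-- Whether `x` lies under the segment `ab`. -/
def below (x a b : ℝ × ℝ) : ZMod 2 := strip x a b * bit (height a b x < 0)

/-- Whether `x` lies over the segment `ab`. -/
def above (x a b : ℝ × ℝ) : ZMod 2 := strip x a b * bit (0 < height a b x)

theorem strip_comm (x a b : ℝ × ℝ) : strip x a b = strip x b a := add_comm _ _

theorem height_comm (x a b : ℝ × ℝ) : height a b x = height b a x := by
  simp only [height, cross, Prod.fst_sub, Prod.snd_sub]; ring

theorem below_comm (x a b : ℝ × ℝ) : below x a b = below x b a := by
  rw [below, below, strip_comm, height_comm]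

theorem above_comm (x a b : ℝ × ℝ) : above x a b = above x b a := by
  rw [above, above, strip_comm, height_comm]

theorem height_left (a b : ℝ × ℝ) : height a b a = 0 := by
  simp [height, cross]

theorem below_left (a b : ℝ × ℝ) : below a a b = 0 := by
  rw [below, height_left, bit_false (lt_irrefl _), mul_zero]

theorem above_left (a b : ℝ × ℝ) : above a a b = 0 := by
  rw [above, height_left, bit_false (lt_irrefl _), mul_zero]

theorem below_add_above {x a b : ℝ × ℝ} (h : strip x a b ≠ 0 → height a b x ≠ 0) :
    below x a b + above x a b = strip x a b := by
  unfold below above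
  by_cases h0 : strip x a b = 0
  · simp [h0]
  · rcases lt_or_gt_of_ne (h h0) with h1 | h1
    · rw [bit_true h1, bit_false h1.not_gt]; ring
    · rw [bit_true h1, bit_false h1.not_gt]; ring

/-- The gap between the lines `ab` and `pq` over the abscissa `t`, up to a positive factor. -/
def gap (a b p q : ℝ × ℝ) (t : ℝ) : ℝ :=
  (q.1 - p.1) * (a.2 * (b.1 - a.1) + (b.2 - a.2) * (t - a.1)) -
    (b.1 - a.1) * (p.2 * (q.1 - p.1) + (q.2 - p.2) * (t - p.1))

theorem mem_segment_of_abscissa {a b z : ℝ × ℝ} (hab : a.1 < b.1) (h1 : a.1 ≤ z.1)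
    (h2 : z.1 ≤ b.1) (h : z.2 * (b.1 - a.1) = a.2 * (b.1 - a.1) + (b.2 - a.2) * (z.1 - a.1)) :
    z ∈ segment ℝ a b := by
  have hpos : 0 < b.1 - a.1 := sub_pos.2 hab
  refine ⟨(b.1 - z.1) / (b.1 - a.1), (z.1 - a.1) / (b.1 - a.1),
    div_nonneg (by linarith) hpos.le, div_nonneg (by linarith) hpos.le, ?_, ?_⟩
  · rw [← add_div, div_eq_one_iff_eq hpos.ne']; ring
  · refine Prod.ext ?_ ?_
    · simp only [Prod.fst_add, Prod.smul_fst, smul_eq_mul]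
      field_simp; ring
    · simp only [Prod.snd_add, Prod.smul_snd, smul_eq_mul]
      field_simp
      linarith

/-- A zero of the gap over a common abscissa is a common point of the two segments. -/
theorem gap_ne_zero {a b p q : ℝ × ℝ} (hab : a.1 < b.1) (hpq : p.1 < q.1)
    (hd : Disjoint (segment ℝ a b) (segment ℝ p q)) {t : ℝ} (h1 : a.1 ≤ t) (h2 : t ≤ b.1)
    (h3 : p.1 ≤ t) (h4 : t ≤ q.1) : gap a b p q t ≠ 0 := by
  intro h0
  have hpos : 0 < b.1 - a.1 := sub_pos.2 hab
  have hpos' : 0 < q.1 - p.1 := sub_pos.2 hpq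
  set y := a.2 + (b.2 - a.2) * (t - a.1) / (b.1 - a.1) with hy
  have hy' : y * (b.1 - a.1) = a.2 * (b.1 - a.1) + (b.2 - a.2) * (t - a.1) := by
    rw [hy]; field_simp
  unfold gap at h0
  rw [← hy'] at h0
  have : (b.1 - a.1) * (y * (q.1 - p.1) - (p.2 * (q.1 - p.1) + (q.2 - p.2) * (t - p.1))) = 0 := by
    linarith
  rcases mul_eq_zero.1 this with h | h
  · exact absurd h hpos.ne'
  · exact Set.disjoint_left.1 hd (mem_segment_of_abscissa (z := (t, y)) hab h1 h2 hy')
      (mem_segment_of_abscissa (z := (t, y)) hpq h3 h4 (sub_eq_zero.1 h))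

/-- The gap is continuous without zeros over the overlap, so by the intermediate value theorem it
keeps its sign there: one segment stays above the other. -/
theorem gap_pos_of_le {a b p q : ℝ × ℝ} (hab : a.1 < b.1) (hpq : p.1 < q.1)
    (hd : Disjoint (segment ℝ a b) (segment ℝ p q)) {t t' : ℝ} (h1 : a.1 ≤ t) (h2 : t ≤ b.1)
    (h3 : p.1 ≤ t) (h4 : t ≤ q.1) (h1' : a.1 ≤ t') (h2' : t' ≤ b.1)
    (h3' : p.1 ≤ t') (h4' : t' ≤ q.1) (h : 0 < gap a b p q t) : 0 < gap a b p q t' := by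
  by_contra hneg
  have hcont : ContinuousOn (gap a b p q) (Set.uIcc t' t) := by
    unfold gap; fun_prop
  have := intermediate_value_uIcc hcont (a := t') (b := t)
  obtain ⟨s, hs, hs0⟩ := this (Set.mem_uIcc.2 (Or.inl ⟨not_lt.1 hneg, h.le⟩))
  have hs1 : min t' t ≤ s ∧ s ≤ max t' t := hs
  exact gap_ne_zero hab hpq hd (t := s) (le_trans (le_min h1' h1) hs1.1)
    (hs1.2.trans (max_le h2' h2)) (le_trans (le_min h3' h3) hs1.1)
    (hs1.2.trans (max_le h4' h4)) hs0

/-- An end contributes only if it lies in the vertical strip of the other segment, and then exactly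
when `gap` is positive, a condition that is constant on the overlap. Exactly two ends bound the
overlap, so the contributions cancel in pairs. The lexicographic strips break ties between equal
abscissas consistently. -/
theorem below_add_above_of_disjoint_of_lt {a b p q : ℝ × ℝ} (hab : a.1 < b.1) (hpq : p.1 < q.1)
    (hd : Disjoint (segment ℝ a b) (segment ℝ p q)) :
    below p a b + below q a b + above a p q + above b p q = 0 := by
  have hpos : 0 < b.1 - a.1 := sub_pos.2 hab
  have hpos' : 0 < q.1 - p.1 := sub_pos.2 hpq
  have ab : LexLt a b := Or.inl hab
  have pq : LexLt p q := Or.inl hpq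
  have hne : ∀ x ∈ segment ℝ a b, ∀ y ∈ segment ℝ p q, x ≠ y :=
    fun x hx y hy => Set.disjoint_iff_forall_ne.1 hd hx hy
  have a_mem := left_mem_segment ℝ a b
  have b_mem := right_mem_segment ℝ a b
  have p_mem := left_mem_segment ℝ p q
  have q_mem := right_mem_segment ℝ p q
  have hp : height a b p < 0 ↔ 0 < gap a b p q p.1 := by
    have : gap a b p q p.1 = -((q.1 - p.1) * cross (b - a) (p - a)) := by
      simp only [gap, cross, Prod.fst_sub, Prod.snd_sub]; ring
    rw [this, height, neg_pos, mul_neg_iff_of_pos_left' hpos, mul_neg_iff_of_pos_left' hpos']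
  have hq : height a b q < 0 ↔ 0 < gap a b p q q.1 := by
    have : gap a b p q q.1 = -((q.1 - p.1) * cross (b - a) (q - a)) := by
      simp only [gap, cross, Prod.fst_sub, Prod.snd_sub]; ring
    rw [this, height, neg_pos, mul_neg_iff_of_pos_left' hpos, mul_neg_iff_of_pos_left' hpos']
  have ha : 0 < height p q a ↔ 0 < gap a b p q a.1 := by
    have : gap a b p q a.1 = (b.1 - a.1) * cross (q - p) (a - p) := by
      simp only [gap, cross, Prod.fst_sub, Prod.snd_sub]; ring
    rw [this, height, mul_pos_iff_of_pos_left hpos, mul_pos_iff_of_pos_left hpos']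
  have hb : 0 < height p q b ↔ 0 < gap a b p q b.1 := by
    have : gap a b p q b.1 = (b.1 - a.1) * cross (q - p) (b - p) := by
      simp only [gap, cross, Prod.fst_sub, Prod.snd_sub]; ring
    rw [this, height, mul_pos_iff_of_pos_left hpos, mul_pos_iff_of_pos_left hpos']
  have key : ∀ t t' : ℝ, a.1 ≤ t → t ≤ b.1 → p.1 ≤ t → t ≤ q.1 → a.1 ≤ t' → t' ≤ b.1 →
      p.1 ≤ t' → t' ≤ q.1 → bit (0 < gap a b p q t) = bit (0 < gap a b p q t') :=
    fun t t' h1 h2 h3 h4 h1' h2' h3' h4' => bit_congr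
      ⟨gap_pos_of_le hab hpq hd h1 h2 h3 h4 h1' h2' h3' h4',
        gap_pos_of_le hab hpq hd h1' h2' h3' h4' h1 h2 h3 h4⟩
  unfold below above strip
  rw [bit_congr hp, bit_congr hq, bit_congr ha, bit_congr hb]
  -- If `b` precedes `p` or `q` precedes `a`, every strip contribution is zero. Otherwise the
  -- overlap runs from the later of `a`, `p` to the earlier of `b`, `q`.
  rcases LexLt.total (hne b b_mem p p_mem) with bp | pb
  · rw [bit_true bp, bit_true (ab.trans bp), bit_true (bp.trans pq),
      bit_true (ab.trans (bp.trans pq)), bit_false bp.asymm, bit_false (ab.trans bp).asymm,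
      bit_false (bp.trans pq).asymm, bit_false (ab.trans (bp.trans pq)).asymm]
    simp [add_self_zmod_two]
  rcases LexLt.total (hne a a_mem q q_mem) with aq | qa
  · have a1 := ab.le
    have a2 := aq.le
    have a3 := pb.le
    have a4 := pq.le
    rw [bit_false pb.asymm, bit_true aq, bit_false aq.asymm, bit_true pb]
    rcases LexLt.total (hne a a_mem p p_mem) with h1 | h1 <;>
    rcases LexLt.total (hne b b_mem q q_mem) with h2 | h2 <;>
    rw [bit_true h1, bit_false h1.asymm, bit_true h2, bit_false h2.asymm] <;>
    have h1' := h1.le <;> have h2' := h2.le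
    · rw [key p.1 b.1 h1' a3 le_rfl a4 a1 le_rfl a3 h2']
      simp [add_self_zmod_two]
    · rw [key p.1 q.1 h1' a3 le_rfl a4 a2 h2' a4 le_rfl]
      simp [add_self_zmod_two]
    · rw [key a.1 b.1 le_rfl a1 h1' a2 a1 le_rfl a3 h2']
      simp [add_self_zmod_two]
    · rw [key a.1 q.1 le_rfl a1 h1' a2 a2 h2' a4 le_rfl]
      simp [add_self_zmod_two]
  · rw [bit_true qa, bit_true (pq.trans qa), bit_true (qa.trans ab),
      bit_true (pq.trans (qa.trans ab)), bit_false qa.asymm, bit_false (pq.trans qa).asymm,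
      bit_false (qa.trans ab).asymm, bit_false (pq.trans (qa.trans ab)).asymm]
    simp [add_self_zmod_two]

/-- Two disjoint segments: the number of ends of the second under the first one has the parity of
the number of ends of the first over the second one. -/
theorem below_add_above_of_disjoint {a b p q : ℝ × ℝ} (hab : a.1 ≠ b.1) (hpq : p.1 ≠ q.1)
    (hd : Disjoint (segment ℝ a b) (segment ℝ p q)) :
    below p a b + below q a b + above a p q + above b p q = 0 := by
  rcases lt_or_gt_of_ne hab with h | h <;> rcases lt_or_gt_of_ne hpq with h' | h'
  · exact below_add_above_of_disjoint_of_lt h h' hd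
  · rw [segment_symm ℝ p q] at hd
    have := below_add_above_of_disjoint_of_lt h h' hd
    rw [above_comm a, above_comm b, ← this]; ring
  · rw [segment_symm ℝ a b] at hd
    have := below_add_above_of_disjoint_of_lt h h' hd
    rw [below_comm p, below_comm q, ← this]; ring
  · rw [segment_symm ℝ a b, segment_symm ℝ p q] at hd
    have := below_add_above_of_disjoint_of_lt h h' hd
    rw [below_comm p, below_comm q, above_comm a, above_comm b, ← this]; ring

/-- Two segments with a common end. -/
theorem below_add_above_of_common {p a q : ℝ × ℝ} (ha : p.1 ≠ a.1) (hq : p.1 ≠ q.1)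
    (hne : 0 < (q.1 - p.1) * (a.1 - p.1) → cross (q - p) (a - p) ≠ 0) :
    below q p a + above a p q =
      bit (0 < (q.1 - p.1) * (a.1 - p.1) ∧ 0 < (q.1 - p.1) * cross (q - p) (a - p)) := by
  have e1 : height p a q = -((a.1 - p.1) * cross (q - p) (a - p)) := by
    simp only [height, cross, Prod.fst_sub, Prod.snd_sub]; ring
  have e2 : height p q a = (q.1 - p.1) * cross (q - p) (a - p) := rfl
  unfold below above strip
  rw [e1, e2, neg_lt_zero]
  -- When both segments leave `p` on the same side, exactly one of `a`, `q` lies in the strip of the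
  -- other segment, and both height conditions agree. When they leave on opposite sides, neither end
  -- lies in a strip.
  by_cases hs : 0 < (q.1 - p.1) * (a.1 - p.1)
  · have hc := hne hs
    have haq : a ≠ q := by
      rintro rfl
      exact hc (by simp [cross]; ring)
    have hsgn : bit (0 < (a.1 - p.1) * cross (q - p) (a - p)) =
        bit (0 < (q.1 - p.1) * cross (q - p) (a - p)) := by
      apply bit_congr
      rcases mul_pos_iff.1 hs with ⟨h1, h2⟩ | ⟨h1, h2⟩
      · rw [mul_pos_iff_of_pos_left h1, mul_pos_iff_of_pos_left h2]
      · rw [mul_pos_iff, mul_pos_iff]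
        constructor <;> (rintro (⟨h, _⟩ | ⟨_, h⟩); · linarith) <;> exact Or.inr ⟨by assumption, h⟩
    have hpp : bit (LexLt p q) = bit (LexLt p a) := by
      rcases mul_pos_iff.1 hs with ⟨h1, h2⟩ | ⟨h1, h2⟩
      · have pq : LexLt p q := Or.inl (by linarith)
        have pa : LexLt p a := Or.inl (by linarith)
        rw [bit_true pq, bit_true pa]
      · have qp : LexLt q p := Or.inl (by linarith)
        have ap : LexLt a p := Or.inl (by linarith)
        rw [bit_false qp.asymm, bit_false ap.asymm]
    rw [hsgn, ← add_mul, hpp, bit_congr (and_iff_right hs)]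
    have := bit_lexLt_add haq
    have h2 := add_self_zmod_two (bit (LexLt p a))
    linear_combination (bit (0 < (q.1 - p.1) * cross (q - p) (a - p))) * (this + h2)
  · have hfalse : ¬ (0 < (q.1 - p.1) * (a.1 - p.1) ∧ 0 < (q.1 - p.1) * cross (q - p) (a - p)) :=
      fun h => hs h.1
    rw [bit_false hfalse]
    have hs' : (q.1 - p.1) * (a.1 - p.1) < 0 := by
      refine lt_of_le_of_ne (not_lt.1 hs) (mul_ne_zero (sub_ne_zero.2 hq.symm) (sub_ne_zero.2 ha.symm))
    rcases mul_neg_iff.1 hs' with ⟨h1, h2⟩ | ⟨h1, h2⟩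
    · have pq : LexLt p q := Or.inl (by linarith)
      have ap : LexLt a p := Or.inl (by linarith)
      rw [bit_true pq, bit_true (ap.trans pq), bit_false ap.asymm, bit_false (ap.trans pq).asymm]
      simp [add_self_zmod_two]
    · have qp : LexLt q p := Or.inl (by linarith)
      have pa : LexLt p a := Or.inl (by linarith)
      rw [bit_true pa, bit_true (qp.trans pa), bit_false qp.asymm, bit_false (qp.trans pa).asymm]
      simp [add_self_zmod_two]

end Plane

end

/-! ### Incidence, and coordinates adapted to the gauge ray direction. -/

noncomputable section

namespace PBDTPGraph

variable {n : ℕ} {V E : Type*} {G : PBDTPGraph n V E}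

/-! ### Ends of edges -/

/-- The edge `e` joins `x` and `y`. -/
def Joins (G : PBDTPGraph n V E) (e : E) (x y : V ⊕ Fin n) : Prop :=
  (G.fst e = x ∧ G.snd e = y) ∨ (G.fst e = y ∧ G.snd e = x)

/-- The edge `e` has the end `x`. -/
def Inc (G : PBDTPGraph n V E) (e : E) (x : V ⊕ Fin n) : Prop := G.fst e = x ∨ G.snd e = x

theorem joins_fst_snd (e : E) : G.Joins e (G.fst e) (G.snd e) := Or.inl ⟨rfl, rfl⟩

theorem joins_src_tgt (O : E → Bool) (e : E) : G.Joins e (G.src O e) (G.tgt O e) := by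
  unfold src tgt
  cases O e
  · exact Or.inr ⟨rfl, rfl⟩
  · exact Or.inl ⟨rfl, rfl⟩

theorem Joins.symm {e : E} {x y : V ⊕ Fin n} (h : G.Joins e x y) : G.Joins e y x := Or.symm h

theorem Joins.inc_left {e : E} {x y : V ⊕ Fin n} (h : G.Joins e x y) : G.Inc e x :=
  h.imp And.left And.right

theorem Joins.inc_right {e : E} {x y : V ⊕ Fin n} (h : G.Joins e x y) : G.Inc e y :=
  h.symm.inc_left

theorem Joins.inc_iff {e : E} {x y z : V ⊕ Fin n} (h : G.Joins e x y) :
    G.Inc e z ↔ z = x ∨ z = y := by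
  unfold Inc
  rcases h with ⟨rfl, rfl⟩ | ⟨rfl, rfl⟩
  · rw [eq_comm, @eq_comm _ (G.snd e)]
  · rw [eq_comm, @eq_comm _ (G.snd e), or_comm]

theorem Inc.exists_joins {e : E} {x : V ⊕ Fin n} (h : G.Inc e x) : ∃ y, G.Joins e x y := by
  rcases h with rfl | rfl
  · exact ⟨_, joins_fst_snd e⟩
  · exact ⟨_, (joins_fst_snd e).symm⟩

theorem inc_iff_src_or_tgt (O : E → Bool) {e : E} {x : V ⊕ Fin n} :
    G.Inc e x ↔ G.src O e = x ∨ G.tgt O e = x := by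
  rw [(joins_src_tgt O e).inc_iff, eq_comm, @eq_comm _ x]

theorem inc_src (O : E → Bool) (e : E) : G.Inc e (G.src O e) := (joins_src_tgt O e).inc_left

theorem inc_tgt (O : E → Bool) (e : E) : G.Inc e (G.tgt O e) := (joins_src_tgt O e).inc_right

theorem exists_boundary_edge [Finite E] (G : PBDTPGraph n V E) (i : Fin n) :
    ∃ (e : E) (v : V), G.Joins e (Sum.inr i) (Sum.inl v) ∧
      ∀ e', G.Inc e' (Sum.inr i) → e' = e := by
  obtain ⟨e, v, h, -⟩ := G.boundary_neighbor i
  refine ⟨e, v, h.imp id fun h => ⟨h.2, h.1⟩, fun e' he' => ?_⟩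
  have hdeg := G.deg_boundary i
  have he : G.fst e = Sum.inr i ∨ G.snd e = Sum.inr i := h.imp And.left And.left
  have hA : ∀ d, G.fst d = Sum.inr i → 0 < {e | G.fst e = Sum.inr i}.ncard := fun d hd =>
    (Set.ncard_pos (Set.toFinite _)).2 ⟨d, hd⟩
  have hB : ∀ d, G.snd d = Sum.inr i → 0 < {e | G.snd e = Sum.inr i}.ncard := fun d hd =>
    (Set.ncard_pos (Set.toFinite _)).2 ⟨d, hd⟩
  rcases he with he | he <;> rcases he' with he' | he'
  · have h1 : {e | G.fst e = Sum.inr i}.ncard ≤ 1 := by omega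
    exact (Set.ncard_le_one (Set.toFinite _)).1 h1 _ he' _ he
  · have := hA _ he; have := hB _ he'; omega
  · have := hA _ he'; have := hB _ he; omega
  · have h1 : {e | G.snd e = Sum.inr i}.ncard ≤ 1 := by omega
    exact (Set.ncard_le_one (Set.toFinite _)).1 h1 _ he' _ he

theorem not_joins_boundary [Finite E] {e : E} {i j : Fin n} :
    ¬ G.Joins e (Sum.inr i) (Sum.inr j) := by
  intro h
  obtain ⟨d, v, hd, huniq⟩ := G.exists_boundary_edge i
  obtain rfl := huniq e h.inc_left
  have := hd.inc_iff.1 h.inc_right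
  have h2 := h.inc_iff.1 hd.inc_right
  simp at h2

theorem eq_of_inc_boundary [Finite E] {e f : E} {i : Fin n} (he : G.Inc e (Sum.inr i))
    (hf : G.Inc f (Sum.inr i)) : e = f := by
  obtain ⟨d, v, hd, huniq⟩ := G.exists_boundary_edge i
  rw [huniq e he, huniq f hf]

namespace Frame

variable (c : G.Frame)

/-! ### Coordinates in which the gauge ray direction is vertical -/

/-- The linear coordinates of the plane in which the gauge ray direction is vertical. -/
def coord : ℝ × ℝ →ₗ[ℝ] ℝ × ℝ where
  toFun x := (cross x c.ray, x.2)
  map_add' x y := by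
    refine Prod.ext ?_ rfl
    simp only [cross, Prod.fst_add, Prod.snd_add]; ring
  map_smul' r x := by
    refine Prod.ext ?_ rfl
    simp only [cross, Prod.smul_fst, Prod.smul_snd, smul_eq_mul, RingHom.id_apply]; ring

/-- The determinant of `coord` is `c.ray.2`, which is positive; for the same reason the map
preserves orientation. -/
theorem coord_injective : Function.Injective c.coord := by
  intro x y h
  have h1 : (c.coord x).1 = (c.coord y).1 := by rw [h]
  have h2 : (c.coord x).2 = (c.coord y).2 := by rw [h]
  change cross x c.ray = cross y c.ray at h1
  change x.2 = y.2 at h2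
  refine Prod.ext ?_ h2
  unfold cross at h1
  rw [h2] at h1
  exact mul_right_cancel₀ c.gauge.points_inside.ne' (by linarith)

/-- The position of a vertex in these coordinates. -/
def pt (x : V ⊕ Fin n) : ℝ × ℝ := c.coord (c.pos x)

theorem pt_injective : Function.Injective c.pt := c.coord_injective.comp c.planar.injective

theorem pt_fst (x : V ⊕ Fin n) : (c.pt x).1 = cross (c.pos x) c.ray := rfl

theorem pt_snd (x : V ⊕ Fin n) : (c.pt x).2 = (c.pos x).2 := rfl

theorem pt_boundary_snd (i : Fin n) : (c.pt (Sum.inr i)).2 = 0 := c.planar.boundary_line i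

theorem pt_internal_snd (v : V) : 0 < (c.pt (Sum.inl v)).2 := c.planar.internal_inside v

theorem pt_snd_nonneg (x : V ⊕ Fin n) : 0 ≤ (c.pt x).2 := by
  cases x
  · exact (c.pt_internal_snd _).le
  · exact (c.pt_boundary_snd _).ge

/-- On the real axis the first coordinate is just scaled by `c.ray.2`; the reversal comes from the
labelling from right to left. -/
theorem pt_boundary_lt_iff {i j : Fin n} :
    (c.pt (Sum.inr i)).1 < (c.pt (Sum.inr j)).1 ↔ j < i := by
  have h : ∀ i : Fin n, (c.pt (Sum.inr i)).1 = (c.pos (Sum.inr i)).1 * c.ray.2 := fun i => by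
    rw [pt_fst, cross, c.planar.boundary_line]; ring
  rw [h, h, mul_lt_mul_iff_left₀ c.gauge.points_inside]
  exact c.planar.boundary_clockwise.lt_iff_gt

/-- Internal vertices are in the open upper half plane, so one on the vertical line through `b_i`
would lie on the ray itself. -/
theorem pt_boundary_ne_internal (i : Fin n) (v : V) :
    (c.pt (Sum.inl v)).1 ≠ (c.pt (Sum.inr i)).1 := by
  intro h
  refine c.gauge.ray_avoids_vertices i v ((c.pos (Sum.inl v)).2 / c.ray.2)
    (div_nonneg (c.planar.internal_inside v).le c.gauge.points_inside.le) ?_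
  rw [pt_fst, pt_fst, cross, cross, c.planar.boundary_line] at h
  have hl := c.gauge.points_inside.ne'
  refine Prod.ext ?_ ?_
  · simp only [Prod.fst_add, Prod.smul_fst, smul_eq_mul]
    field_simp
    linarith
  · simp only [Prod.snd_add, Prod.smul_snd, smul_eq_mul, c.planar.boundary_line]
    field_simp
    ring

theorem pt_ne_boundary {x : V ⊕ Fin n} {i : Fin n} (h : x ≠ Sum.inr i) :
    (c.pt x).1 ≠ (c.pt (Sum.inr i)).1 := by
  cases x with
  | inl v => exact c.pt_boundary_ne_internal i v
  | inr j =>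
    have hij : j ≠ i := fun hij => h (by rw [hij])
    rcases lt_or_gt_of_ne hij with h' | h'
    · exact (c.pt_boundary_lt_iff.2 h').ne'
    · exact (c.pt_boundary_lt_iff.2 h').ne

theorem fst_ne_snd (c : G.Frame) (e : E) : G.fst e ≠ G.snd e := by
  intro h
  apply c.planar.vertex_not_mem_edge (G.fst e) e
  rw [← h, openSegment_same]
  rfl

theorem joins_ne (c : G.Frame) {e : E} {x y : V ⊕ Fin n} (h : G.Joins e x y) : x ≠ y := by
  rcases h with ⟨rfl, rfl⟩ | ⟨rfl, rfl⟩
  · exact c.fst_ne_snd e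
  · exact (c.fst_ne_snd e).symm

/-- No edge is vertical: internal edges because they are not parallel to the ray, boundary edges
because the rays avoid the vertices. -/
theorem pt_fst_ne_of_joins {e : E} {x y : V ⊕ Fin n} (h : G.Joins e x y) :
    (c.pt x).1 ≠ (c.pt y).1 := by
  have key : ∀ x y, G.fst e = x → G.snd e = y → (c.pt x).1 ≠ (c.pt y).1 := by
    intro x y hx hy
    have hxy : x ≠ y := by rw [← hx, ← hy]; exact c.fst_ne_snd e
    cases x with
    | inr i => exact (c.pt_ne_boundary hxy.symm).symm
    | inl u =>
      cases y with
      | inr j => exact c.pt_ne_boundary hxy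
      | inl v =>
        intro h
        apply c.gauge.not_parallel e u v hx hy
        rw [hx, hy]
        rw [pt_fst, pt_fst] at h
        simp only [cross, Prod.fst_sub, Prod.snd_sub] at h ⊢
        linarith
  rcases h with ⟨h1, h2⟩ | ⟨h1, h2⟩
  · exact key _ _ h1 h2
  · exact (key _ _ h1 h2).symm

theorem disjoint_openSegment {e f : E} (h : e ≠ f) {a b p q : V ⊕ Fin n} (he : G.Joins e a b)
    (hf : G.Joins f p q) :
    Disjoint (openSegment ℝ (c.pt a) (c.pt b)) (openSegment ℝ (c.pt p) (c.pt q)) := by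
  have key : Disjoint (openSegment ℝ (c.pos a) (c.pos b)) (openSegment ℝ (c.pos p) (c.pos q)) := by
    have := c.planar.edges_disjoint e f h
    rcases he with ⟨rfl, rfl⟩ | ⟨rfl, rfl⟩ <;> rcases hf with ⟨rfl, rfl⟩ | ⟨rfl, rfl⟩
    · exact this
    · rwa [openSegment_symm ℝ (c.pos (G.snd f))]
    · rwa [openSegment_symm ℝ (c.pos (G.snd e))]
    · rwa [openSegment_symm ℝ (c.pos (G.snd e)), openSegment_symm ℝ (c.pos (G.snd f))]
  have him : ∀ x y, openSegment ℝ (c.pt x) (c.pt y) =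
      c.coord '' openSegment ℝ (c.pos x) (c.pos y) := fun x y =>
    (image_openSegment ℝ c.coord.toAffineMap _ _).symm
  rw [him, him, Set.disjoint_image_iff c.coord_injective]
  exact key

theorem pt_notMem_openSegment {e : E} {a b : V ⊕ Fin n} (he : G.Joins e a b) (x : V ⊕ Fin n) :
    c.pt x ∉ openSegment ℝ (c.pt a) (c.pt b) := by
  have him : openSegment ℝ (c.pt a) (c.pt b) = c.coord '' openSegment ℝ (c.pos a) (c.pos b) :=
    (image_openSegment ℝ c.coord.toAffineMap _ _).symm
  rw [him, pt, c.coord_injective.mem_set_image]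
  rcases he with ⟨rfl, rfl⟩ | ⟨rfl, rfl⟩
  · exact c.planar.vertex_not_mem_edge x e
  · rw [openSegment_symm]
    exact c.planar.vertex_not_mem_edge x e

theorem disjoint_segment {e f : E} {a b p q : V ⊕ Fin n} (he : G.Joins e a b)
    (hf : G.Joins f p q) (hap : a ≠ p) (haq : a ≠ q) (hbp : b ≠ p) (hbq : b ≠ q) :
    Disjoint (segment ℝ (c.pt a) (c.pt b)) (segment ℝ (c.pt p) (c.pt q)) := by
  have hef : e ≠ f := by
    rintro rfl
    rcases hf.inc_iff.1 he.inc_left with h | h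
    · exact hap h
    · exact haq h
  have ho := c.disjoint_openSegment hef he hf
  rw [Set.disjoint_left] at ho ⊢
  intro z hz hz'
  rw [← insert_endpoints_openSegment] at hz hz'
  have hinj := c.pt_injective
  rcases hz with rfl | rfl | hz <;> rcases hz' with h | h | hz'
  · exact hap (hinj h)
  · exact haq (hinj h)
  · exact c.pt_notMem_openSegment hf _ hz'
  · exact hbp (hinj h)
  · exact hbq (hinj h)
  · exact c.pt_notMem_openSegment hf _ hz'
  · exact c.pt_notMem_openSegment he p (h ▸ hz)
  · exact c.pt_notMem_openSegment he q (h ▸ hz)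
  · exact ho hz hz'

/-- Two collinear edges leaving `p` on the same side would overlap near `p`. -/
theorem cross_ne_zero_of_common {e f : E} (h : e ≠ f) {p q a : V ⊕ Fin n} (he : G.Joins e p q)
    (hf : G.Joins f p a)
    (hs : 0 < ((c.pt q).1 - (c.pt p).1) * ((c.pt a).1 - (c.pt p).1)) :
    cross (c.pt q - c.pt p) (c.pt a - c.pt p) ≠ 0 := by
  intro h0
  have ho := c.disjoint_openSegment h he hf
  set x := c.pt p
  set y := c.pt q
  set z := c.pt a
  have hy : y.1 - x.1 ≠ 0 := left_ne_zero_of_mul hs.ne'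
  have hz : z.1 - x.1 ≠ 0 := right_ne_zero_of_mul hs.ne'
  set t := (z.1 - x.1) / (y.1 - x.1) with ht
  have htpos : 0 < t := by
    rw [ht, div_pos_iff]
    rcases mul_pos_iff.1 hs with h | h
    · exact Or.inl ⟨h.2, h.1⟩
    · exact Or.inr ⟨h.2, h.1⟩
  have hzt : z - x = t • (y - x) := by
    simp only [cross, Prod.fst_sub, Prod.snd_sub] at h0
    refine Prod.ext ?_ ?_
    · simp only [Prod.fst_sub, Prod.smul_fst, smul_eq_mul, ht]
      field_simp
    · simp only [Prod.snd_sub, Prod.smul_snd, smul_eq_mul, ht]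
      field_simp
      linarith
  -- The factor `t` rescales one edge to the other; at half of the smaller of `1` and `t`, the point
  -- is interior to both.
  set s := min 1 t / 2 with hsdef
  have hm : 0 < min 1 t := lt_min one_pos htpos
  have hm1 : min 1 t ≤ 1 := min_le_left _ _
  have hmt : min 1 t ≤ t := min_le_right _ _
  refine (Set.disjoint_left.1 ho : ∀ ⦃a⦄, _ → _) (a := x + s • (y - x))
    ⟨1 - s, s, ?_, ?_, ?_, ?_⟩ ⟨1 - s / t, s / t, ?_, ?_, ?_, ?_⟩
  · rw [hsdef]; linarith
  · rw [hsdef]; linarith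
  · ring
  · module
  · rw [sub_pos, div_lt_one htpos, hsdef]; linarith
  · rw [hsdef]; positivity
  · ring
  · have : z = x + t • (y - x) := by rw [← hzt]; abel
    rw [this, smul_add, smul_smul, div_mul_cancel₀ _ htpos.ne']
    module

end Frame

end PBDTPGraph

end

/-! ### The parity `under`, its relation to winding, and ray intersections. -/

noncomputable section

namespace PBDTPGraph

variable {n : ℕ} {V E : Type*} {G : PBDTPGraph n V E}

namespace Frame

open Plane

variable (c : G.Frame)

/-! ### Vertical comparison of vertices and edges -/

/-- Whether the vertex `x` lies under the edge `e`. -/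
def bel (x : V ⊕ Fin n) (e : E) : ZMod 2 := below (c.pt x) (c.pt (G.fst e)) (c.pt (G.snd e))

/-- Whether the vertex `x` lies over the edge `e`. -/
def abv (x : V ⊕ Fin n) (e : E) : ZMod 2 := above (c.pt x) (c.pt (G.fst e)) (c.pt (G.snd e))

/-- Whether the edge `e` lies under the edge `f` near a common vertex. -/
def under (e f : E) : ZMod 2 :=
  c.bel (G.fst e) f + c.bel (G.snd e) f + c.abv (G.fst f) e + c.abv (G.snd f) e

/-- Whether `x` precedes the boundary vertex `b_i` in the horizontal order. -/
def left (i : Fin n) (x : V ⊕ Fin n) : ZMod 2 := bit ((c.pt x).1 < (c.pt (Sum.inr i)).1)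

/-- Whether `y` follows `x` in the horizontal order. -/
def right (x y : V ⊕ Fin n) : ZMod 2 := bit ((c.pt x).1 < (c.pt y).1)

variable {c}

theorem bel_eq {e : E} {a b : V ⊕ Fin n} (h : G.Joins e a b) (x : V ⊕ Fin n) :
    c.bel x e = below (c.pt x) (c.pt a) (c.pt b) := by
  rcases h with ⟨rfl, rfl⟩ | ⟨rfl, rfl⟩
  · rfl
  · exact below_comm _ _ _

theorem abv_eq {e : E} {a b : V ⊕ Fin n} (h : G.Joins e a b) (x : V ⊕ Fin n) :
    c.abv x e = above (c.pt x) (c.pt a) (c.pt b) := by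
  rcases h with ⟨rfl, rfl⟩ | ⟨rfl, rfl⟩
  · rfl
  · exact above_comm _ _ _

theorem bel_eq_zero {e : E} {x : V ⊕ Fin n} (h : G.Inc e x) : c.bel x e = 0 := by
  obtain ⟨y, h⟩ := h.exists_joins
  rw [bel_eq h, below_left]

theorem abv_eq_zero {e : E} {x : V ⊕ Fin n} (h : G.Inc e x) : c.abv x e = 0 := by
  obtain ⟨y, h⟩ := h.exists_joins
  rw [abv_eq h, above_left]

theorem sum_ends {M : Type*} [AddCommMonoid M] {e : E} {a b : V ⊕ Fin n} (h : G.Joins e a b)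
    (φ : V ⊕ Fin n → M) : φ (G.fst e) + φ (G.snd e) = φ a + φ b := by
  rcases h with ⟨rfl, rfl⟩ | ⟨rfl, rfl⟩
  · rfl
  · exact add_comm _ _

theorem under_eq {e f : E} {a b p q : V ⊕ Fin n} (he : G.Joins e a b) (hf : G.Joins f p q) :
    c.under e f = c.bel a f + c.bel b f + c.abv p e + c.abv q e := by
  unfold under
  linear_combination sum_ends he (fun x => c.bel x f) + sum_ends hf (fun x => c.abv x e)

theorem under_self (e : E) : c.under e e = 0 := by
  have h := joins_fst_snd (G := G) e
  rw [under_eq h h, bel_eq_zero h.inc_left, bel_eq_zero h.inc_right, abv_eq_zero h.inc_left,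
    abv_eq_zero h.inc_right]
  simp

/-- This locality, coming from the parity relation for disjoint segments, is what makes the sums of
`under` telescope. -/
theorem under_eq_zero {e f : E} (h : ∀ x, G.Inc e x → ¬ G.Inc f x) : c.under e f = 0 := by
  have he := joins_fst_snd (G := G) e
  have hf := joins_fst_snd (G := G) f
  have h1 := h _ he.inc_left
  have h2 := h _ he.inc_right
  rw [hf.inc_iff, not_or] at h1 h2
  exact below_add_above_of_disjoint (c.pt_fst_ne_of_joins hf) (c.pt_fst_ne_of_joins he)
    (c.disjoint_segment hf he (Ne.symm h1.1) (Ne.symm h2.1) (Ne.symm h1.2) (Ne.symm h2.2))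

theorem under_eq_bit {e f : E} (h : e ≠ f) {p q a : V ⊕ Fin n} (he : G.Joins e p q)
    (hf : G.Joins f p a) :
    c.under e f = bit (0 < ((c.pt q).1 - (c.pt p).1) * ((c.pt a).1 - (c.pt p).1) ∧
      0 < ((c.pt q).1 - (c.pt p).1) * cross (c.pt q - c.pt p) (c.pt a - c.pt p)) := by
  rw [under_eq he hf, bel_eq_zero hf.inc_left, abv_eq_zero he.inc_left, bel_eq hf, abv_eq he,
    zero_add, add_zero]
  exact below_add_above_of_common (c.pt_fst_ne_of_joins hf) (c.pt_fst_ne_of_joins he)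
    (c.cross_ne_zero_of_common h he hf)

/-- Of two edges leaving `p` on the same side exactly one is under the other; on opposite sides
neither is. The terms `right` distinguish the two cases. -/
theorem under_add_under {e f : E} (h : e ≠ f) {p q a : V ⊕ Fin n} (he : G.Joins e p q)
    (hf : G.Joins f p a) : c.under e f + c.under f e = 1 + c.right p q + c.right p a := by
  rw [under_eq_bit h he hf, under_eq_bit h.symm hf he]
  have hc := c.cross_ne_zero_of_common h he hf
  have hq := sub_ne_zero.2 (c.pt_fst_ne_of_joins he).symm
  have ha := sub_ne_zero.2 (c.pt_fst_ne_of_joins hf).symm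
  have hcomm : cross (c.pt a - c.pt p) (c.pt q - c.pt p) =
      -cross (c.pt q - c.pt p) (c.pt a - c.pt p) := by unfold cross; ring
  unfold right
  rw [hcomm, bit_congr (sub_pos (a := (c.pt q).1) (b := (c.pt p).1)).symm,
    bit_congr (sub_pos (a := (c.pt a).1) (b := (c.pt p).1)).symm]
  revert hc hq ha
  generalize cross (c.pt q - c.pt p) (c.pt a - c.pt p) = k
  generalize (c.pt q).1 - (c.pt p).1 = x
  generalize (c.pt a).1 - (c.pt p).1 = y
  intro hc hx hy
  rcases lt_or_gt_of_ne hx with hx | hx <;> rcases lt_or_gt_of_ne hy with hy | hy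
  · have hxy : 0 < x * y := mul_pos_of_neg_of_neg hx hy
    have hyx : 0 < y * x := mul_pos_of_neg_of_neg hy hx
    rw [bit_congr (and_iff_right hxy), bit_congr (and_iff_right hyx), bit_false hx.not_gt,
      bit_false hy.not_gt]
    rcases lt_or_gt_of_ne (hc hxy) with hk | hk
    · rw [bit_true (by nlinarith), bit_false (by nlinarith)]; rfl
    · rw [bit_false (by nlinarith), bit_true (by nlinarith)]; rfl
  · have hxy : ¬ 0 < x * y := by nlinarith
    have hyx : ¬ 0 < y * x := by nlinarith
    rw [bit_false (fun h => hxy h.1), bit_false (fun h => hyx h.1), bit_false hx.not_gt,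
      bit_true hy]; rfl
  · have hxy : ¬ 0 < x * y := by nlinarith
    have hyx : ¬ 0 < y * x := by nlinarith
    rw [bit_false (fun h => hxy h.1), bit_false (fun h => hyx h.1), bit_true hx,
      bit_false hy.not_gt]; rfl
  · have hxy : 0 < x * y := mul_pos hx hy
    have hyx : 0 < y * x := mul_pos hy hx
    rw [bit_congr (and_iff_right hxy), bit_congr (and_iff_right hyx), bit_true hx, bit_true hy]
    rcases lt_or_gt_of_ne (hc hxy) with hk | hk
    · rw [bit_false (by nlinarith), bit_true (by nlinarith)]; rfl
    · rw [bit_true (by nlinarith), bit_false (by nlinarith)]; rfl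

/-- The local winding number modulo two. -/
theorem localWind_cast {e f : E} (h : G.tgt c.orient e = G.src c.orient f) :
    ((c.localWind e f : ℤ) : ZMod 2) = c.under e f := by
  have he := (joins_src_tgt (G := G) c.orient e).symm
  have hf := joins_src_tgt (G := G) c.orient f
  have hef : e ≠ f := by
    rintro rfl
    exact c.joins_ne hf h.symm
  rw [← h] at hf
  rw [under_eq_bit hef he hf]
  have hl := c.gauge.points_inside
  -- Seen from the common vertex, `e` points backwards, whence the sign here.
  have hA : (c.pt (G.src c.orient e)).1 - (c.pt (G.tgt c.orient e)).1 =
      -cross (c.dir e) c.ray := by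
    simp only [pt_fst, dir, cross, Prod.fst_sub, Prod.snd_sub]; ring
  have hC : (c.pt (G.tgt c.orient f)).1 - (c.pt (G.tgt c.orient e)).1 =
      -cross c.ray (c.dir f) := by
    rw [h]
    simp only [pt_fst, dir, cross, Prod.fst_sub, Prod.snd_sub]; ring
  -- The factor `c.ray.2` is the determinant of `coord`; being positive, it does not affect signs.
  have hK : cross (c.pt (G.src c.orient e) - c.pt (G.tgt c.orient e))
      (c.pt (G.tgt c.orient f) - c.pt (G.tgt c.orient e)) =
      -(c.ray.2 * cross (c.dir e) (c.dir f)) := by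
    unfold dir
    rw [← h]
    simp only [pt_fst, pt_snd, cross, Prod.fst_sub, Prod.snd_sub]; ring
  rw [hA, hC, hK]
  unfold localWind orientationSign
  simp only [sign_eq_one_iff, sign_eq_neg_one_iff]
  generalize cross (c.dir e) (c.dir f) = k
  generalize cross (c.dir e) c.ray = x
  generalize cross c.ray (c.dir f) = y
  split_ifs with h1 h2
  · rw [bit_true]
    · simp
    · obtain ⟨h1, h2, h3⟩ := h1
      exact ⟨by rw [neg_mul_neg]; positivity, by rw [neg_mul_neg]; positivity⟩
  · rw [bit_true]
    · simp
    · obtain ⟨h1, h2, h3⟩ := h2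
      have := mul_pos_of_neg_of_neg h2 h1
      have := mul_pos_of_neg_of_neg h2 h3
      exact ⟨by rw [neg_mul_neg]; positivity, by
        rw [neg_mul_neg, mul_left_comm]; positivity⟩
  · rw [bit_false]
    · simp
    · rintro ⟨h3, h4⟩
      rw [neg_mul_neg] at h3 h4
      rw [mul_left_comm, mul_pos_iff_of_pos_left hl] at h4
      rcases mul_pos_iff.1 h3 with ⟨hx, hy⟩ | ⟨hx, hy⟩
      · exact h1 ⟨(mul_pos_iff_of_pos_left hx).1 h4, hx, hy⟩
      · refine h2 ⟨?_, hx, hy⟩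
        by_contra hk
        nlinarith

/-! ### Boundary vertices -/

theorem left_self (i : Fin n) : c.left i (Sum.inr i) = 0 := bit_false (lt_irrefl _)

theorem bit_lexLt_boundary (x : V ⊕ Fin n) (i : Fin n) :
    bit (LexLt (c.pt x) (c.pt (Sum.inr i))) = c.left i x := by
  by_cases h : x = Sum.inr i
  · rw [h, left_self, bit_false (LexLt.irrefl _)]
  · refine bit_congr ⟨fun h' => h'.resolve_right fun h' => c.pt_ne_boundary h h'.1, Or.inl⟩

theorem left_add_left {i j : Fin n} (h : i ≠ j) :
    c.left i (Sum.inr j) + c.left j (Sum.inr i) = 1 := by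
  rw [← bit_lexLt_boundary, ← bit_lexLt_boundary]
  exact bit_lexLt_add fun h' => h (Sum.inr_injective (c.pt_injective h')).symm

theorem strip_boundary (i : Fin n) (a b : V ⊕ Fin n) :
    strip (c.pt (Sum.inr i)) (c.pt a) (c.pt b) = c.left i a + c.left i b := by
  rw [strip, bit_lexLt_boundary, bit_lexLt_boundary]

/-- Edges lie in the closed upper half plane and never join two boundary vertices, so their
interiors are strictly above the axis. -/
theorem height_boundary_neg [Finite E] {e : E} {a b : V ⊕ Fin n} (h : G.Joins e a b) {i : Fin n}
    (h1 : (c.pt a).1 < (c.pt (Sum.inr i)).1) (h2 : (c.pt (Sum.inr i)).1 < (c.pt b).1) :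
    height (c.pt a) (c.pt b) (c.pt (Sum.inr i)) < 0 := by
  have hab : 0 < (c.pt b).1 - (c.pt a).1 := by linarith
  refine mul_neg_of_pos_of_neg hab ?_
  have e1 : cross (c.pt b - c.pt a) (c.pt (Sum.inr i) - c.pt a) =
      -((c.pt a).2 * ((c.pt b).1 - (c.pt (Sum.inr i)).1) +
        (c.pt b).2 * ((c.pt (Sum.inr i)).1 - (c.pt a).1)) := by
    simp only [cross, Prod.fst_sub, Prod.snd_sub, c.pt_boundary_snd]; ring
  rw [e1, neg_lt_zero]
  have ha := c.pt_snd_nonneg a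
  have hb := c.pt_snd_nonneg b
  have hp1 := sub_pos.2 h1
  have hp2 := sub_pos.2 h2
  cases a with
  | inl u => have := c.pt_internal_snd u; positivity
  | inr j =>
    cases b with
    | inl v => have := c.pt_internal_snd v; positivity
    | inr k => exact absurd h not_joins_boundary

theorem height_boundary_neg' [Finite E] {e : E} {a b : V ⊕ Fin n} (h : G.Joins e a b) {i : Fin n}
    (hs : strip (c.pt (Sum.inr i)) (c.pt a) (c.pt b) ≠ 0) (hi : ¬ G.Inc e (Sum.inr i)) :
    height (c.pt a) (c.pt b) (c.pt (Sum.inr i)) < 0 := by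
  rw [h.inc_iff, not_or] at hi
  rw [strip_boundary] at hs
  unfold left at hs
  have ha := c.pt_ne_boundary (Ne.symm hi.1)
  have hb := c.pt_ne_boundary (Ne.symm hi.2)
  rcases lt_or_gt_of_ne ha with ha | ha <;> rcases lt_or_gt_of_ne hb with hb | hb
  · rw [bit_true ha, bit_true hb] at hs
    exact absurd rfl hs
  · exact height_boundary_neg h ha hb
  · rw [height_comm]
    exact height_boundary_neg h.symm hb ha
  · rw [bit_false ha.not_gt, bit_false hb.not_gt] at hs
    exact absurd rfl hs

/-- A boundary vertex in the strip of an edge is automatically below it, so only the strip test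
remains. Hence the crossing with a ray is a sum over the ends of the edge of a function of vertices,
which will telescope along walks. -/
theorem bel_boundary [Finite E] {e : E} {a b : V ⊕ Fin n} (h : G.Joins e a b) {i : Fin n}
    (hi : ¬ G.Inc e (Sum.inr i)) : c.bel (Sum.inr i) e = c.left i a + c.left i b := by
  rw [bel_eq h, below, ← strip_boundary]
  by_cases hs : strip (c.pt (Sum.inr i)) (c.pt a) (c.pt b) = 0
  · rw [hs, zero_mul]
  · rw [bit_true (height_boundary_neg' h hs hi), mul_one]

theorem abv_boundary [Finite E] (e : E) (i : Fin n) : c.abv (Sum.inr i) e = 0 := by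
  by_cases hi : G.Inc e (Sum.inr i)
  · exact abv_eq_zero hi
  · have h := joins_fst_snd (G := G) e
    rw [abv_eq h, above]
    by_cases hs : strip (c.pt (Sum.inr i)) (c.pt (G.fst e)) (c.pt (G.snd e)) = 0
    · rw [hs, zero_mul]
    · rw [bit_false (height_boundary_neg' h hs hi).not_gt, mul_zero]

/-- In the coordinates `pt` the ray is a vertical half line, so meeting the edge means starting
below it. -/
theorem ray_meets_iff [Finite E] (e : E) (i : Fin n) :
    (∃ s : ℝ, 0 < s ∧ c.pos (Sum.inr i) + s • c.ray ∈
      openSegment ℝ (c.pos (G.fst e)) (c.pos (G.snd e))) ↔ c.bel (Sum.inr i) e = 1 := by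
  have hl := c.gauge.points_inside
  have hray : c.coord c.ray = (0, c.ray.2) := by
    refine Prod.ext ?_ rfl
    change c.ray.1 * c.ray.2 - c.ray.2 * c.ray.1 = 0
    ring
  have hmem : ∀ s : ℝ, c.pos (Sum.inr i) + s • c.ray ∈
      openSegment ℝ (c.pos (G.fst e)) (c.pos (G.snd e)) ↔
      ((c.pt (Sum.inr i)).1, s * c.ray.2) ∈
        openSegment ℝ (c.pt (G.fst e)) (c.pt (G.snd e)) := by
    intro s
    have him : openSegment ℝ (c.pt (G.fst e)) (c.pt (G.snd e)) =
        c.coord '' openSegment ℝ (c.pos (G.fst e)) (c.pos (G.snd e)) :=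
      (image_openSegment ℝ c.coord.toAffineMap _ _).symm
    have hpt : ((c.pt (Sum.inr i)).1, s * c.ray.2) = c.coord (c.pos (Sum.inr i) + s • c.ray) := by
      rw [map_add, map_smul, hray]
      refine Prod.ext ?_ ?_
      · change _ = (c.pt (Sum.inr i)).1 + s * 0
        simp
      · change _ = (c.pt (Sum.inr i)).2 + s * c.ray.2
        rw [c.pt_boundary_snd, zero_add]
    rw [him, hpt, c.coord_injective.mem_set_image]
  have hne := c.pt_fst_ne_of_joins (joins_fst_snd (G := G) e)
  constructor
  · rintro ⟨s, hs, hs'⟩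
    rw [hmem] at hs'
    obtain ⟨x, y, hx, hy, hxy, h⟩ := hs'
    have h1 : x * (c.pt (G.fst e)).1 + y * (c.pt (G.snd e)).1 = (c.pt (Sum.inr i)).1 :=
      congrArg Prod.fst h
    obtain rfl : x = 1 - y := by linarith
    have hi : ¬ G.Inc e (Sum.inr i) := by
      rintro (h' | h')
      · rw [← h'] at h1
        have : y * ((c.pt (G.snd e)).1 - (c.pt (G.fst e)).1) = 0 := by linarith
        exact (mul_ne_zero hy.ne' (sub_ne_zero.2 hne.symm)) this
      · rw [← h'] at h1
        have : (1 - y) * ((c.pt (G.fst e)).1 - (c.pt (G.snd e)).1) = 0 := by linarith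
        exact (mul_ne_zero hx.ne' (sub_ne_zero.2 hne)) this
    rw [bel_boundary (joins_fst_snd e) hi]
    unfold left
    rw [← h1]
    rcases lt_or_gt_of_ne hne with h' | h'
    · rw [bit_true (by nlinarith), bit_false (by nlinarith)]; rfl
    · rw [bit_false (by nlinarith), bit_true (by nlinarith)]; rfl
  · intro h
    have hi : ¬ G.Inc e (Sum.inr i) := fun hi => by
      rw [bel_eq_zero hi] at h
      exact absurd h (by decide)
    have key : ∀ a b, G.Joins e a b → (c.pt a).1 < (c.pt (Sum.inr i)).1 →
        (c.pt (Sum.inr i)).1 < (c.pt b).1 → ∃ s : ℝ, 0 < s ∧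
          ((c.pt (Sum.inr i)).1, s * c.ray.2) ∈ openSegment ℝ (c.pt a) (c.pt b) := by
      intro a b hab h1 h2
      set u := (c.pt (Sum.inr i)).1
      have hba : 0 < (c.pt b).1 - (c.pt a).1 := by linarith
      have hab' : 0 < (c.pt a).2 + (c.pt b).2 := by
        have ha := c.pt_snd_nonneg a
        have hb := c.pt_snd_nonneg b
        cases a with
        | inl u => have := c.pt_internal_snd u; positivity
        | inr j =>
          cases b with
          | inl v => have := c.pt_internal_snd v; positivity
          | inr k => exact absurd hab not_joins_boundary
      set y := (u - (c.pt a).1) / ((c.pt b).1 - (c.pt a).1) with hy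
      have hy0 : 0 < y := div_pos (by linarith) hba
      have hy1 : y < 1 := by rw [hy, div_lt_one hba]; linarith
      have hy2 : y * ((c.pt b).1 - (c.pt a).1) = u - (c.pt a).1 := div_mul_cancel₀ _ hba.ne'
      have hH : 0 < (1 - y) * (c.pt a).2 + y * (c.pt b).2 := by
        have ha := c.pt_snd_nonneg a
        have hb := c.pt_snd_nonneg b
        have h1y : 0 < 1 - y := by linarith
        rcases ha.lt_or_eq with ha' | ha'
        · positivity
        · have : 0 < (c.pt b).2 := by linarith
          positivity
      -- The abscissa of the ray fixes the parameter `y` on the edge; the height there, divided by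
      -- `c.ray.2`, is the parameter on the ray.
      refine ⟨((1 - y) * (c.pt a).2 + y * (c.pt b).2) / c.ray.2, div_pos hH hl, 1 - y, y,
        by linarith, hy0, by ring, ?_⟩
      refine Prod.ext ?_ ?_
      · simp only [Prod.fst_add, Prod.smul_fst, smul_eq_mul]
        linarith
      · simp only [Prod.snd_add, Prod.smul_snd, smul_eq_mul]
        rw [div_mul_cancel₀ _ hl.ne']
    simp only [hmem]
    have h' := h
    rw [bel_boundary (joins_fst_snd e) hi] at h'
    unfold left at h'
    have hi' : ¬ (Sum.inr i = G.fst e ∨ Sum.inr i = G.snd e) := fun h =>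
      hi ((joins_fst_snd e).inc_iff.2 h)
    rw [not_or] at hi'
    rcases lt_or_gt_of_ne (c.pt_ne_boundary (Ne.symm hi'.1)) with ha | ha <;>
      rcases lt_or_gt_of_ne (c.pt_ne_boundary (Ne.symm hi'.2)) with hb | hb
    · rw [bit_true ha, bit_true hb] at h'
      exact absurd h' (by decide)
    · exact key _ _ (joins_fst_snd e) ha hb
    · rw [openSegment_symm]
      exact key _ _ (joins_fst_snd e).symm hb ha
    · rw [bit_false ha.not_gt, bit_false hb.not_gt] at h'
      exact absurd h' (by decide)

open Classical in
/-- The number of intersections with the gauge rays modulo two. -/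
theorem edgeInt_cast [Finite E] (e : E) :
    ((c.edgeInt e : ℕ) : ZMod 2) = ∑ i with i ∈ G.sources c.orient, c.bel (Sum.inr i) e := by
  have h1 : {i ∈ G.sources c.orient | ∃ s : ℝ, 0 < s ∧
      c.pos (Sum.inr i) + s • c.ray ∈ openSegment ℝ (c.pos (G.fst e)) (c.pos (G.snd e))} =
      ((Finset.univ.filter fun i => i ∈ G.sources c.orient).filter
        fun i => c.bel (Sum.inr i) e = 1 : Finset (Fin n)) := by
    ext i
    simp only [ray_meets_iff, Finset.coe_filter, Finset.mem_filter, Finset.mem_univ, true_and]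
  unfold edgeInt
  rw [h1, Set.ncard_coe_finset, Finset.card_filter, Nat.cast_sum]
  refine Finset.sum_congr rfl fun i _ => ?_
  generalize c.bel (Sum.inr i) e = z
  revert z
  decide

end Frame

end PBDTPGraph

end

/-! ### Counting in perfect orientations, and the winding of paths and polygons. -/

noncomputable section

namespace PBDTPGraph

variable {n : ℕ} {V E : Type*} {G : PBDTPGraph n V E}

/-! ### Perfect orientations -/

theorem mem_sources_of_src {O : E → Bool} {e : E} {i : Fin n} (h : G.src O e = Sum.inr i) :
    i ∈ G.sources O := ⟨e, h⟩

theorem tgt_of_notMem_sources {O : E → Bool} {e : E} {i : Fin n} (h : i ∉ G.sources O)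
    (he : G.Inc e (Sum.inr i)) : G.tgt O e = Sum.inr i :=
  ((inc_iff_src_or_tgt O).1 he).resolve_left fun h' => h (mem_sources_of_src h')

section Orientation

variable [Fintype E]

open Classical in
/-- The edges entering the internal vertex `v`. -/
def inEdges (G : PBDTPGraph n V E) (O : E → Bool) (v : V) : Finset E :=
  {e | G.tgt O e = Sum.inl v}

open Classical in
/-- The edges leaving the internal vertex `v`. -/
def outEdges (G : PBDTPGraph n V E) (O : E → Bool) (v : V) : Finset E :=
  {e | G.src O e = Sum.inl v}

theorem mem_inEdges {O : E → Bool} {v : V} {e : E} :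
    e ∈ G.inEdges O v ↔ G.tgt O e = Sum.inl v := by simp [inEdges]

theorem mem_outEdges {O : E → Bool} {v : V} {e : E} :
    e ∈ G.outEdges O v ↔ G.src O e = Sum.inl v := by simp [outEdges]

theorem ncard_setOf_eq_card (p : E → Prop) [DecidablePred p] :
    {e | p e}.ncard = (Finset.univ.filter p).card := by
  rw [← Set.ncard_coe_finset]; simp

theorem card_inEdges (O : E → Bool) (v : V) :
    (G.inEdges O v).card = {e | G.tgt O e = Sum.inl v}.ncard := by
  classical
  rw [ncard_setOf_eq_card, inEdges]

theorem card_outEdges (O : E → Bool) (v : V) :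
    (G.outEdges O v).card = {e | G.src O e = Sum.inl v}.ncard := by
  classical
  rw [ncard_setOf_eq_card, outEdges]

theorem card_inEdges_add_card_outEdges (O : E → Bool) (v : V) :
    (G.inEdges O v).card + (G.outEdges O v).card = G.deg v := by
  classical
  unfold deg
  rw [card_inEdges, card_outEdges]
  simp only [ncard_setOf_eq_card, Finset.card_filter]
  rw [← Finset.sum_add_distrib, ← Finset.sum_add_distrib]
  refine Finset.sum_congr rfl fun e _ => ?_
  unfold src tgt
  cases O e
  · rfl
  · exact add_comm _ _

open Classical in
/-- The number of edges leaving `v` in every perfect orientation. -/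
def outDeg (G : PBDTPGraph n V E) (v : V) : ℕ := if G.deg v = 3 ∧ G.isWhite v then 2 else 1

theorem IsPerfect.card_outEdges {O : E → Bool} (h : G.IsPerfect O) (v : V) :
    (G.outEdges O v).card = G.outDeg v := by
  obtain ⟨h1, h2, h3⟩ := h v
  rw [← PBDTPGraph.card_inEdges, ← PBDTPGraph.card_outEdges] at h1
  rw [← PBDTPGraph.card_inEdges] at h2
  rw [← PBDTPGraph.card_outEdges] at h3
  have hsum := card_inEdges_add_card_outEdges (G := G) O v
  unfold outDeg
  split_ifs with h
  · have := h2 h.1 h.2; omega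
  · rcases G.deg_internal v with hd | hd
    · exact (h1 hd).2
    · exact h3 hd fun hw => h ⟨hd, hw⟩

/-- The colour of the vertex decides the alternative uniformly in the orientation, so two
orientations can be compared vertex by vertex in just two cases. -/
theorem IsPerfect.card_inEdges_eq_or (G : PBDTPGraph n V E) (v : V) :
    (∀ O, G.IsPerfect O → (G.inEdges O v).card = 1) ∨
      (∀ O, G.IsPerfect O → (G.outEdges O v).card = 1) := by
  by_cases h : G.deg v = 3 ∧ G.isWhite v
  · left
    intro O hO
    have h1 := hO.card_outEdges v
    have hsum := card_inEdges_add_card_outEdges (G := G) O v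
    rw [outDeg, if_pos h] at h1
    omega
  · right
    intro O hO
    rw [hO.card_outEdges, outDeg, if_neg h]

theorem IsPerfect.outEdges_nonempty {O : E → Bool} (h : G.IsPerfect O) (v : V) :
    (G.outEdges O v).Nonempty := by
  rw [← Finset.card_pos, h.card_outEdges, outDeg]
  split_ifs <;> norm_num

theorem IsPerfect.inEdges_nonempty {O : E → Bool} (h : G.IsPerfect O) (v : V) :
    (G.inEdges O v).Nonempty := by
  rw [← Finset.card_pos]
  have h1 := h.card_outEdges v
  have hsum := card_inEdges_add_card_outEdges (G := G) O v
  have hd := G.deg_internal v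
  change G.deg v = 2 ∨ G.deg v = 3 at hd
  unfold outDeg at h1
  split_ifs at h1 with h2 <;> omega

/-- At an internal vertex two incoming and two outgoing edges cannot be all distinct. -/
theorem IsPerfect.eq_or_eq {O : E → Bool} (h : G.IsPerfect O) {v : V} {e e' f f' : E}
    (he : G.tgt O e = Sum.inl v) (he' : G.tgt O e' = Sum.inl v) (hf : G.src O f = Sum.inl v)
    (hf' : G.src O f' = Sum.inl v) : e = e' ∨ f = f' := by
  rcases IsPerfect.card_inEdges_eq_or G v with h1 | h1
  · exact Or.inl (Finset.card_le_one.1 (h1 O h).le _ (mem_inEdges.2 he) _ (mem_inEdges.2 he'))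
  · exact Or.inr (Finset.card_le_one.1 (h1 O h).le _ (mem_outEdges.2 hf) _ (mem_outEdges.2 hf'))

theorem src_of_mem_sources {O : E → Bool} {e : E} {i : Fin n} (h : i ∈ G.sources O)
    (he : G.Inc e (Sum.inr i)) : G.src O e = Sum.inr i := by
  obtain ⟨d, hd⟩ := h
  obtain rfl := eq_of_inc_boundary he (hd ▸ inc_src O d)
  exact hd

theorem notMem_sources_of_tgt {O : E → Bool} {e : E} {i : Fin n} (h : G.tgt O e = Sum.inr i) :
    i ∉ G.sources O := by
  intro hi
  have h1 := src_of_mem_sources hi (h ▸ inc_tgt O e)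
  have := joins_src_tgt (G := G) O e
  rw [h, h1] at this
  exact not_joins_boundary this

theorem exists_internal_of_consecutive {O : E → Bool} {e f : E} (h : G.tgt O e = G.src O f) :
    ∃ v, G.tgt O e = Sum.inl v := by
  rcases hx : G.tgt O e with v | j
  · exact ⟨v, rfl⟩
  · exact absurd (mem_sources_of_src (h ▸ hx)) (notMem_sources_of_tgt hx)

open Classical in
/-- The sum of a function over the initial vertices of the edges. -/
theorem IsPerfect.sum_src [Fintype V] {M : Type*} [AddCommMonoid M] {O : E → Bool}
    (h : G.IsPerfect O) (φ : V ⊕ Fin n → M) :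
    ∑ e, φ (G.src O e) = ∑ v, G.outDeg v • φ (Sum.inl v) +
      ∑ i with i ∈ G.sources O, φ (Sum.inr i) := by
  have h1 : ∑ e, φ (G.src O e) = ∑ x, ∑ e with G.src O e = x, φ (G.src O e) :=
    (Finset.sum_fiberwise _ _ _).symm
  have h2 : ∀ x, ∑ e with G.src O e = x, φ (G.src O e) =
      (Finset.univ.filter fun e => G.src O e = x).card • φ x := by
    intro x
    rw [Finset.card_eq_sum_ones, Finset.sum_smul]
    refine Finset.sum_congr rfl fun e he => ?_
    rw [(Finset.mem_filter.1 he).2, one_smul]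
  rw [h1, Fintype.sum_sum_type]
  congr 1
  · refine Finset.sum_congr rfl fun v _ => ?_
    rw [h2, ← h.card_outEdges, outEdges]
  · rw [Finset.sum_filter]
    refine Finset.sum_congr rfl fun i _ => ?_
    rw [h2]
    split_ifs with hi
    · obtain ⟨e, he⟩ := hi
      have : (Finset.univ.filter fun e => G.src O e = Sum.inr i) = {e} := by
        ext d
        simp only [Finset.mem_filter, Finset.mem_univ, true_and, Finset.mem_singleton]
        refine ⟨fun hd => eq_of_inc_boundary (hd ▸ inc_src O d) (he ▸ inc_src O e), ?_⟩
        rintro rfl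
        exact he
      rw [this, Finset.card_singleton, one_smul]
    · have : (Finset.univ.filter fun e => G.src O e = Sum.inr i) = ∅ := by
        refine Finset.filter_eq_empty_iff.2 fun e _ he => hi ⟨e, he⟩
      rw [this, Finset.card_empty, zero_smul]

-- Edges are counted by their initial vertices; the internal contribution `outDeg` does not depend
-- on the orientation.
open Classical in
theorem IsPerfect.card_sources_eq [Fintype V] {O O' : E → Bool} (h : G.IsPerfect O)
    (h' : G.IsPerfect O') :
    (Finset.univ.filter fun i => i ∈ G.sources O).card =
      (Finset.univ.filter fun i => i ∈ G.sources O').card := by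
  have h1 := h.sum_src fun _ => (1 : ℕ)
  have h2 := h'.sum_src fun _ => (1 : ℕ)
  rw [Finset.card_eq_sum_ones, Finset.card_eq_sum_ones]
  omega

open Classical in
/-- The sum of a function modulo two over the ends of the edges on which two orientations
differ. -/
theorem IsPerfect.sum_flip [Fintype V] {O O' : E → Bool} (h : G.IsPerfect O)
    (h' : G.IsPerfect O') (φ : V ⊕ Fin n → ZMod 2) :
    ∑ d with O d ≠ O' d, (φ (G.fst d) + φ (G.snd d)) =
      ∑ i with i ∈ G.sources O, φ (Sum.inr i) + ∑ i with i ∈ G.sources O', φ (Sum.inr i) := by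
  -- On a reversed edge the two initial vertices are its two ends; on an unreversed edge they
  -- coincide and cancel modulo two.
  have h1 : ∑ d with O d ≠ O' d, (φ (G.fst d) + φ (G.snd d)) =
      ∑ e, (φ (G.src O e) + φ (G.src O' e)) := by
    rw [Finset.sum_filter]
    refine Finset.sum_congr rfl fun e _ => ?_
    unfold src
    cases O e <;> cases O' e <;> simp [add_self_zmod_two, add_comm]
  rw [h1, Finset.sum_add_distrib, h.sum_src, h'.sum_src]
  linear_combination add_self_zmod_two (∑ v, G.outDeg v • φ (Sum.inl v))

end Orientation

namespace Frame

open Plane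

variable {c : G.Frame}

/-! ### Polygonal paths and polygons -/

theorem bel_add_abv {x a b : V ⊕ Fin n} {e : E} (h : G.Joins e a b) (hx : ¬ G.Inc e x) :
    c.bel x e + c.abv x e = bit (LexLt (c.pt a) (c.pt x)) + bit (LexLt (c.pt b) (c.pt x)) := by
  rw [bel_eq h, abv_eq h]
  refine below_add_above fun hs h0 => ?_
  have key : ∀ a b, G.Joins e a b → (c.pt a).1 ≤ (c.pt x).1 → (c.pt x).1 ≤ (c.pt b).1 →
      height (c.pt a) (c.pt b) (c.pt x) = 0 → False := by
    intro a b h h1 h2 h0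
    have hab := lt_of_le_of_ne (h1.trans h2) (c.pt_fst_ne_of_joins h)
    have hmem : c.pt x ∈ segment ℝ (c.pt a) (c.pt b) := by
      refine mem_segment_of_abscissa hab h1 h2 ?_
      rcases mul_eq_zero.1 h0 with h0 | h0
      · exact absurd h0 (sub_ne_zero.2 hab.ne')
      · simp only [cross, Prod.fst_sub, Prod.snd_sub] at h0
        linarith
    rw [← insert_endpoints_openSegment] at hmem
    rcases hmem with h' | h' | h'
    · exact hx (c.pt_injective h' ▸ h.inc_left)
    · exact hx (c.pt_injective h' ▸ h.inc_right)
    · exact c.pt_notMem_openSegment h _ h'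
  have hne : ∀ y, G.Inc e y → c.pt y ≠ c.pt x := fun y hy h' => hx (c.pt_injective h' ▸ hy)
  rcases LexLt.total (hne a h.inc_left) with ha | ha <;>
    rcases LexLt.total (hne b h.inc_right) with hb | hb
  · rw [strip, bit_true ha, bit_true hb] at hs
    exact hs rfl
  · exact key a b h ha.le hb.le h0
  · exact key b a h.symm hb.le ha.le (by rw [height_comm, h0])
  · rw [strip, bit_false ha.asymm, bit_false hb.asymm] at hs
    exact hs rfl

theorem sum_range_telescope {m : ℕ} (f : ℕ → ZMod 2) :
    ∑ k ∈ Finset.range m, (f k + f (k + 1)) = f 0 + f m := by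
  induction m with
  | zero => simp [add_self_zmod_two]
  | succ m ih =>
    rw [Finset.sum_range_succ, ih]
    linear_combination add_self_zmod_two (f m)

/-- Induction on the last edge. Its `under` with every earlier nonadjacent edge is zero; the sum of
these zeros telescopes and moves the `abv` terms from the old end of the path to the new one, at the
cost of one `bel` term at the start. -/
theorem sum_under_path (O : E → Bool) (e : ℕ → E) (m : ℕ)
    (hchain : ∀ k < m, G.tgt O (e k) = G.src O (e (k + 1)))
    (hna : ∀ i j, i + 2 ≤ j → j ≤ m → ∀ x, G.Inc (e i) x → ¬ G.Inc (e j) x) :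
    ∑ k ∈ Finset.range m, c.under (e k) (e (k + 1)) =
      ∑ k ∈ Finset.range m, c.bel (G.src O (e 0)) (e (k + 1)) +
        ∑ k ∈ Finset.range m, c.abv (G.tgt O (e m)) (e k) := by
  induction m with
  | zero => simp
  | succ m ih =>
    have ih := ih (fun k hk => hchain k (by omega)) (fun i j h1 h2 => hna i j h1 (by omega))
    have h1 : ∑ k ∈ Finset.range m, (c.bel (G.src O (e k)) (e (m + 1)) +
        c.bel (G.src O (e (k + 1))) (e (m + 1))) +
        ∑ k ∈ Finset.range m, (c.abv (G.tgt O (e m)) (e k) + c.abv (G.tgt O (e (m + 1))) (e k)) =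
        0 := by
      rw [← Finset.sum_add_distrib]
      refine Finset.sum_eq_zero fun k hk => ?_
      have hk := Finset.mem_range.1 hk
      have := under_eq_zero (c := c) (hna k (m + 1) (by omega) le_rfl)
      rw [under_eq (joins_src_tgt O _) (joins_src_tgt O _), hchain k (by omega),
        ← hchain m (by omega)] at this
      rw [← this]; ring
    rw [sum_range_telescope fun k => c.bel (G.src O (e k)) (e (m + 1)),
      Finset.sum_add_distrib] at h1
    have h2 : c.under (e m) (e (m + 1)) =
        c.bel (G.src O (e m)) (e (m + 1)) + c.abv (G.tgt O (e (m + 1))) (e m) := by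
      rw [under_eq (joins_src_tgt O _) (joins_src_tgt O _), hchain m (by omega),
        bel_eq_zero (inc_src O _), abv_eq_zero (hchain m (by omega) ▸ inc_tgt O (e m))]
      ring
    rw [Finset.sum_range_succ, ih, h2, Finset.sum_range_succ, Finset.sum_range_succ]
    have h3 := add_self_zmod_two (∑ k ∈ Finset.range m, c.abv (G.tgt O (e m)) (e k))
    have h4 := add_self_zmod_two (c.bel (G.src O (e m)) (e (m + 1)))
    have h5 := add_self_zmod_two (c.bel (G.src O (e 0)) (e (m + 1)))
    have h6 := add_self_zmod_two (∑ k ∈ Finset.range m, c.abv (G.tgt O (e (m + 1))) (e k))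
    linear_combination h3 + h4 - h1

/-- The winding number of a simple polygon is odd. -/
theorem sum_under_cycle (O : E → Bool) (e : ℕ → E) (s : ℕ)
    (hchain : ∀ k < s + 2, G.tgt O (e k) = G.src O (e (k + 1)))
    (hclose : G.tgt O (e (s + 2)) = G.src O (e 0))
    (hsrc : ∀ i j, i ≤ s + 2 → j ≤ s + 2 → G.src O (e i) = G.src O (e j) → i = j) :
    ∑ k ∈ Finset.range (s + 2), c.under (e k) (e (k + 1)) + c.under (e (s + 2)) (e 0) = 1 := by
  have hna : ∀ i j, i + 2 ≤ j → j ≤ s + 2 → (i ≠ 0 ∨ j ≠ s + 2) →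
      ∀ x, G.Inc (e i) x → ¬ G.Inc (e j) x := by
    intro i j h1 h2 h3 x hx hx'
    rw [(joins_src_tgt O _).inc_iff, hchain i (by omega)] at hx
    rw [(joins_src_tgt O _).inc_iff] at hx'
    rcases h2.lt_or_eq with h2 | h2
    · rw [hchain j h2] at hx'
      rcases hx with rfl | rfl <;> rcases hx' with h | h <;>
        have := hsrc _ _ (by omega) (by omega) h <;> omega
    · rw [h2, hclose] at hx'
      rcases hx with rfl | rfl <;> rcases hx' with h | h <;>
        have := hsrc _ _ (by omega) (by omega) h <;> omega
  set z := G.src O (e (s + 2)) with hz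
  set o := G.src O (e 0) with ho
  set y := G.src O (e 1) with hy
  -- The polygon is cut open: without its closing edge it is a path from `o` to `z`. The turns at
  -- `z` and `o` are treated in `hlast` and `hwrap`.
  have hpath := sum_under_path (c := c) O e (s + 1) (fun k hk => hchain k (by omega))
    (fun i j h1 h2 => hna i j h1 (by omega) (Or.inr (by omega)))
  rw [hchain (s + 1) (by omega), ← ho] at hpath
  change _ = _ + ∑ k ∈ Finset.range (s + 1), c.abv z (e k) at hpath
  have hlast : c.under (e (s + 1)) (e (s + 2)) =
      c.bel (G.src O (e (s + 1))) (e (s + 2)) + c.abv o (e (s + 1)) := by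
    rw [under_eq (joins_src_tgt O _) (joins_src_tgt O _), hchain (s + 1) (by omega), hclose,
      bel_eq_zero (inc_src O _), abv_eq_zero (hchain (s + 1) (by omega) ▸ inc_tgt O _)]
    ring
  have hwrap : c.under (e (s + 2)) (e 0) = c.bel z (e 0) + c.abv y (e (s + 2)) := by
    rw [under_eq (joins_src_tgt O _) (joins_src_tgt O _), hclose, hchain 0 (by omega),
      bel_eq_zero (inc_src O _), abv_eq_zero (x := o) (e := e (s + 2)) (hclose ▸ inc_tgt O (e (s + 2)))]
    ring
  -- The closing edge is disjoint from all edges except its two neighbours.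
  have hpairs : ∑ k ∈ Finset.range s, (c.bel (G.src O (e (k + 1))) (e (s + 2)) +
      c.bel (G.src O (e (k + 1 + 1))) (e (s + 2))) +
      ∑ k ∈ Finset.range s, (c.abv z (e (k + 1)) + c.abv o (e (k + 1))) = 0 := by
    rw [← Finset.sum_add_distrib]
    refine Finset.sum_eq_zero fun k hk => ?_
    have hk := Finset.mem_range.1 hk
    have := under_eq_zero (c := c) (hna (k + 1) (s + 2) (by omega) le_rfl (Or.inl (by omega)))
    rw [under_eq (joins_src_tgt O _) (joins_src_tgt O _), hchain (k + 1) (by omega), hclose]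
      at this
    rw [← this]; ring
  rw [sum_range_telescope fun k => c.bel (G.src O (e (k + 1))) (e (s + 2)),
    Finset.sum_add_distrib] at hpairs
  have hstrip : ∀ x k, k < s + 2 → ¬ G.Inc (e k) x → c.bel x (e k) + c.abv x (e k) =
      bit (LexLt (c.pt (G.src O (e k))) (c.pt x)) +
        bit (LexLt (c.pt (G.src O (e (k + 1)))) (c.pt x)) := by
    intro x k hk hx
    rw [bel_add_abv (joins_src_tgt O _) hx, hchain k hk]
  have hinc : ∀ i k, k < s + 2 → i ≤ s + 2 → i ≠ k → i ≠ k + 1 →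
      ¬ G.Inc (e k) (G.src O (e i)) := by
    intro i k hk hi h1 h2 h
    rw [(joins_src_tgt O _).inc_iff, hchain k hk] at h
    rcases h with h | h
    · exact h1 (hsrc _ _ hi (by omega) h)
    · exact h2 (hsrc _ _ hi (by omega) h)
  have hsum : ∑ k ∈ Finset.range (s + 1), (c.bel o (e (k + 1)) + c.abv o (e (k + 1))) =
      bit (LexLt (c.pt y) (c.pt o)) + bit (LexLt (c.pt z) (c.pt o)) := by
    rw [← sum_range_telescope fun k => bit (LexLt (c.pt (G.src O (e (k + 1)))) (c.pt o))]
    refine Finset.sum_congr rfl fun k hk => ?_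
    have hk := Finset.mem_range.1 hk
    exact hstrip o (k + 1) (by omega) (hinc 0 (k + 1) (by omega) (by omega) (by omega) (by omega))
  have hz0 := hstrip z 0 (by omega) (hinc (s + 2) 0 (by omega) le_rfl (by omega) (by omega))
  have hy0 : c.bel y (e (s + 2)) + c.abv y (e (s + 2)) =
      bit (LexLt (c.pt z) (c.pt y)) + bit (LexLt (c.pt o) (c.pt y)) := by
    rw [bel_add_abv (joins_src_tgt O _), hclose]
    rw [(joins_src_tgt O _).inc_iff, hclose, not_or]
    constructor <;> intro h <;> have := hsrc _ _ (by omega) (by omega) h <;> omega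
  have ne : ∀ i j, i ≤ s + 2 → j ≤ s + 2 → i ≠ j →
      c.pt (G.src O (e i)) ≠ c.pt (G.src O (e j)) :=
    fun i j hi hj hij h => hij (hsrc i j hi hj (c.pt_injective h))
  -- After telescoping only the comparisons between `o`, `y` and `z` survive. Each of the three
  -- pairs contributes one, and three is odd.
  have t1 : bit (LexLt (c.pt y) (c.pt o)) + bit (LexLt (c.pt o) (c.pt y)) = 1 :=
    bit_lexLt_add (ne 1 0 (by omega) (by omega) (by omega))
  have t2 : bit (LexLt (c.pt z) (c.pt o)) + bit (LexLt (c.pt o) (c.pt z)) = 1 :=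
    bit_lexLt_add (ne (s + 2) 0 (by omega) (by omega) (by omega))
  have t3 : bit (LexLt (c.pt z) (c.pt y)) + bit (LexLt (c.pt y) (c.pt z)) = 1 :=
    bit_lexLt_add (ne (s + 2) 1 (by omega) (by omega) (by omega))
  rw [Finset.sum_add_distrib, Finset.sum_range_succ (fun k => c.abv o (e (k + 1)))] at hsum
  rw [Finset.sum_range_succ, hpath, hlast, hwrap,
    Finset.sum_range_succ' (fun k => c.abv z (e k))]
  change _ = bit (LexLt (c.pt o) (c.pt z)) + bit (LexLt (c.pt y) (c.pt z)) at hz0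
  have d1 := add_self_zmod_two (c.bel (G.src O (e (s + 1))) (e (s + 2)))
  have d2 := add_self_zmod_two (∑ k ∈ Finset.range s, c.abv z (e (k + 1)))
  have d3 := add_self_zmod_two (c.bel y (e (s + 2)))
  have d4 := add_self_zmod_two (∑ k ∈ Finset.range s, c.abv o (e (k + 1)))
  have two : (2 : ZMod 2) = 0 := rfl
  simp only [zero_add] at hpairs
  linear_combination hsum + hz0 + hy0 + t1 + t2 + t3 - hpairs + d1 + d2 + two

end Frame

end PBDTPGraph

end

/-! ### Directed walks and their signs in acyclic orientations. -/

noncomputable section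

/-- The sign attached to a parity. -/
def sgn (a : ZMod 2) : ℤˣ := if a = 0 then 1 else -1

theorem sgn_zero : sgn 0 = 1 := rfl

theorem sgn_one : sgn 1 = -1 := rfl

theorem sgn_add (a b : ZMod 2) : sgn (a + b) = sgn a * sgn b := by
  revert a b; decide

theorem sgn_sum {ι : Type*} (s : Finset ι) (f : ι → ZMod 2) :
    sgn (∑ i ∈ s, f i) = ∏ i ∈ s, sgn (f i) := by
  classical
  induction s using Finset.induction_on with
  | empty => rfl
  | insert a s ha ih => rw [Finset.sum_insert ha, Finset.prod_insert ha, sgn_add, ih]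

theorem negOnePow_eq_sgn (k : ℤ) : k.negOnePow = sgn (k : ZMod 2) := by
  rcases Int.even_or_odd k with h | h
  · rw [Int.negOnePow_even k h, (ZMod.intCast_zmod_eq_zero_iff_dvd k 2).2 h.two_dvd]; rfl
  · obtain ⟨r, rfl⟩ := h
    rw [Int.negOnePow_odd _ ⟨r, rfl⟩]
    push_cast
    rw [show (2 : ZMod 2) = 0 from rfl, zero_mul, zero_add, sgn_one]

theorem neg_one_pow_eq_sgn (k : ℕ) : ((-1 : ℝ)) ^ k = ((sgn (k : ZMod 2) : ℤ) : ℝ) := by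
  rcases Nat.even_or_odd k with h | h
  · rw [h.neg_one_pow, (ZMod.natCast_eq_zero_iff k 2).2 h.two_dvd]; simp [sgn_zero]
  · obtain ⟨r, rfl⟩ := h
    rw [Odd.neg_one_pow ⟨r, rfl⟩]
    push_cast
    rw [show (2 : ZMod 2) = 0 from rfl, zero_mul, zero_add, sgn_one]
    simp

namespace PBDTPGraph

variable {n : ℕ} {V E : Type*} {G : PBDTPGraph n V E}

/-! ### Directed walks -/

theorem isWalk_cons {O : E → Bool} {e d : E} {j : Fin n} {P : List E} :
    G.IsWalk O e j (d :: P) ↔ d = e ∧ ((P = [] ∧ G.tgt O e = Sum.inr j) ∨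
      ∃ f, G.tgt O e = G.src O f ∧ G.IsWalk O f j P) := by
  unfold IsWalk
  cases P with
  | nil =>
    simp only [List.head?_cons, Option.some.injEq, List.isChain_singleton, List.getLast?_singleton,
      exists_eq_left', true_and, List.head?_nil, reduceCtorEq, false_and, and_false, exists_false,
      or_false]
    constructor
    · rintro ⟨rfl, h⟩; exact ⟨rfl, h⟩
    · rintro ⟨rfl, h⟩; exact ⟨rfl, h⟩
  | cons f P =>
    simp only [List.head?_cons, Option.some.injEq, List.isChain_cons_cons, reduceCtorEq, false_and,
      false_or, List.getLast?_cons_cons]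
    constructor
    · rintro ⟨rfl, ⟨h1, h2⟩, h3⟩
      exact ⟨rfl, f, h1, rfl, h2, h3⟩
    · rintro ⟨rfl, f', h1, rfl, h2, h3⟩
      exact ⟨rfl, ⟨h1, h2⟩, h3⟩

theorem not_isWalk_nil {O : E → Bool} {e : E} {j : Fin n} : ¬ G.IsWalk O e j [] := by
  rintro ⟨h, -⟩
  simp at h

theorem IsWalk.exists_cons {O : E → Bool} {e : E} {j : Fin n} {P : List E}
    (h : G.IsWalk O e j P) : ∃ P', P = e :: P' := by
  cases P with
  | nil => exact absurd h not_isWalk_nil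
  | cons d P => exact ⟨P, by rw [(isWalk_cons.1 h).1]⟩

theorem IsWalk.cons {O : E → Bool} {d e : E} {j : Fin n} {P : List E}
    (h : G.IsWalk O e j P) (hd : G.tgt O d = G.src O e) : G.IsWalk O d j (d :: P) :=
  isWalk_cons.2 ⟨rfl, Or.inr ⟨e, hd, h⟩⟩

theorem IsWalk.getD {O : E → Bool} {e : E} {j : Fin n} {P : List E} (h : G.IsWalk O e j P) (a : E) :
    ∃ m, P.length = m + 1 ∧ P.getD 0 a = e ∧
      (∀ k < m, G.tgt O (P.getD k a) = G.src O (P.getD (k + 1) a)) ∧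
      G.tgt O (P.getD m a) = Sum.inr j := by
  induction P generalizing e with
  | nil => exact absurd h not_isWalk_nil
  | cons d P ih =>
    obtain ⟨rfl, ⟨rfl, ht⟩ | ⟨f, hf, hP⟩⟩ := isWalk_cons.1 h
    · exact ⟨0, rfl, rfl, fun k hk => absurd hk (by omega), ht⟩
    · obtain ⟨m, h1, h2, h3, h4⟩ := ih hP
      refine ⟨m + 1, by rw [List.length_cons, h1], rfl, fun k hk => ?_, by simpa using h4⟩
      cases k with
      | zero =>
        rw [List.getD_cons_zero, List.getD_cons_succ, h2]
        exact hf
      | succ k =>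
        rw [List.getD_cons_succ, List.getD_cons_succ]
        exact h3 k (by omega)

/-- The relation of being consecutive for vertices of an oriented graph. -/
def Step (G : PBDTPGraph n V E) (O : E → Bool) (a b : V ⊕ Fin n) : Prop :=
  ∃ e, G.src O e = a ∧ G.tgt O e = b

theorem transGen_of_chain {O : E → Bool} {f : ℕ → E} {m : ℕ}
    (h : ∀ k < m, G.tgt O (f k) = G.src O (f (k + 1))) {a b : ℕ} (hab : a < b) (hb : b ≤ m) :
    Relation.TransGen (G.Step O) (G.src O (f a)) (G.src O (f b)) := by
  induction b with
  | zero => omega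
  | succ b ih =>
    have hstep : G.Step O (G.src O (f b)) (G.src O (f (b + 1))) := ⟨f b, rfl, h b (by omega)⟩
    rcases Nat.lt_succ_iff_lt_or_eq.1 hab with h' | rfl
    · exact (ih h' (by omega)).tail hstep
    · exact Relation.TransGen.single hstep

theorem IsAcyclic.src_ne {O : E → Bool} (hO : G.IsAcyclic O) {f : ℕ → E} {m : ℕ}
    (h : ∀ k < m, G.tgt O (f k) = G.src O (f (k + 1))) {a b : ℕ} (hab : a < b) (hb : b ≤ m) :
    G.src O (f a) ≠ G.src O (f b) := by
  intro h'
  have := transGen_of_chain h hab hb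
  rw [h'] at this
  exact hO _ this

theorem IsAcyclic.src_ne_tgt {O : E → Bool} (hO : G.IsAcyclic O) {f : ℕ → E} {m : ℕ}
    (h : ∀ k < m, G.tgt O (f k) = G.src O (f (k + 1))) {a b : ℕ} (hab : a ≤ b) (hb : b ≤ m) :
    G.src O (f a) ≠ G.tgt O (f b) := by
  intro h'
  have hstep : G.Step O (G.src O (f b)) (G.tgt O (f b)) := ⟨f b, rfl, rfl⟩
  rw [← h'] at hstep
  rcases hab.lt_or_eq with hab | rfl
  · exact hO _ ((transGen_of_chain h hab hb).tail hstep)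
  · exact hO _ (Relation.TransGen.single hstep)

/-- Acyclicity makes all vertices of a walk distinct, which gives the hypothesis of
`sum_under_path`. -/
theorem IsAcyclic.not_inc {O : E → Bool} (hO : G.IsAcyclic O) {f : ℕ → E} {m : ℕ}
    (h : ∀ k < m, G.tgt O (f k) = G.src O (f (k + 1))) {i j : ℕ} (hij : i + 2 ≤ j) (hj : j ≤ m)
    (x : V ⊕ Fin n) (hx : G.Inc (f i) x) : ¬ G.Inc (f j) x := by
  intro hx'
  rw [(joins_src_tgt O _).inc_iff, h i (by omega)] at hx
  rw [(joins_src_tgt O _).inc_iff] at hx'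
  rcases hx with rfl | rfl <;> rcases hx' with h' | h'
  · exact hO.src_ne h (by omega) hj h'
  · exact hO.src_ne_tgt h (by omega) hj h'
  · exact hO.src_ne h (by omega) hj h'
  · exact hO.src_ne_tgt h (by omega) hj h'

theorem IsAcyclic.nodup_of_isWalk {O : E → Bool} (hO : G.IsAcyclic O) {e : E} {j : Fin n}
    {P : List E} (h : G.IsWalk O e j P) : P.Nodup := by
  obtain ⟨m, h1, h2, h3, h4⟩ := h.getD e
  rw [List.nodup_iff_injective_getElem]
  rintro ⟨a, ha⟩ ⟨b, hb⟩ hab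
  simp only [Fin.mk.injEq]
  have key : ∀ a b, (hab : a < b) → (hb : b < P.length) → P[a]'(by omega) ≠ P[b] := by
    intro a b hab hb h'
    refine hO.src_ne h3 hab (by omega) ?_
    rw [List.getD_eq_getElem _ _ (by omega), List.getD_eq_getElem _ _ hb, h']
  rcases lt_trichotomy a b with h | h | h
  · exact absurd hab (key a b h hb)
  · exact h
  · exact absurd hab.symm (key b a h ha)

theorem IsAcyclic.finite_walks [Finite E] {O : E → Bool} (hO : G.IsAcyclic O) (e : E) (j : Fin n) :
    {P | G.IsWalk O e j P}.Finite := by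
  classical
  cases nonempty_fintype E
  refine (List.finite_length_le E (Fintype.card E)).subset fun P hP => ?_
  exact (hO.nodup_of_isWalk hP).length_le_card

theorem IsAcyclic.wellFounded [Finite E] {O : E → Bool} (hO : G.IsAcyclic O) :
    WellFounded fun d e => Relation.TransGen (G.Step O) (G.src O d) (G.src O e) := by
  have : IsTrans E fun d e => Relation.TransGen (G.Step O) (G.src O d) (G.src O e) :=
    ⟨fun _ _ _ h h' => h.trans h'⟩
  have : Std.Irrefl fun d e => Relation.TransGen (G.Step O) (G.src O d) (G.src O e) :=
    ⟨fun _ h => hO _ h⟩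
  exact Finite.wellFounded_of_trans_of_irrefl _

theorem IsAcyclic.wellFounded_swap [Finite E] {O : E → Bool} (hO : G.IsAcyclic O) :
    WellFounded fun e d => Relation.TransGen (G.Step O) (G.src O d) (G.src O e) := by
  have : IsTrans E fun e d => Relation.TransGen (G.Step O) (G.src O d) (G.src O e) :=
    ⟨fun _ _ _ h h' => h'.trans h⟩
  have : Std.Irrefl fun e d => Relation.TransGen (G.Step O) (G.src O d) (G.src O e) :=
    ⟨fun _ h => hO _ h⟩
  exact Finite.wellFounded_of_trans_of_irrefl _

/-- In an acyclic perfect orientation every walk can be extended backwards to a boundary source. -/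
theorem IsPerfect.exists_extension [Fintype E] {O : E → Bool} (hO : G.IsPerfect O)
    (hac : G.IsAcyclic O) (e : E) : ∃ (i : Fin n) (d : E) (Q : List E), G.src O d = Sum.inr i ∧
      ∀ j P, G.IsWalk O e j P → G.IsWalk O d j (Q ++ P) := by
  induction e using hac.wellFounded.induction with
  | h e ih =>
    rcases hx : G.src O e with v | i
    · obtain ⟨d, hd⟩ := hO.inEdges_nonempty v
      rw [mem_inEdges] at hd
      obtain ⟨i, d', Q, h1, h2⟩ := ih d (Relation.TransGen.single ⟨d, rfl, hd.trans hx.symm⟩)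
      refine ⟨i, d', Q ++ [d], h1, fun j P hP => ?_⟩
      rw [List.append_assoc]
      exact h2 j _ (hP.cons (hd.trans hx.symm))
    · exact ⟨i, e, [], hx, fun j P hP => hP⟩

/-- In an acyclic perfect orientation every edge is the first edge of a walk to a boundary sink. -/
theorem IsPerfect.exists_isWalk [Fintype E] {O : E → Bool} (hO : G.IsPerfect O)
    (hac : G.IsAcyclic O) (e : E) : ∃ j P, G.IsWalk O e j P := by
  induction e using hac.wellFounded_swap.induction with
  | h e ih =>
    rcases hx : G.tgt O e with v | j
    · obtain ⟨f, hf⟩ := hO.outEdges_nonempty v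
      rw [mem_outEdges] at hf
      obtain ⟨j, P, hP⟩ := ih f (Relation.TransGen.single ⟨e, rfl, hx.trans hf.symm⟩)
      exact ⟨j, e :: P, hP.cons (hx.trans hf.symm)⟩
    · exact ⟨j, [e], isWalk_cons.2 ⟨rfl, Or.inl ⟨rfl, hx⟩⟩⟩

theorem IsWalk.notMem_sources [Finite E] {O : E → Bool} {e : E} {j : Fin n} {P : List E}
    (h : G.IsWalk O e j P) : j ∉ G.sources O := by
  cases nonempty_fintype E
  obtain ⟨-, -, f, -, hf⟩ := h
  exact notMem_sources_of_tgt hf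

namespace Frame

open Plane

variable (c : G.Frame)

/-! ### Signs of walks -/

open Classical in
/-- The number modulo two of the boundary sources that follow `x` in the horizontal order. -/
def gamma (x : V ⊕ Fin n) : ZMod 2 := ∑ i with i ∈ G.sources c.orient, c.left i x

/-- The gauge that removes the intersection numbers from the signs. -/
def rho (e : E) : ZMod 2 := (c.edgeInt e : ZMod 2) + c.gamma (G.tgt c.orient e)

variable {c}

theorem edgeInt_eq (e : E) :
    (c.edgeInt e : ZMod 2) = c.rho e + c.gamma (G.tgt c.orient e) := by
  unfold rho
  linear_combination -add_self_zmod_two (c.gamma (G.tgt c.orient e))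

/-- Each ray contributes `left` at both ends of the edge. The part at the final vertex cancels
against `gamma`, leaving a function of the initial vertex alone. -/
theorem rho_of_internal [Fintype E] {e : E} {v : V} (h : G.src c.orient e = Sum.inl v) :
    c.rho e = c.gamma (Sum.inl v) := by
  classical
  unfold rho gamma
  rw [edgeInt_cast, ← Finset.sum_add_distrib]
  refine Finset.sum_congr rfl fun i hi => ?_
  rw [bel_boundary (joins_src_tgt c.orient e), h]
  · linear_combination add_self_zmod_two (c.left i (G.tgt c.orient e))
  · intro hinc
    have := src_of_mem_sources (Finset.mem_filter.1 hi).2 hinc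
    rw [h] at this
    cases this

/-- The ray from `b_i` does not cross the edge at `b_i`, although that edge may leave to its left;
the extra term corrects for this. -/
theorem rho_of_boundary [Fintype E] {e : E} {i : Fin n} (h : G.src c.orient e = Sum.inr i) :
    c.rho e = c.gamma (Sum.inr i) + c.left i (G.tgt c.orient e) := by
  classical
  unfold rho gamma
  have hi : i ∈ Finset.univ.filter fun i => i ∈ G.sources c.orient :=
    Finset.mem_filter.2 ⟨Finset.mem_univ _, e, h⟩
  have h1 : c.left i (G.tgt c.orient e) = ∑ s with s ∈ G.sources c.orient,
      if s = i then c.left i (G.tgt c.orient e) else 0 := by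
    rw [Finset.sum_ite_eq', if_pos hi]
  rw [edgeInt_cast, ← Finset.sum_add_distrib, h1, ← Finset.sum_add_distrib]
  refine Finset.sum_congr rfl fun s hs => ?_
  split_ifs with hsi
  · subst hsi
    rw [bel_eq_zero (h ▸ inc_src _ _), left_self]
  · rw [bel_boundary (joins_src_tgt c.orient e), h]
    · linear_combination add_self_zmod_two (c.left s (G.tgt c.orient e))
    · intro hinc
      have := src_of_mem_sources (Finset.mem_filter.1 hs).2 hinc
      rw [h] at this
      exact hsi (Sum.inr_injective this).symm

theorem wind_cons_cons (e f : E) (P : List E) :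
    c.wind (e :: f :: P) = c.localWind e f + c.wind (f :: P) := by
  rw [wind]

theorem wind_singleton (e : E) : c.wind [e] = 0 := by rw [wind]; simp

theorem wind_append (Q : List E) (e : E) (P : List E) :
    c.wind (Q ++ e :: P) = c.wind (Q ++ [e]) + c.wind (e :: P) := by
  induction Q with
  | nil => rw [List.nil_append, List.nil_append, wind_singleton, zero_add]
  | cons d Q ih =>
    cases Q with
    | nil =>
      simp only [List.cons_append, List.nil_append]
      rw [wind_cons_cons, wind_cons_cons, wind_singleton]; ring
    | cons f Q =>
      simp only [List.cons_append] at ih ⊢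
      rw [wind_cons_cons, wind_cons_cons, ih]; ring

theorem walkInt_cons (e : E) (P : List E) :
    c.walkInt (e :: P) = c.edgeInt e + c.walkInt P := by
  simp [walkInt]

theorem walkInt_append (Q P : List E) : c.walkInt (Q ++ P) = c.walkInt Q + c.walkInt P := by
  simp [walkInt]

theorem wind_cast (P : List E) (a : E) {m : ℕ} (h : P.length = m + 1) :
    ((c.wind P : ℤ) : ZMod 2) =
      ∑ k ∈ Finset.range m, ((c.localWind (P.getD k a) (P.getD (k + 1) a) : ℤ) : ZMod 2) := by
  induction P generalizing m with
  | nil => simp at h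
  | cons e P ih =>
    cases P with
    | nil =>
      obtain rfl : m = 0 := by simpa using h.symm
      simp [wind_singleton]
    | cons f P =>
      obtain ⟨k, rfl⟩ : ∃ k, m = k + 1 := ⟨P.length, by simpa using h.symm⟩
      rw [wind_cons_cons, Int.cast_add, ih (m := k) (by simpa using h), Finset.sum_range_succ']
      simp only [List.getD_cons_succ, List.getD_cons_zero]
      exact add_comm _ _

theorem walkInt_cast (P : List E) (a : E) :
    ((c.walkInt P : ℤ) : ZMod 2) =
      ∑ k ∈ Finset.range P.length, (c.edgeInt (P.getD k a) : ZMod 2) := by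
  induction P with
  | nil => simp [walkInt]
  | cons e P ih =>
    rw [walkInt_cons, Int.cast_add, ih, List.length_cons, Finset.sum_range_succ']
    simp [add_comm]

/-- At each inner vertex of the walk the `gamma` of the incoming edge cancels the `rho` of the
outgoing one. -/
theorem sum_edgeInt_walk [Fintype E] {f : ℕ → E} {m : ℕ}
    (h : ∀ k < m, G.tgt c.orient (f k) = G.src c.orient (f (k + 1))) :
    ∑ k ∈ Finset.range (m + 1), (c.edgeInt (f k) : ZMod 2) =
      c.rho (f 0) + c.gamma (G.tgt c.orient (f m)) := by
  induction m with
  | zero => simp [edgeInt_eq]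
  | succ m ih =>
    rw [Finset.sum_range_succ, ih fun k hk => h k (by omega), edgeInt_eq (f (m + 1))]
    have h1 := h m (by omega)
    obtain ⟨v, hv⟩ := exists_internal_of_consecutive h1
    rw [rho_of_internal (e := f (m + 1)) (h1 ▸ hv), hv]
    linear_combination add_self_zmod_two (c.gamma (Sum.inl v))

/-- The sign of a walk from a boundary source to a boundary sink in an acyclic orientation. -/
theorem sign_of_source_walk [Fintype E] (hac : G.IsAcyclic c.orient) {e : E} {i j : Fin n}
    {P : List E} (hi : G.src c.orient e = Sum.inr i) (hP : G.IsWalk c.orient e j P) :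
    ((c.wind P + c.walkInt P : ℤ) : ZMod 2) = (G.sourcesBetween c.orient i j : ZMod 2) := by
  classical
  obtain ⟨m, h1, h2, h3, h4⟩ := hP.getD e
  have hj := hP.notMem_sources
  rw [Int.cast_add, wind_cast P e h1, walkInt_cast P e, h1]
  obtain ⟨f, hf⟩ : ∃ f : ℕ → E, ∀ k, P.getD k e = f k := ⟨_, fun _ => rfl⟩
  simp only [hf] at h2 h3 h4 ⊢
  rw [← h2] at hi
  rw [sum_edgeInt_walk h3, h4, rho_of_boundary hi]
  -- No boundary vertex is above an edge, so the `abv` sum at the sink vanishes, and the `bel` sum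
  -- at the source telescopes.
  have hw : ∑ k ∈ Finset.range m, ((c.localWind (f k) (f (k + 1)) : ℤ) : ZMod 2) =
      c.left i (G.tgt c.orient (f 0)) + c.left i (Sum.inr j) := by
    rw [Finset.sum_congr rfl fun k hk => localWind_cast (h3 k (Finset.mem_range.1 hk)),
      sum_under_path c.orient f m h3 (fun a b h h' => hac.not_inc h3 h h'), h4,
      Finset.sum_eq_zero (s := Finset.range m) (f := fun k => c.abv (Sum.inr j) _)
        fun k _ => abv_boundary _ _, add_zero, ← h4,
      ← sum_range_telescope fun k => c.left i (G.tgt c.orient (f k))]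
    refine Finset.sum_congr rfl fun k hk => ?_
    have hk := Finset.mem_range.1 hk
    rw [hi, bel_boundary (joins_src_tgt c.orient _), h3 k hk]
    rw [(joins_src_tgt c.orient _).inc_iff, ← hi, not_or]
    exact ⟨hac.src_ne h3 (by omega) (by omega), hac.src_ne_tgt h3 (by omega) (by omega)⟩
  rw [hw]
  have hsB : (G.sourcesBetween c.orient i j : ZMod 2) =
      ∑ s with s ∈ G.sources c.orient, bit (min i j < s ∧ s < max i j) := by
    have : {s ∈ G.sources c.orient | min i j < s ∧ s < max i j} =
        ((Finset.univ.filter fun i => i ∈ G.sources c.orient).filter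
          fun s => min i j < s ∧ s < max i j : Finset (Fin n)) := by
      ext s; simp
    unfold sourcesBetween
    rw [this, Set.ncard_coe_finset, Finset.card_filter, Nat.cast_sum]
    refine Finset.sum_congr rfl fun s _ => ?_
    unfold bit
    split_ifs <;> simp
  have hmem : i ∈ Finset.univ.filter fun i => i ∈ G.sources c.orient :=
    Finset.mem_filter.2 ⟨Finset.mem_univ _, f 0, hi⟩
  have hl : c.left i (Sum.inr j) = ∑ s with s ∈ G.sources c.orient,
      if s = i then c.left i (Sum.inr j) else 0 := by
    rw [Finset.sum_ite_eq', if_pos hmem]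
  -- A source other than `i` contributes to the sum of the two `gamma` exactly when it separates `i`
  -- from `j`. The contribution of `i` itself is cancelled by the last term.
  have hmain : c.gamma (Sum.inr i) + c.gamma (Sum.inr j) + c.left i (Sum.inr j) =
      (G.sourcesBetween c.orient i j : ZMod 2) := by
    rw [hsB, hl, gamma, gamma, ← Finset.sum_add_distrib, ← Finset.sum_add_distrib]
    refine Finset.sum_congr rfl fun s hs => ?_
    have hsj : s ≠ j := by
      rintro rfl
      exact hj (Finset.mem_filter.1 hs).2
    split_ifs with h
    · subst h
      rw [left_self, bit_false, zero_add, add_self_zmod_two]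
      rintro ⟨h1, h2⟩
      rcases le_total s j with h | h
      · rw [min_eq_left h] at h1
        exact lt_irrefl _ h1
      · rw [max_eq_left h] at h2
        exact lt_irrefl _ h2
    · unfold left
      rw [bit_congr c.pt_boundary_lt_iff, bit_congr c.pt_boundary_lt_iff, add_zero]
      rcases lt_or_gt_of_ne h with h1 | h1 <;> rcases lt_or_gt_of_ne hsj with h2 | h2
      · rw [bit_true h1, bit_true h2, bit_false fun h => ?_]; · rfl
        exact (lt_min h1 h2).not_gt h.1
      · rw [bit_true h1, bit_false h2.not_gt, bit_true, add_zero]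
        exact ⟨(min_le_right _ _).trans_lt h2, h1.trans_le (le_max_left _ _)⟩
      · rw [bit_false h1.not_gt, bit_true h2, bit_true, zero_add]
        exact ⟨(min_le_left _ _).trans_lt h1, h2.trans_le (le_max_right _ _)⟩
      · rw [bit_false h1.not_gt, bit_false h2.not_gt, bit_false fun h => ?_, add_zero]
        exact (max_lt h1 h2).not_gt h.2
  rw [← hmain]
  linear_combination add_self_zmod_two (c.left i (G.tgt c.orient (f 0)))

end Frame

open PBDTPGraph.Frame in
/-- In an acyclic orientation the sign of a walk depends only on its first edge and its sink; the
dependence on the sink does not involve the drawing. -/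
theorem exists_walk_sign [Fintype E] {O : E → Bool} (hO : G.IsPerfect O) (hac : G.IsAcyclic O) :
    ∃ i : E → Fin n, ∀ c : G.Frame, c.orient = O → ∃ τ : E → ZMod 2, ∀ e j P,
      G.IsWalk O e j P →
        ((c.wind P + c.walkInt P : ℤ) : ZMod 2) = τ e + (G.sourcesBetween O (i e) j : ZMod 2) := by
  choose i d Q h1 h2 using hO.exists_extension hac
  refine ⟨i, fun c hc => ?_⟩
  subst hc
  -- `τ e` is the sign of the backward extension chosen for `e`, including the turn into `e`.
  refine ⟨fun e => ((c.wind (Q e ++ [e]) + c.walkInt (Q e) : ℤ) : ZMod 2), fun e j P hP => ?_⟩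
  rw [← sign_of_source_walk hac (h1 e) (h2 e j P hP)]
  obtain ⟨P', rfl⟩ := hP.exists_cons
  rw [wind_append, walkInt_append]
  push_cast
  linear_combination -add_self_zmod_two ((c.wind (Q e ++ [e]) : ℤ) : ZMod 2) -
    add_self_zmod_two ((c.walkInt (Q e) : ℤ) : ZMod 2)

end PBDTPGraph

end

/-! ### The transfer matrix, its determinant, and rationality of the edge vectors. -/

noncomputable section

/-! ### Evaluation of rational functions -/

theorem rationalValue_eq {E : Type*} {F : MvPowerSeries E ℤ} {x : E → ℝ} {y : ℝ}
    (h : IsRationalValue F x y) : rationalValue F x = y := by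
  have h' : ∃ y, IsRationalValue F x y := ⟨y, h⟩
  rw [rationalValue, dif_pos h']
  exact h'.choose_spec.unique h

theorem MvPolynomial.aeval_pos_of_ne_zero {E : Type*} {Q : MvPolynomial E ℕ} (hQ : Q ≠ 0)
    {w : E → ℝ} (hw : ∀ e, 0 < w e) : 0 < MvPolynomial.aeval w Q := by
  classical
  rw [MvPolynomial.aeval_def, MvPolynomial.eval₂_eq]
  refine Finset.sum_pos (fun d hd => ?_) (MvPolynomial.support_nonempty.2 hQ)
  refine mul_pos ?_ (Finset.prod_pos fun e _ => pow_pos (hw e) _)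
  have := Nat.pos_of_ne_zero (MvPolynomial.mem_support_iff.1 hd)
  simpa using this

namespace PBDTPGraph

variable {n : ℕ} {V E : Type*} {G : PBDTPGraph n V E}

theorem weight_pos {O : E → Bool} {w : E → ℝ} (hw : ∀ e, 0 < w e) (e : E) :
    0 < weight O w e := by
  unfold weight
  split_ifs
  · exact hw e
  · exact inv_pos.2 (hw e)

namespace Frame

variable (c : G.Frame)

/-- Straight edges with the same ends would share their midpoint. -/
theorem joins_injective (c : G.Frame) {e f : E} {a b : V ⊕ Fin n} (he : G.Joins e a b)
    (hf : G.Joins f a b) : e = f := by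
  by_contra h
  refine Set.disjoint_left.1 (c.disjoint_openSegment h he hf)
    (?_ : (1 / 2 : ℝ) • c.pt a + (1 / 2 : ℝ) • c.pt b ∈ _) ?_ <;>
  exact ⟨1 / 2, 1 / 2, by norm_num, by norm_num, by norm_num, rfl⟩

/-- The sign of a pair of consecutive edges. -/
def edgeSign (e f : E) : ZMod 2 := c.edgeInt e + c.under e f

/-! ### The signs of simple directed cycles -/

section Cycle

variable [Fintype E] [DecidableEq E]

/-- A permutation of the edges is a flow if it maps each edge to itself or to a subsequent one. -/
def IsFlow (σ : Equiv.Perm E) : Prop :=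
  ∀ e, σ e ≠ e → G.tgt c.orient e = G.src c.orient (σ e)

variable {c}

/-- The orbit of the permutation is a simple directed polygon: its winding is odd and its number of
ray crossings is even. -/
theorem sum_edgeSign_cycle {σ : Equiv.Perm E} (hσ : σ.IsCycle) (hf : c.IsFlow σ) :
    ∑ e ∈ σ.support, c.edgeSign e (σ e) = 1 := by
  classical
  obtain ⟨x, hx, -⟩ := id hσ
  have hon : σ.IsCycleOn σ.support := by
    have hs : (σ.support : Set E) = {x | σ x ≠ x} := by ext; simp
    rw [hs]
    exact hσ.isCycleOn
  have hxs : x ∈ σ.support := Equiv.Perm.mem_support.2 hx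
  set f : ℕ → E := fun k => (σ ^ k) x with hfdef
  have hfs : ∀ k, f k ∈ σ.support := fun k => by simpa [hfdef] using hx
  have hsucc : ∀ k, σ (f k) = f (k + 1) := fun k => by
    simp only [hfdef, pow_succ', Equiv.Perm.mul_apply]
  have hstep : ∀ k, G.tgt c.orient (f k) = G.src c.orient (f (k + 1)) := fun k => by
    rw [← hsucc]
    exact hf _ (Equiv.Perm.mem_support.1 (hfs k))
  have hper : f σ.support.card = x := hon.pow_card_apply hxs
  have hinj : ∀ i j, i < σ.support.card → j < σ.support.card → f i = f j → i = j := by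
    intro i j hi hj h
    have := (hon.pow_apply_eq_pow_apply hxs).1 h
    rwa [Nat.ModEq, Nat.mod_eq_of_lt hi, Nat.mod_eq_of_lt hj] at this
  have himg : σ.support = (Finset.range σ.support.card).image f := by
    ext e
    rw [Finset.mem_image]
    constructor
    · intro he
      obtain ⟨k, hk, h⟩ := hon.exists_pow_eq hxs he
      exact ⟨k, Finset.mem_range.2 hk, h⟩
    · rintro ⟨k, -, rfl⟩
      exact hfs k
  have hsum : ∑ e ∈ σ.support, c.edgeSign e (σ e) =
      ∑ k ∈ Finset.range σ.support.card, c.edgeSign (f k) (f (k + 1)) := by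
    conv_lhs => rw [himg]
    rw [Finset.sum_image]
    · exact Finset.sum_congr rfl fun k _ => by rw [hsucc]
    · intro i hi j hj h
      exact hinj i j (by simpa using hi) (by simpa using hj) h
  have htwo := hσ.two_le_card_support
  -- Two edges forming a cycle would have the same ends. So there are at least three, as the polygon
  -- lemma requires.
  have hthree : σ.support.card ≠ 2 := by
    intro h2
    rw [h2] at hper hinj
    have h0 := joins_src_tgt (G := G) c.orient (f 0)
    have h1 := joins_src_tgt (G := G) c.orient (f 1)
    rw [hstep] at h0
    rw [hstep, hper] at h1
    have := c.joins_injective h0 h1.symm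
    exact absurd (hinj 0 1 (by omega) (by omega) this) (by omega)
  obtain ⟨s, hs⟩ : ∃ s, σ.support.card = s + 3 := ⟨σ.support.card - 3, by omega⟩
  rw [hs] at hsum hper hinj
  -- Passing twice through a vertex would need two incoming and two outgoing edges there, which a
  -- perfect orientation excludes.
  have hsrc : ∀ i j, i ≤ s + 2 → j ≤ s + 2 →
      G.src c.orient (f i) = G.src c.orient (f j) → i = j := by
    intro i j hi hj h
    have hpred : ∀ k, ∃ d, G.tgt c.orient d = G.src c.orient (f k) ∧ σ d = f k := by
      intro k
      obtain ⟨d, hd⟩ := σ.surjective (f k)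
      refine ⟨d, ?_, hd⟩
      rw [← hd]
      refine hf d fun h' => Equiv.Perm.mem_support.1 (hfs k) ?_
      rw [← hd, h', h']
    obtain ⟨d, hd, hd'⟩ := hpred i
    obtain ⟨d2, hd2, hd2'⟩ := hpred j
    obtain ⟨v, hv⟩ := exists_internal_of_consecutive hd
    have : d = d2 ∨ f i = f j :=
      c.perfect.eq_or_eq hv (hd2.trans (h.symm.trans (hd.symm.trans hv))) (hd.symm.trans hv)
        (h.symm.trans (hd.symm.trans hv))
    refine hinj i j (by omega) (by omega) ?_
    rcases this with rfl | h
    · rw [← hd', hd2']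
    · exact h
  have hclose : G.tgt c.orient (f (s + 2)) = G.src c.orient (f 0) := by
    rw [hstep, hper]; rfl
  have hcycle := sum_under_cycle (c := c) c.orient f s (fun k _ => hstep k) hclose hsrc
  have hint : ∑ k ∈ Finset.range (s + 3), (c.edgeInt (f k) : ZMod 2) = 0 := by
    rw [sum_edgeInt_walk fun k _ => hstep k, hclose]
    obtain ⟨v, hv⟩ := exists_internal_of_consecutive hclose
    rw [rho_of_internal (e := f 0) (hclose ▸ hv), ← hclose, hv, add_self_zmod_two]
  rw [hsum]
  unfold edgeSign
  rw [Finset.sum_add_distrib, hint, Finset.sum_range_succ]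
  have : f (s + 2 + 1) = f 0 := hper
  rw [this, hcycle, zero_add]

/-- A cycle of length l has permutation sign (-1)^(l-1); the minus signs of the entries give (-1)^l
and the odd sign of the polygon gives one more -1. The product is one, and it is multiplicative over
disjoint cycles. -/
theorem sign_mul_prod_flow (σ : Equiv.Perm E) (hf : c.IsFlow σ) :
    (Equiv.Perm.sign σ) * ∏ e, (if σ e = e then 1 else -sgn (c.edgeSign e (σ e))) = 1 := by
  induction σ using Equiv.Perm.cycle_induction_on with
  | base_one => simp
  | base_cycles σ hσ =>
    have h1 : ∏ e, (if σ e = e then 1 else -sgn (c.edgeSign e (σ e))) =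
        ∏ e ∈ σ.support, -sgn (c.edgeSign e (σ e)) := by
      rw [Finset.prod_ite, Finset.prod_const_one, one_mul]
      refine Finset.prod_congr ?_ fun _ _ => rfl
      ext e
      simp
    rw [h1, Finset.prod_neg, ← sgn_sum, sum_edgeSign_cycle hσ hf, hσ.sign, sgn_one]
    rw [mul_neg_one, neg_mul_neg, ← mul_pow]
    simp
  | induction_disjoint σ τ hd hσ ihσ ihτ =>
    have hfix : ∀ e, σ e ≠ e → τ e = e := fun e he => (hd e).resolve_left he
    have hfix' : ∀ e, τ e ≠ e → σ e = e := fun e he => (hd e).resolve_right he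
    have hσ' : ∀ e, σ e ≠ e → (σ * τ) e = σ e := fun e he => by
      rw [Equiv.Perm.mul_apply, hfix e he]
    have hτ' : ∀ e, τ e ≠ e → (σ * τ) e = τ e := fun e he => by
      rw [hd.commute.eq, Equiv.Perm.mul_apply, hfix' e he]
    have iσ := ihσ fun e he => by
      have := hf e (by rwa [hσ' e he])
      rwa [hσ' e he] at this
    have iτ := ihτ fun e he => by
      have := hf e (by rwa [hτ' e he])
      rwa [hτ' e he] at this
    have hprod : ∏ e, (if (σ * τ) e = e then 1 else -sgn (c.edgeSign e ((σ * τ) e))) =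
        (∏ e, (if σ e = e then 1 else -sgn (c.edgeSign e (σ e)))) *
          ∏ e, (if τ e = e then 1 else -sgn (c.edgeSign e (τ e))) := by
      rw [← Finset.prod_mul_distrib]
      refine Finset.prod_congr rfl fun e _ => ?_
      by_cases h1 : σ e = e
      · by_cases h2 : τ e = e
        · rw [if_pos h1, if_pos h2, if_pos (by rw [Equiv.Perm.mul_apply, h2, h1]), one_mul]
        · rw [hτ' e h2, if_pos h1, one_mul]
      · rw [hσ' e h1, if_pos (hfix e h1), mul_one]
    rw [Equiv.Perm.sign_mul, hprod]
    calc _ = (Equiv.Perm.sign σ * ∏ e, (if σ e = e then 1 else -sgn (c.edgeSign e (σ e)))) *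
        (Equiv.Perm.sign τ * ∏ e, (if τ e = e then 1 else -sgn (c.edgeSign e (τ e)))) := by
          ac_rfl
      _ = 1 := by rw [iσ, iτ, one_mul]

end Cycle

/-! ### The linear system satisfied by the edge series -/

variable {c}

/-- The monomial of a walk. -/
def content (P : List E) : E →₀ ℕ := (P.map fun a => Finsupp.single a 1).sum

theorem content_cons (e : E) (P : List E) :
    content (e :: P) = Finsupp.single e 1 + content P := by
  simp [content]

theorem degree_content (P : List E) : Finsupp.degree (content P) = P.length := by
  induction P with
  | nil => simp [content]
  | cons e P ih => rw [content_cons, map_add, ih]; simp [add_comm]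

theorem finite_content_eq [Finite E] (m : E →₀ ℕ) : {P : List E | content P = m}.Finite := by
  refine (List.finite_length_eq E (Finsupp.degree m)).subset fun P hP => ?_
  exact (degree_content P).symm.trans (congrArg _ hP)

variable (c) in
/-- The sign of a walk. -/
def walkSign (P : List E) : ℤ := (c.wind P + c.walkInt P).negOnePow

theorem walkSign_singleton (e : E) : c.walkSign [e] = (sgn (c.edgeInt e : ZMod 2) : ℤ) := by
  rw [walkSign, negOnePow_eq_sgn]
  simp [wind_singleton, walkInt]

theorem walkSign_cons_cons {e f : E} (h : G.tgt c.orient e = G.src c.orient f) (P : List E) :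
    c.walkSign (e :: f :: P) = (sgn (c.edgeSign e f) : ℤ) * c.walkSign (f :: P) := by
  unfold walkSign
  rw [negOnePow_eq_sgn, negOnePow_eq_sgn, ← Units.val_mul, ← sgn_add, wind_cons_cons, walkInt_cons]
  push_cast
  rw [localWind_cast h, edgeSign]
  congr 2
  ring

variable (c) in
/-- The walks from `e` to `b_j` of a given content. -/
def walks (e : E) (j : Fin n) (m : E →₀ ℕ) : Set (List E) :=
  {P | G.IsWalk c.orient e j P ∧ content P = m}

theorem finite_walks [Finite E] (e : E) (j : Fin n) (m : E →₀ ℕ) : (c.walks e j m).Finite :=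
  (finite_content_eq m).subset fun _ hP => hP.2

theorem coeff_edgeSeries (e : E) (j : Fin n) (m : E →₀ ℕ) :
    MvPowerSeries.coeff m (c.edgeSeries e j) = ∑ᶠ P ∈ c.walks e j m, c.walkSign P := rfl

variable (c) in
open Classical in
/-- The transfer matrix of the oriented network. -/
def transfer : Matrix E E (MvPolynomial E ℤ) := fun e f =>
  if G.tgt c.orient e = G.src c.orient f then
    MvPolynomial.monomial (Finsupp.single e 1) (sgn (c.edgeSign e f) : ℤ) else 0

variable (c) in
open Classical in
/-- The inhomogeneous term of the linear system for the edge vectors. -/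
def sinkTerm (e : E) (j : Fin n) : MvPolynomial E ℤ :=
  if G.tgt c.orient e = Sum.inr j then
    MvPolynomial.monomial (Finsupp.single e 1) (sgn (c.edgeInt e : ZMod 2) : ℤ) else 0

theorem transfer_self (e : E) : c.transfer e e = 0 :=
  if_neg fun h => c.joins_ne (joins_src_tgt c.orient e) h.symm

section System

variable [Fintype E] [DecidableEq E]

/-- A walk is either the single edge `e` ending at the sink, or `e` followed by a walk from a
subsequent edge; signs and monomials multiply. -/
theorem edgeSeries_eq (e : E) (j : Fin n) :
    c.edgeSeries e j = (c.sinkTerm e j : MvPowerSeries E ℤ) +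
      ∑ f, (c.transfer e f : MvPowerSeries E ℤ) * c.edgeSeries f j := by
  classical
  ext m
  rw [map_add, map_sum, coeff_edgeSeries]
  have ht : ∀ f, MvPowerSeries.coeff m ((c.transfer e f : MvPowerSeries E ℤ) *
      c.edgeSeries f j) = if G.tgt c.orient e = G.src c.orient f ∧ Finsupp.single e 1 ≤ m then
        (sgn (c.edgeSign e f) : ℤ) * ∑ᶠ P ∈ c.walks f j (m - Finsupp.single e 1), c.walkSign P
        else 0 := by
    intro f
    unfold transfer
    by_cases h : G.tgt c.orient e = G.src c.orient f
    · rw [if_pos h, MvPolynomial.coe_monomial, MvPowerSeries.coeff_monomial_mul, coeff_edgeSeries]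
      simp [h]
    · rw [if_neg h, if_neg fun h' => h h'.1, MvPolynomial.coe_zero, zero_mul, map_zero]
  have hs : MvPowerSeries.coeff m (c.sinkTerm e j : MvPowerSeries E ℤ) =
      if G.tgt c.orient e = Sum.inr j ∧ m = Finsupp.single e 1 then
        (sgn (c.edgeInt e : ZMod 2) : ℤ) else 0 := by
    unfold sinkTerm
    by_cases h : G.tgt c.orient e = Sum.inr j
    · rw [if_pos h, MvPolynomial.coe_monomial, MvPowerSeries.coeff_monomial]
      simp [h]
    · rw [if_neg h, if_neg fun h' => h h'.1, MvPolynomial.coe_zero, map_zero]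
  rw [hs, Finset.sum_congr rfl fun f _ => ht f]
  by_cases hm : Finsupp.single e 1 ≤ m
  · obtain ⟨m', rfl⟩ := exists_add_of_le hm
    -- `T₀` and `T f` contain the possible tails: the empty one, and those beginning with `f`.
    set T₀ : Set (List E) := {P | P = [] ∧ G.tgt c.orient e = Sum.inr j ∧ m' = 0} with hT₀
    set T : E → Set (List E) := fun f =>
      {P | G.tgt c.orient e = G.src c.orient f ∧ P ∈ c.walks f j m'} with hT
    have himg : c.walks e j (Finsupp.single e 1 + m') = (List.cons e) '' (T₀ ∪ ⋃ f, T f) := by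
      ext P
      constructor
      · rintro ⟨hP, hP'⟩
        obtain ⟨Q, rfl⟩ := hP.exists_cons
        rw [content_cons, add_right_inj] at hP'
        refine ⟨Q, ?_, rfl⟩
        rcases (isWalk_cons.1 hP).2 with ⟨rfl, h⟩ | ⟨f, h, hQ⟩
        · exact Or.inl ⟨rfl, h, hP'.symm⟩
        · exact Or.inr (Set.mem_iUnion.2 ⟨f, h, hQ, hP'⟩)
      · rintro ⟨Q, hQ | hQ, rfl⟩
        · obtain ⟨rfl, h, rfl⟩ := hQ
          exact ⟨isWalk_cons.2 ⟨rfl, Or.inl ⟨rfl, h⟩⟩, by rw [content_cons]; rfl⟩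
        · obtain ⟨f, h, hQ, hQ'⟩ := Set.mem_iUnion.1 hQ
          exact ⟨hQ.cons h, by rw [content_cons, hQ']⟩
    have hTfin : ∀ f, (T f).Finite := fun f => (finite_walks f j m').subset fun P hP => hP.2
    have hT₀fin : T₀.Finite := (Set.finite_singleton []).subset fun P hP => hP.1
    have hdisj : Disjoint T₀ (⋃ f, T f) := by
      rw [Set.disjoint_left]
      rintro P ⟨rfl, -⟩ hP
      obtain ⟨f, -, hP, -⟩ := Set.mem_iUnion.1 hP
      exact not_isWalk_nil hP
    have hpair : Pairwise (Function.onFun Disjoint T) := by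
      intro f g hfg
      rw [Function.onFun, Set.disjoint_left]
      rintro P ⟨-, ⟨hP, -, -⟩, -⟩ ⟨-, ⟨hP', -, -⟩, -⟩
      rw [hP, Option.some.injEq] at hP'
      exact hfg hP'
    rw [himg, finsum_mem_image fun P _ Q _ h => (List.cons_injective h),
      finsum_mem_union hdisj hT₀fin (Set.finite_iUnion hTfin), finsum_mem_iUnion hpair hTfin,
      finsum_eq_sum_of_fintype (fun f => ∑ᶠ P ∈ T f, c.walkSign (e :: P))]
    congr 1
    · by_cases h : G.tgt c.orient e = Sum.inr j ∧ m' = 0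
      · have : T₀ = {[]} := by
          ext P
          exact and_iff_left h
        rw [this, finsum_mem_singleton, walkSign_singleton, if_pos ⟨h.1, by rw [h.2, add_zero]⟩]
      · have : T₀ = ∅ := Set.eq_empty_of_forall_notMem fun P hP => h hP.2
        rw [this, finsum_mem_empty, if_neg fun h' => h ⟨h'.1, by simpa using h'.2⟩]
    · refine Finset.sum_congr rfl fun f _ => ?_
      by_cases h : G.tgt c.orient e = G.src c.orient f
      · rw [if_pos ⟨h, hm⟩, add_tsub_cancel_left, mul_finsum_mem]
        have : T f = c.walks f j m' := by
          ext P
          exact and_iff_right h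
        rw [this]
        refine finsum_mem_congr rfl fun P hP => ?_
        obtain ⟨P', rfl⟩ := hP.1.exists_cons
        exact walkSign_cons_cons h P'
      · have : T f = ∅ := Set.eq_empty_of_forall_notMem fun P hP => h hP.1
        rw [this, finsum_mem_empty, if_neg fun h' => h h'.1]
  · have : c.walks e j m = ∅ := by
      refine Set.eq_empty_of_forall_notMem fun P hP => hm ?_
      obtain ⟨P', rfl⟩ := hP.1.exists_cons
      rw [← hP.2, content_cons]
      exact le_self_add
    rw [this, finsum_mem_empty, if_neg, Finset.sum_eq_zero, add_zero]
    · exact fun f _ => if_neg fun h' => hm h'.2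
    · rintro ⟨-, rfl⟩
      exact hm le_rfl

variable (c) in
open Classical in
/-- The determinant of the linear system, as a polynomial with natural coefficients. -/
def flowPolynomial : MvPolynomial E ℕ :=
  ∑ σ : Equiv.Perm E, if c.IsFlow σ then ∏ e, (if σ e = e then 1 else MvPolynomial.X e) else 0

/-- The identity permutation is a flow contributing one, and natural coefficients cannot cancel. -/
theorem flowPolynomial_ne_zero : c.flowPolynomial ≠ 0 := by
  classical
  intro h
  have h1 := congrArg (MvPolynomial.eval fun _ => (1 : ℕ)) h
  have h2 : ∀ σ : Equiv.Perm E, MvPolynomial.eval (fun _ => (1 : ℕ))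
      (if c.IsFlow σ then ∏ e, (if σ e = e then 1 else MvPolynomial.X e) else 0) =
      if c.IsFlow σ then 1 else 0 := by
    intro σ
    split_ifs
    · rw [map_prod]
      refine Finset.prod_eq_one fun e _ => ?_
      split_ifs <;> simp
    · simp
  rw [flowPolynomial, map_sum, map_zero, Finset.sum_congr rfl fun σ _ => h2 σ,
    Finset.sum_eq_zero_iff] at h1
  have := h1 1 (Finset.mem_univ _)
  rw [if_pos (show c.IsFlow 1 from fun e he => absurd rfl he)] at this
  exact one_ne_zero this

/-- In the Leibniz expansion a permutation that is not a flow meets a zero entry, while flows have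
total sign one by `sign_mul_prod_flow`. -/
theorem det_one_sub_transfer :
    (1 - c.transfer).det = MvPolynomial.map (Nat.castRingHom ℤ) c.flowPolynomial := by
  classical
  rw [← Matrix.det_transpose, Matrix.det_apply', flowPolynomial, map_sum]
  refine Finset.sum_congr rfl fun σ _ => ?_
  simp only [Matrix.transpose_apply, Matrix.sub_apply]
  by_cases hf : c.IsFlow σ
  · have h1 : ∀ e, (1 : Matrix E E (MvPolynomial E ℤ)) e (σ e) - c.transfer e (σ e) =
        (((if σ e = e then 1 else -sgn (c.edgeSign e (σ e)) : ℤˣ) : ℤ) : MvPolynomial E ℤ) *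
          (if σ e = e then 1 else MvPolynomial.X e) := by
      intro e
      by_cases he : σ e = e
      · rw [if_pos he, if_pos he, he, transfer_self]
        simp
      · rw [if_neg he, if_neg he, Matrix.one_apply_ne (Ne.symm he), transfer, if_pos (hf e he)]
        rw [← mul_one ((sgn (c.edgeSign e (σ e)) : ℤˣ) : ℤ), ← MvPolynomial.C_mul_monomial]
        simp [MvPolynomial.X]
    rw [if_pos hf, Finset.prod_congr rfl fun e _ => h1 e, Finset.prod_mul_distrib, ← mul_assoc]
    have h2 := congrArg (fun u : ℤˣ => ((u : ℤ) : MvPolynomial E ℤ)) (sign_mul_prod_flow σ hf)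
    simp only [Units.val_mul, Int.cast_mul, Units.val_one, Int.cast_one, Units.coe_prod,
      Int.cast_prod] at h2
    rw [h2, one_mul, map_prod]
    refine Finset.prod_congr rfl fun e _ => ?_
    split_ifs <;> simp
  · rw [if_neg hf, map_zero]
    unfold IsFlow at hf
    push Not at hf
    obtain ⟨e, he, he'⟩ := hf
    rw [Finset.prod_eq_zero (Finset.mem_univ e), mul_zero]
    rw [Matrix.one_apply_ne (Ne.symm he), transfer, if_neg he', sub_zero]

/-- Cramer's rule over the ring of formal power series: the system is multiplied by the adjugate. -/
theorem det_mul_edgeSeries (e : E) (j : Fin n) :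
    (MvPolynomial.map (Nat.castRingHom ℤ) c.flowPolynomial : MvPowerSeries E ℤ) *
      c.edgeSeries e j =
    ((∑ f, (1 - c.transfer).adjugate e f * c.sinkTerm f j : MvPolynomial E ℤ) :
      MvPowerSeries E ℤ) := by
  rw [← det_one_sub_transfer]
  set φ := MvPolynomial.coeToMvPowerSeries.ringHom (σ := E) (R := ℤ) with hφ
  have hB : ∀ f, φ (c.sinkTerm f j) =
      ((φ.mapMatrix (1 - c.transfer)).mulVec fun f => c.edgeSeries f j) f := by
    intro f
    have h := edgeSeries_eq (c := c) f j
    rw [map_sub, map_one, Matrix.sub_mulVec, Matrix.one_mulVec, Pi.sub_apply]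
    rw [eq_sub_iff_add_eq]
    exact h.symm
  change φ _ * _ = φ _
  rw [map_sum]
  simp only [map_mul, hB]
  have hadj : ∀ f, φ ((1 - c.transfer).adjugate e f) =
      (φ.mapMatrix (1 - c.transfer)).adjugate e f := fun f => by
    rw [← RingHom.map_adjugate]; rfl
  simp only [hadj]
  have h2 := congrFun (Matrix.mulVec_mulVec (fun f => c.edgeSeries f j)
    (φ.mapMatrix (1 - c.transfer)).adjugate (φ.mapMatrix (1 - c.transfer))) e
  rw [Matrix.adjugate_mul, Matrix.smul_mulVec, Matrix.one_mulVec, Pi.smul_apply,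
    smul_eq_mul] at h2
  rw [RingHom.map_det, ← h2]
  rfl

/-! ### The linear system satisfied by the edge vectors -/

variable {w : E → ℝ}

theorem aeval_flowPolynomial_pos (hw : ∀ e, 0 < w e) :
    0 < MvPolynomial.aeval (weight c.orient w)
      (MvPolynomial.map (Nat.castRingHom ℤ) c.flowPolynomial) := by
  rw [MvPolynomial.aeval_def, MvPolynomial.eval₂_map]
  have := MvPolynomial.aeval_pos_of_ne_zero (flowPolynomial_ne_zero (c := c))
    (weight_pos (O := c.orient) hw)
  rw [MvPolynomial.aeval_def] at this
  convert this
  exact Subsingleton.elim _ _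

theorem edgeVector_eq_div (hw : ∀ e, 0 < w e) (e : E) (j : Fin n) :
    c.edgeVector w e j =
      MvPolynomial.aeval (weight c.orient w)
        (∑ f, (1 - c.transfer).adjugate e f * c.sinkTerm f j) /
      MvPolynomial.aeval (weight c.orient w)
        (MvPolynomial.map (Nat.castRingHom ℤ) c.flowPolynomial) :=
  rationalValue_eq ⟨_, _, det_mul_edgeSeries e j, (aeval_flowPolynomial_pos hw).ne', rfl⟩

variable (c w) in
/-- The transfer matrix evaluated at the weights. -/
def realTransfer : Matrix E E ℝ :=
  (MvPolynomial.aeval (weight c.orient w) : MvPolynomial E ℤ →ₐ[ℤ] ℝ).mapMatrix c.transfer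

open Classical in
theorem realTransfer_apply (e f : E) :
    c.realTransfer w e f = if G.tgt c.orient e = G.src c.orient f then
      (sgn (c.edgeSign e f) : ℤ) * weight c.orient w e else 0 := by
  unfold realTransfer
  rw [AlgHom.mapMatrix_apply, Matrix.map_apply, transfer]
  split_ifs
  · rw [MvPolynomial.aeval_monomial]
    simp
  · simp

theorem det_one_sub_realTransfer :
    (1 - c.realTransfer w).det = MvPolynomial.aeval (weight c.orient w)
      (MvPolynomial.map (Nat.castRingHom ℤ) c.flowPolynomial) := by
  rw [← det_one_sub_transfer, AlgHom.map_det, map_sub, map_one]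
  rfl

-- The real system is recovered from Cramer's formula, so no convergence of the sums over walks is
-- needed; on a cyclic orientation they may diverge.
open Classical in
theorem edgeVector_system (hw : ∀ e, 0 < w e) (e : E) (j : Fin n) :
    c.edgeVector w e j = (if G.tgt c.orient e = Sum.inr j then
      ((sgn (c.edgeInt e : ZMod 2) : ℤ) : ℝ) * weight c.orient w e else 0) +
      ∑ f, c.realTransfer w e f * c.edgeVector w f j := by
  set ψ : MvPolynomial E ℤ →ₐ[ℤ] ℝ := MvPolynomial.aeval (weight c.orient w) with hψ
  have hB : ψ (c.sinkTerm e j) = if G.tgt c.orient e = Sum.inr j then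
      ((sgn (c.edgeInt e : ZMod 2) : ℤ) : ℝ) * weight c.orient w e else 0 := by
    unfold sinkTerm
    split_ifs
    · rw [hψ, MvPolynomial.aeval_monomial]
      simp
    · simp
  have hdet := (aeval_flowPolynomial_pos (c := c) hw).ne'
  rw [← hψ] at hdet
  have hX : (fun f => c.edgeVector w f j) = (ψ (MvPolynomial.map (Nat.castRingHom ℤ)
      c.flowPolynomial))⁻¹ • (1 - c.realTransfer w).adjugate.mulVec
        fun f => ψ (c.sinkTerm f j) := by
    funext e
    rw [edgeVector_eq_div hw, ← hψ, map_sum, Pi.smul_apply, smul_eq_mul, div_eq_inv_mul]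
    congr 1
    refine Finset.sum_congr rfl fun f _ => ?_
    rw [map_mul]
    congr 1
    have : (1 - c.realTransfer w) = ψ.mapMatrix (1 - c.transfer) := by
      rw [map_sub, map_one]; rfl
    rw [this, ← AlgHom.map_adjugate]
    rfl
  have key : (1 - c.realTransfer w).mulVec (fun f => c.edgeVector w f j) =
      fun f => ψ (c.sinkTerm f j) := by
    rw [hX, Matrix.mulVec_smul, Matrix.mulVec_mulVec, Matrix.mul_adjugate,
      det_one_sub_realTransfer, Matrix.smul_mulVec, Matrix.one_mulVec, smul_smul,
      inv_mul_cancel₀ hdet, one_smul]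
  rw [Matrix.sub_mulVec, Matrix.one_mulVec] at key
  have := congrFun key e
  rw [Pi.sub_apply, hB, sub_eq_iff_eq_add] at this
  exact this

/-- The determinant is a nonzero polynomial with natural coefficients at positive arguments, so the
homogeneous system has only the zero solution. -/
theorem eq_zero_of_system (hw : ∀ e, 0 < w e) {y : E → ℝ}
    (hy : ∀ e, y e = ∑ f, c.realTransfer w e f * y f) : y = 0 := by
  refine Matrix.eq_zero_of_mulVec_eq_zero (M := 1 - c.realTransfer w) ?_ ?_
  · rw [det_one_sub_realTransfer]
    exact (aeval_flowPolynomial_pos hw).ne'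
  · rw [Matrix.sub_mulVec, Matrix.one_mulVec, sub_eq_zero]
    funext e
    exact hy e

end System

end Frame

end PBDTPGraph

end

/-! ### Edge factors under a change of orientation. -/

noncomputable section

/-- The real sign attached to a parity. -/
def rsgn (a : ZMod 2) : ℝ := ((sgn a : ℤ) : ℝ)

theorem rsgn_zero : rsgn 0 = 1 := by simp [rsgn, sgn_zero]

theorem rsgn_one : rsgn 1 = -1 := by simp [rsgn, sgn_one]

theorem rsgn_add (a b : ZMod 2) : rsgn (a + b) = rsgn a * rsgn b := by
  simp [rsgn, sgn_add]

theorem rsgn_mul_self (a : ZMod 2) : rsgn a * rsgn a = 1 := by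
  rw [← rsgn_add, add_self_zmod_two, rsgn_zero]

theorem rsgn_ne_zero (a : ZMod 2) : rsgn a ≠ 0 := by
  intro h
  have := rsgn_mul_self a
  rw [h, zero_mul] at this
  exact zero_ne_one this

theorem rsgn_add_rsgn {a b : ZMod 2} (h : a + b = 1) : rsgn a + rsgn b = 0 := by
  obtain rfl : b = a + 1 := by linear_combination h - add_self_zmod_two a
  rw [rsgn_add, rsgn_one]; ring

namespace PBDTPGraph

variable {n : ℕ} {V E : Type*} {G : PBDTPGraph n V E}

namespace Frame

variable (c : G.Frame)

/-- The frame with the same drawing and another perfect orientation. -/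
def reorient (O : E → Bool) (h : G.IsPerfect O) : G.Frame := { c with orient := O, perfect := h }

variable {c}

theorem eq_of_tgt_eq {O O' : E → Bool} (c : G.Frame) {e : E} {x : V ⊕ Fin n}
    (h : G.tgt O e = x) (h' : G.tgt O' e = x) : O e = O' e := by
  have := c.fst_ne_snd e
  unfold tgt at h h'
  rcases hO : O e <;> rcases hO' : O' e <;> simp [hO, hO'] at h h' ⊢
  · exact this (h.trans h'.symm)
  · exact this (h'.trans h.symm)

theorem eq_of_src_eq {O O' : E → Bool} (c : G.Frame) {e : E} {x : V ⊕ Fin n}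
    (h : G.src O e = x) (h' : G.src O' e = x) : O e = O' e := by
  have := c.fst_ne_snd e
  unfold src at h h'
  rcases hO : O e <;> rcases hO' : O' e <;> simp [hO, hO'] at h h' ⊢
  · exact this (h'.trans h.symm)
  · exact this (h.trans h'.symm)

theorem ne_of_tgt_eq_src {O O' : E → Bool} (c : G.Frame) {e : E} {x : V ⊕ Fin n}
    (h : G.tgt O e = x) (h' : G.src O' e = x) : O e ≠ O' e := by
  intro hO
  have : G.src O e = G.src O' e := by unfold src; rw [hO]
  exact c.joins_ne (joins_src_tgt O e) ((this.trans h').trans h.symm)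

theorem tgt_congr {O O' : E → Bool} {e : E} (h : O e = O' e) : G.tgt O e = G.tgt O' e := by
  unfold tgt; rw [h]

theorem src_congr {O O' : E → Bool} {e : E} (h : O e = O' e) : G.src O e = G.src O' e := by
  unfold src; rw [h]

theorem weight_congr {O O' : E → Bool} {w : E → ℝ} {e : E} (h : O e = O' e) :
    weight O w e = weight O' w e := by unfold weight; rw [h]

theorem weight_mul_of_ne {O O' : E → Bool} {w : E → ℝ} (hw : ∀ e, 0 < w e) {e : E}
    (h : O e ≠ O' e) : weight O w e * weight O' w e = 1 := by
  have := (hw e).ne'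
  unfold weight
  rcases hO : O e <;> rcases hO' : O' e <;> simp [hO, hO', this] at h ⊢

/-! ### The side of the reversed paths on which an edge lies -/

section Side

variable [Fintype E] {O : E → Bool}

open Classical in
variable (c O) in
/-- The edges reversed between the orientation `O` and that of the frame. -/
def flips : Finset E := {d | c.orient d ≠ O d}

theorem mem_flips {d : E} : d ∈ c.flips O ↔ c.orient d ≠ O d := by
  simp [flips]

variable (c O) in
/-- The number modulo two of reversed edges over the vertex `x`. -/
def sideVertex (x : V ⊕ Fin n) : ZMod 2 := ∑ d ∈ c.flips O, c.bel x d

open Classical in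
variable (c O) in
/-- The number modulo two of reversed edges over the edge `g` near its end `x`. -/
def sideAt (g : E) (x : V ⊕ Fin n) : ZMod 2 :=
  c.sideVertex O x + ∑ d ∈ c.flips O with G.Inc d x, c.under g d

variable (c O) in
/-- The number modulo two of reversed edges over the edge `g`. -/
def side (g : E) : ZMod 2 := c.sideAt O g (G.fst g)

variable [Fintype V]

/-- The difference of the two sides is computed by summing `under g d` over all reversed edges. The
terms `abv` of ends over `g` reduce by `sum_flip` to boundary vertices, which are never above an
edge. -/
theorem sideAt_eq (hO : G.IsPerfect O) {g : E} {p q : V ⊕ Fin n} (h : G.Joins g p q) :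
    c.sideAt O g p = c.sideAt O g q := by
  classical
  have h1 : ∑ d ∈ c.flips O, c.under g d = c.sideVertex O p + c.sideVertex O q := by
    have h2 := c.perfect.sum_flip hO fun x => c.abv x g
    simp only [abv_boundary, Finset.sum_const_zero, add_zero] at h2
    have h3 : c.flips O = Finset.univ.filter fun d => c.orient d ≠ O d := by
      ext d; simp [mem_flips]
    rw [← h3] at h2
    rw [sideVertex, sideVertex, ← Finset.sum_add_distrib]
    have h4 : ∑ d ∈ c.flips O, c.under g d = ∑ d ∈ c.flips O, (c.bel p d + c.bel q d) +
        ∑ d ∈ c.flips O, (c.abv (G.fst d) g + c.abv (G.snd d) g) := by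
      rw [← Finset.sum_add_distrib]
      refine Finset.sum_congr rfl fun d _ => ?_
      rw [under_eq h (joins_fst_snd d)]
      ring
    rw [h4, h2, add_zero]
  -- Only reversed edges meeting `g` contribute. An edge meeting it at both ends is `g` itself, for
  -- which `under` is zero.
  have h5 : ∑ d ∈ c.flips O, c.under g d = ∑ d ∈ c.flips O with G.Inc d p, c.under g d +
      ∑ d ∈ c.flips O with G.Inc d q, c.under g d := by
    rw [Finset.sum_filter, Finset.sum_filter, ← Finset.sum_add_distrib]
    refine Finset.sum_congr rfl fun d _ => ?_
    by_cases hp : G.Inc d p <;> by_cases hq : G.Inc d q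
    · have hd : G.Joins d p q := by
        obtain ⟨y, hy⟩ := hp.exists_joins
        rcases hy.inc_iff.1 hq with h' | h'
        · exact absurd h'.symm (c.joins_ne h)
        · rwa [h']
      rw [c.joins_injective hd h, under_self]
      simp
    · simp [hp, hq]
    · simp [hp, hq]
    · rw [if_neg hp, if_neg hq, under_eq_zero, add_zero]
      intro x hx
      rcases h.inc_iff.1 hx with rfl | rfl
      · exact hp
      · exact hq
  unfold sideAt
  rw [h1] at h5
  have h6 := add_self_zmod_two (c.sideVertex O q)
  have h7 := add_self_zmod_two (∑ d ∈ c.flips O with G.Inc d p, c.under g d)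
  linear_combination h5 - h6 + h7

theorem side_eq (hO : G.IsPerfect O) {g : E} {x : V ⊕ Fin n} (h : G.Inc g x) :
    c.side O g = c.sideAt O g x := by
  obtain ⟨y, hy⟩ := h.exists_joins
  unfold side
  rcases hy with ⟨h1, -⟩ | ⟨h1, h2⟩
  · rw [h1]
  · rw [h1]
    exact (sideAt_eq hO (Or.inr ⟨h1, h2⟩)).symm

-- Being below an edge is expressed by `left k` at its ends, so `sum_flip` reduces the count to the
-- sources of the two orientations. The edge at `b_k`, if reversed, needs a separate correction.
open Classical in
theorem side_boundary (hO : G.IsPerfect O) {e : E} {k : Fin n} {y : V ⊕ Fin n}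
    (h : G.Joins e (Sum.inr k) y) :
    c.side O e = (if e ∈ c.flips O then 1 + c.left k y else 0) + c.gamma (Sum.inr k) +
      (c.reorient O hO).gamma (Sum.inr k) := by
  classical
  have hinc : ∀ d, G.Inc d (Sum.inr k) ↔ d = e := fun d =>
    ⟨fun hd => eq_of_inc_boundary hd h.inc_left, by rintro rfl; exact h.inc_left⟩
  have h1 : ∑ d ∈ c.flips O with G.Inc d (Sum.inr k), c.under e d = 0 := by
    refine Finset.sum_eq_zero fun d hd => ?_
    rw [(hinc d).1 (Finset.mem_filter.1 hd).2, under_self]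
  rw [side_eq hO h.inc_left, sideAt, h1, add_zero, sideVertex]
  have h2 : ∀ d ∈ c.flips O, c.bel (Sum.inr k) d =
      (c.left k (G.fst d) + c.left k (G.snd d)) + if d = e then c.left k y else 0 := by
    intro d _
    split_ifs with hd
    · subst hd
      rw [sum_ends h (c.left k), bel_eq_zero h.inc_left, left_self, zero_add, add_self_zmod_two]
    · rw [bel_boundary (joins_fst_snd d) fun h' => hd ((hinc d).1 h'), add_zero]
  rw [Finset.sum_congr rfl h2, Finset.sum_add_distrib, Finset.sum_ite_eq']
  have h3 : c.flips O = Finset.univ.filter fun d => c.orient d ≠ O d := by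
    ext d; simp [mem_flips]
  have h4 := c.perfect.sum_flip hO (c.left k)
  rw [← h3] at h4
  -- For `i ≠ k` exactly one of the two boundary vertices precedes the other; the cardinality and
  -- the indicator collect the resulting ones.
  have h5 : ∀ O' : E → Bool, ∑ i with i ∈ G.sources O', c.left k (Sum.inr i) =
      ∑ i with i ∈ G.sources O', c.left i (Sum.inr k) +
        ((Finset.univ.filter fun i => i ∈ G.sources O').card : ZMod 2) +
          if k ∈ G.sources O' then 1 else 0 := by
    intro O'
    have h6 : (if k ∈ G.sources O' then 1 else 0 : ZMod 2) =
        ∑ i with i ∈ G.sources O', if i = k then 1 else 0 := by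
      rw [Finset.sum_ite_eq']
      simp
    rw [h6, Finset.card_eq_sum_ones, Nat.cast_sum, ← Finset.sum_add_distrib,
      ← Finset.sum_add_distrib]
    refine Finset.sum_congr rfl fun i _ => ?_
    split_ifs with hik
    · subst hik
      rw [left_self, Nat.cast_one, zero_add, add_self_zmod_two]
    · rw [Nat.cast_one, ← left_add_left (c := c) hik, add_zero]
      linear_combination -add_self_zmod_two (c.left i (Sum.inr k))
  rw [h4, h5, h5, c.perfect.card_sources_eq hO]
  have h7 : (c.reorient O hO).gamma (Sum.inr k) =
      ∑ i with i ∈ G.sources O, c.left i (Sum.inr k) := rfl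
  have h8 : (if k ∈ G.sources c.orient then 1 else 0 : ZMod 2) +
      (if k ∈ G.sources O then 1 else 0 : ZMod 2) = if e ∈ c.flips O then 1 else 0 := by
    by_cases hk : k ∈ G.sources c.orient <;> by_cases hk' : k ∈ G.sources O
    · have := c.eq_of_src_eq (src_of_mem_sources hk h.inc_left) (src_of_mem_sources hk' h.inc_left)
      rw [if_pos hk, if_pos hk', if_neg fun h => mem_flips.1 h this]; rfl
    · have := c.ne_of_tgt_eq_src (tgt_of_notMem_sources hk' h.inc_left)
        (src_of_mem_sources hk h.inc_left)
      rw [if_pos hk, if_neg hk', if_pos (mem_flips.2 this.symm)]; rfl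
    · have := c.ne_of_tgt_eq_src (tgt_of_notMem_sources hk h.inc_left)
        (src_of_mem_sources hk' h.inc_left)
      rw [if_neg hk, if_pos hk', if_pos (mem_flips.2 this)]; rfl
    · have := c.eq_of_tgt_eq (tgt_of_notMem_sources hk h.inc_left)
        (tgt_of_notMem_sources hk' h.inc_left)
      rw [if_neg hk, if_neg hk', if_neg fun h => mem_flips.1 h this]; rfl
  rw [h7]
  have h9 := add_self_zmod_two
    ((Finset.univ.filter fun i => i ∈ G.sources O).card : ZMod 2)
  have h10 : (if e ∈ c.flips O then 1 + c.left k y else 0 : ZMod 2) =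
      (if e ∈ c.flips O then 1 else 0) + if e ∈ c.flips O then c.left k y else 0 := by
    split_ifs <;> simp
  rw [h10, ← h8, gamma]
  linear_combination h9

end Side

/-! ### The gauged linear system and its behaviour under a change of orientation -/

section Gauged

/-- Each pair contributes one plus two terms `right`, and every `right` occurs in two pairs. This
odd parity is the minus sign that appears when an equation at a vertex is solved for another edge.
-/
theorem under_cyclic_sum {v : V} {e f g : E} (hef : e ≠ f) (heg : e ≠ g) (hfg : f ≠ g)
    (he : G.Inc e (Sum.inl v)) (hf : G.Inc f (Sum.inl v)) (hg : G.Inc g (Sum.inl v)) :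
    c.under e f + c.under f e + (c.under e g + c.under g e) + (c.under f g + c.under g f) = 1 := by
  obtain ⟨x, hx⟩ := he.exists_joins
  obtain ⟨y, hy⟩ := hf.exists_joins
  obtain ⟨z, hz⟩ := hg.exists_joins
  rw [under_add_under hef hx hy, under_add_under heg hx hz, under_add_under hfg hy hz]
  linear_combination add_self_zmod_two (c.right (Sum.inl v) x) +
    add_self_zmod_two (c.right (Sum.inl v) y) + add_self_zmod_two (c.right (Sum.inl v) z) +
    add_self_zmod_two 1

variable [Fintype E]

variable (c) in
/-- The gauged linear system at the internal vertices. -/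
def IsSolution (w y : E → ℝ) : Prop :=
  ∀ e v, G.tgt c.orient e = Sum.inl v →
    y e = weight c.orient w e * ∑ f ∈ G.outEdges c.orient v, rsgn (c.under e f) * y f

variable {O : E → Bool} {w y : E → ℝ}

open Classical in
variable (c O w) in
/-- The factor relating the gauged edge vectors of two orientations. -/
def flipFactor (e : E) : ℝ := rsgn (c.side O e) * if e ∈ c.flips O then weight O w e else 1

theorem flipFactor_of_mem {e : E} (he : e ∈ c.flips O) :
    c.flipFactor O w e = rsgn (c.side O e) * weight O w e := by
  rw [flipFactor, if_pos he]

theorem flipFactor_of_notMem {e : E} (he : e ∉ c.flips O) :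
    c.flipFactor O w e = rsgn (c.side O e) := by
  rw [flipFactor, if_neg he, mul_one]

theorem flipFactor_ne_zero (hw : ∀ e, 0 < w e) (e : E) : c.flipFactor O w e ≠ 0 := by
  unfold flipFactor
  refine mul_ne_zero (rsgn_ne_zero _) ?_
  split_ifs
  · exact (weight_pos hw e).ne'
  · exact one_ne_zero

variable [Fintype V]

theorem side_of_filter (hO : G.IsPerfect O) {v : V} {e : E} {s : Finset E}
    (hs : ∀ d, (d ∈ c.flips O ∧ G.Inc d (Sum.inl v)) ↔ d ∈ s) (he : G.Inc e (Sum.inl v)) :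
    c.side O e = c.sideVertex O (Sum.inl v) + ∑ d ∈ s, c.under e d := by
  classical
  rw [side_eq hO he, sideAt]
  congr 2
  ext d
  rw [Finset.mem_filter, hs]

/-- Without reversed edges at `v`, all edges at `v` carry the same sign, so the relation is only
rescaled. -/
theorem isSolution_flip_of_unflipped (hO : G.IsPerfect O) {e : E} {v : V}
    (hv : ∀ d, G.Inc d (Sum.inl v) → d ∉ c.flips O) (he : G.tgt O e = Sum.inl v)
    (hy : c.IsSolution w y) :
    c.flipFactor O w e * y e = weight O w e *
      ∑ f ∈ G.outEdges O v, rsgn (c.under e f) * (c.flipFactor O w f * y f) := by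
  have hside : ∀ d, G.Inc d (Sum.inl v) →
      c.flipFactor O w d = rsgn (c.sideVertex O (Sum.inl v)) := by
    intro d hd
    rw [flipFactor_of_notMem (hv d hd), side_of_filter hO (s := ∅) _ hd, Finset.sum_empty, add_zero]
    exact fun d => ⟨fun h => absurd h.1 (hv d h.2), fun h => absurd h (Finset.notMem_empty d)⟩
  have hsame : ∀ d, G.Inc d (Sum.inl v) → c.orient d = O d := fun d hd => by
    have := hv d hd
    rwa [mem_flips, not_not] at this
  have heinc : G.Inc e (Sum.inl v) := he ▸ inc_tgt O e
  have hout : G.outEdges O v = G.outEdges c.orient v := by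
    ext f
    rw [mem_outEdges, mem_outEdges]
    constructor
    · intro h
      rw [src_congr (hsame f (h ▸ inc_src O f)), h]
    · intro h
      rw [← src_congr (hsame f (h ▸ inc_src c.orient f)), h]
  rw [hside e heinc, hy e v (by rw [tgt_congr (hsame e heinc), he]), weight_congr (hsame e heinc),
    hout, mul_left_comm, Finset.mul_sum]
  congr 1
  refine Finset.sum_congr rfl fun f hf => ?_
  rw [hside f (mem_outEdges.1 hf ▸ inc_src c.orient f)]
  ring

/-- The reversed edges at `v` are exactly the old incoming edge `e₁` and the new one `e`. The single
old relation, for `e₁`, is solved for `e`; the terms of the unreversed edges, gathered in `K`, must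
cancel. -/
theorem isSolution_flip_of_card_inEdges (hw : ∀ e, 0 < w e) (hO : G.IsPerfect O) {e : E} {v : V}
    (hin : (G.inEdges c.orient v).card = 1) (hin' : (G.inEdges O v).card = 1)
    (hf : ¬ ∀ d, G.Inc d (Sum.inl v) → d ∉ c.flips O) (he : G.tgt O e = Sum.inl v)
    (hy : c.IsSolution w y) :
    c.flipFactor O w e * y e = weight O w e *
      ∑ f ∈ G.outEdges O v, rsgn (c.under e f) * (c.flipFactor O w f * y f) := by
  classical
  obtain ⟨e₁, he₁⟩ := Finset.card_eq_one.1 hin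
  obtain ⟨e₀, he₀⟩ := Finset.card_eq_one.1 hin'
  have hin₁ : ∀ d, G.tgt c.orient d = Sum.inl v ↔ d = e₁ := fun d => by
    rw [← mem_inEdges, he₁, Finset.mem_singleton]
  have hin₀ : ∀ d, G.tgt O d = Sum.inl v ↔ d = e₀ := fun d => by
    rw [← mem_inEdges, he₀, Finset.mem_singleton]
  obtain rfl := (hin₀ e).1 he
  have ht₁ := (hin₁ e₁).2 rfl
  have hflip : ∀ d, G.Inc d (Sum.inl v) → (d ∈ c.flips O ↔ ¬ (d = e₁ ↔ d = e)) := by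
    intro d hd
    rw [mem_flips, ← hin₁, ← hin₀]
    rcases (inc_iff_src_or_tgt c.orient).1 hd with h | h <;>
      rcases (inc_iff_src_or_tgt O).1 hd with h' | h'
    · have h1 : G.tgt c.orient d ≠ Sum.inl v := fun h2 =>
        c.joins_ne (joins_src_tgt c.orient d) (h.trans h2.symm)
      have h2 : G.tgt O d ≠ Sum.inl v := fun h2 =>
        c.joins_ne (joins_src_tgt O d) (h'.trans h2.symm)
      simp [h1, h2, c.eq_of_src_eq h h']
    · have h1 : G.tgt c.orient d ≠ Sum.inl v := fun h2 =>
        c.joins_ne (joins_src_tgt c.orient d) (h.trans h2.symm)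
      simp [h1, h', (c.ne_of_tgt_eq_src h' h).symm]
    · have h2 : G.tgt O d ≠ Sum.inl v := fun h2 =>
        c.joins_ne (joins_src_tgt O d) (h'.trans h2.symm)
      simp [h, h2, c.ne_of_tgt_eq_src h h']
    · simp [h, h', c.eq_of_tgt_eq h h']
  have hne : e ≠ e₁ := by
    rintro rfl
    refine hf fun d hd => ?_
    rw [hflip d hd]
    exact not_not.2 Iff.rfl
  have hei : G.Inc e (Sum.inl v) := he ▸ inc_tgt O e
  have he₁i : G.Inc e₁ (Sum.inl v) := ht₁ ▸ inc_tgt c.orient e₁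
  have hef : e ∈ c.flips O := (hflip e hei).2 fun h => hne (h.2 rfl)
  have he₁f : e₁ ∈ c.flips O := (hflip e₁ he₁i).2 fun h => hne (h.1 rfl).symm
  have hpair : ∀ d, (d ∈ c.flips O ∧ G.Inc d (Sum.inl v)) ↔ d ∈ ({e, e₁} : Finset E) := by
    intro d
    rw [Finset.mem_insert, Finset.mem_singleton]
    constructor
    · rintro ⟨h1, h2⟩
      have := (hflip d h2).1 h1
      tauto
    · rintro (rfl | rfl)
      · exact ⟨hef, hei⟩
      · exact ⟨he₁f, he₁i⟩
  have hside : ∀ d, G.Inc d (Sum.inl v) → c.side O d =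
      c.sideVertex O (Sum.inl v) + (c.under d e + c.under d e₁) := by
    intro d hd
    rw [side_of_filter hO hpair hd, Finset.sum_pair hne]
  set K := (G.outEdges O v).erase e₁ with hK
  have hout₀ : insert e₁ K = G.outEdges O v := by
    refine Finset.insert_erase (mem_outEdges.2 ?_)
    exact ((inc_iff_src_or_tgt O).1 he₁i).resolve_right fun h => hne.symm ((hin₀ e₁).1 h)
  have hout₁ : insert e K = G.outEdges c.orient v := by
    ext d
    rw [Finset.mem_insert, hK, Finset.mem_erase, mem_outEdges, mem_outEdges]
    constructor
    · rintro (rfl | ⟨h1, h2⟩)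
      · exact ((inc_iff_src_or_tgt c.orient).1 hei).resolve_right fun h => hne ((hin₁ d).1 h)
      · exact ((inc_iff_src_or_tgt c.orient).1 (h2 ▸ inc_src O d)).resolve_right
          fun h => h1 ((hin₁ d).1 h)
    · intro h
      have hd : G.Inc d (Sum.inl v) := h ▸ inc_src c.orient d
      by_cases hde : d = e
      · exact Or.inl hde
      · refine Or.inr ⟨?_, ((inc_iff_src_or_tgt O).1 hd).resolve_right fun h => hde ((hin₀ d).1 h)⟩
        rintro rfl
        exact c.joins_ne (joins_src_tgt c.orient d) (h.trans ht₁.symm)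
  have heK : e ∉ K := by
    intro h
    have := mem_outEdges.1 (Finset.mem_erase.1 h).2
    exact c.joins_ne (joins_src_tgt O e) (this.trans he.symm)
  have he₁K : e₁ ∉ K := fun h => (Finset.mem_erase.1 h).1 rfl
  have hsys := hy e₁ v ht₁
  rw [← hout₁, Finset.sum_insert heK] at hsys
  have hmul := weight_mul_of_ne hw (mem_flips.1 he₁f)
  rw [← hout₀, Finset.sum_insert he₁K, flipFactor_of_mem hef, flipFactor_of_mem he₁f, hsys,
    hside e hei, hside e₁ he₁i]
  -- The cyclic parity identity for `e`, `e₁` and `g` produces the minus sign needed to move the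
  -- remaining terms across the equation.
  have hKsum : ∑ f ∈ K, rsgn (c.under e f) * (c.flipFactor O w f * y f) =
      -(rsgn (c.under e e₁ + c.sideVertex O (Sum.inl v) + c.under e₁ e) *
        ∑ f ∈ K, rsgn (c.under e₁ f) * y f) := by
    rw [Finset.mul_sum, ← Finset.sum_neg_distrib]
    refine Finset.sum_congr rfl fun g hg => ?_
    have hgo := (Finset.mem_erase.1 hg).2
    have hgi : G.Inc g (Sum.inl v) := mem_outEdges.1 hgo ▸ inc_src O g
    have hge : g ≠ e := fun h => heK (h ▸ hg)
    have hge₁ : g ≠ e₁ := fun h => he₁K (h ▸ hg)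
    have hgf : g ∉ c.flips O := by
      rw [hflip g hgi]
      simp [hge, hge₁]
    rw [flipFactor_of_notMem hgf, hside g hgi]
    have hsix := under_cyclic_sum (c := c) hne hge.symm hge₁.symm hei he₁i hgi
    have hkey : (c.under e g + (c.sideVertex O (Sum.inl v) + (c.under g e + c.under g e₁))) +
        (c.under e e₁ + c.sideVertex O (Sum.inl v) + c.under e₁ e + c.under e₁ g) = 1 := by
      linear_combination hsix + add_self_zmod_two (c.sideVertex O (Sum.inl v))
    have := rsgn_add_rsgn hkey
    rw [rsgn_add (c.under e g), rsgn_add _ (c.under e₁ g)] at this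
    linear_combination (y g) * this
  rw [hKsum, under_self, under_self]
  simp only [rsgn_add, rsgn_zero]
  have h1 := rsgn_mul_self (c.under e₁ e)
  linear_combination (-(rsgn (c.under e e₁) * rsgn (c.sideVertex O (Sum.inl v)) *
    rsgn (c.under e₁ e) * weight O w e) * (rsgn (c.under e₁ e) * y e +
      ∑ f ∈ K, rsgn (c.under e₁ f) * y f)) * hmul -
    (rsgn (c.under e e₁) * rsgn (c.sideVertex O (Sum.inl v)) * weight O w e * y e) * h1

/-- With a single outgoing edge, every old relation at `v` expresses an incoming edge through `f₁`.
The new relations express everything through `f₀`, and both sides are compared by writing them in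
terms of `y f₁`. -/
theorem isSolution_flip_of_card_outEdges (hw : ∀ e, 0 < w e) (hO : G.IsPerfect O) {e : E} {v : V}
    (hout : (G.outEdges c.orient v).card = 1) (hout' : (G.outEdges O v).card = 1)
    (hf : ¬ ∀ d, G.Inc d (Sum.inl v) → d ∉ c.flips O) (he : G.tgt O e = Sum.inl v)
    (hy : c.IsSolution w y) :
    c.flipFactor O w e * y e = weight O w e *
      ∑ f ∈ G.outEdges O v, rsgn (c.under e f) * (c.flipFactor O w f * y f) := by
  classical
  obtain ⟨f₁, hf₁⟩ := Finset.card_eq_one.1 hout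
  obtain ⟨f₀, hf₀⟩ := Finset.card_eq_one.1 hout'
  have hout₁ : ∀ d, G.src c.orient d = Sum.inl v ↔ d = f₁ := fun d => by
    rw [← mem_outEdges, hf₁, Finset.mem_singleton]
  have hout₀ : ∀ d, G.src O d = Sum.inl v ↔ d = f₀ := fun d => by
    rw [← mem_outEdges, hf₀, Finset.mem_singleton]
  have hs₁ := (hout₁ f₁).2 rfl
  have hs₀ := (hout₀ f₀).2 rfl
  have hflip : ∀ d, G.Inc d (Sum.inl v) → (d ∈ c.flips O ↔ ¬ (d = f₁ ↔ d = f₀)) := by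
    intro d hd
    rw [mem_flips, ← hout₁, ← hout₀]
    rcases (inc_iff_src_or_tgt c.orient).1 hd with h | h <;>
      rcases (inc_iff_src_or_tgt O).1 hd with h' | h'
    · simp [h, h', c.eq_of_src_eq h h']
    · have h2 : G.src O d ≠ Sum.inl v := fun h2 =>
        c.joins_ne (joins_src_tgt O d) (h2.trans h'.symm)
      simp [h, h2, (c.ne_of_tgt_eq_src h' h).symm]
    · have h1 : G.src c.orient d ≠ Sum.inl v := fun h2 =>
        c.joins_ne (joins_src_tgt c.orient d) (h2.trans h.symm)
      simp [h1, h', c.ne_of_tgt_eq_src h h']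
    · have h1 : G.src c.orient d ≠ Sum.inl v := fun h2 =>
        c.joins_ne (joins_src_tgt c.orient d) (h2.trans h.symm)
      have h2 : G.src O d ≠ Sum.inl v := fun h2 =>
        c.joins_ne (joins_src_tgt O d) (h2.trans h'.symm)
      simp [h1, h2, c.eq_of_tgt_eq h h']
  have hne : f₀ ≠ f₁ := by
    rintro rfl
    refine hf fun d hd => ?_
    rw [hflip d hd]
    exact not_not.2 Iff.rfl
  have hi₀ : G.Inc f₀ (Sum.inl v) := hs₀ ▸ inc_src O f₀
  have hi₁ : G.Inc f₁ (Sum.inl v) := hs₁ ▸ inc_src c.orient f₁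
  have hff₀ : f₀ ∈ c.flips O := (hflip f₀ hi₀).2 fun h => hne (h.2 rfl)
  have hff₁ : f₁ ∈ c.flips O := (hflip f₁ hi₁).2 fun h => hne (h.1 rfl).symm
  have hpair : ∀ d, (d ∈ c.flips O ∧ G.Inc d (Sum.inl v)) ↔ d ∈ ({f₀, f₁} : Finset E) := by
    intro d
    rw [Finset.mem_insert, Finset.mem_singleton]
    constructor
    · rintro ⟨h1, h2⟩
      have := (hflip d h2).1 h1
      tauto
    · rintro (rfl | rfl)
      · exact ⟨hff₀, hi₀⟩
      · exact ⟨hff₁, hi₁⟩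
  have hside : ∀ d, G.Inc d (Sum.inl v) → c.side O d =
      c.sideVertex O (Sum.inl v) + (c.under d f₀ + c.under d f₁) := by
    intro d hd
    rw [side_of_filter hO hpair hd, Finset.sum_pair hne]
  have hsys : ∀ d, G.Inc d (Sum.inl v) → d ≠ f₁ →
      y d = weight c.orient w d * (rsgn (c.under d f₁) * y f₁) := by
    intro d hd hdf
    have ht := ((inc_iff_src_or_tgt c.orient).1 hd).resolve_left fun h => hdf ((hout₁ d).1 h)
    rw [hy d v ht, hf₁, Finset.sum_singleton]
  have hei : G.Inc e (Sum.inl v) := he ▸ inc_tgt O e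
  have hef₀ : e ≠ f₀ := by
    rintro rfl
    exact c.joins_ne (joins_src_tgt O e) (hs₀.trans he.symm)
  have hmul := weight_mul_of_ne hw (mem_flips.1 hff₀)
  rw [hf₀, Finset.sum_singleton, flipFactor_of_mem hff₀, hsys f₀ hi₀ hne, hside f₀ hi₀, under_self,
    zero_add]
  have h1 := rsgn_mul_self (c.under f₀ f₁)
  -- The weights of `f₀` in the two orientations are reciprocal, so its transformed value is `y f₁`
  -- up to the common sign at `v`.
  have hval : rsgn (c.sideVertex O (Sum.inl v) + c.under f₀ f₁) * weight O w f₀ *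
      (weight c.orient w f₀ * (rsgn (c.under f₀ f₁) * y f₁)) =
      rsgn (c.sideVertex O (Sum.inl v)) * y f₁ := by
    rw [rsgn_add]
    linear_combination (rsgn (c.sideVertex O (Sum.inl v)) * rsgn (c.under f₀ f₁) *
      rsgn (c.under f₀ f₁) * y f₁) * hmul + (rsgn (c.sideVertex O (Sum.inl v)) * y f₁) * h1
  rw [hval]
  by_cases hef₁ : e = f₁
  · subst hef₁
    rw [flipFactor_of_mem hff₁, hside e hei, under_self, add_zero, rsgn_add]
    ring
  · have hnf : e ∉ c.flips O := by
      rw [hflip e hei]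
      simp [hef₀, hef₁]
    have hw' : weight c.orient w e = weight O w e := by
      rw [mem_flips, not_not] at hnf
      exact weight_congr hnf
    rw [flipFactor_of_notMem hnf, hside e hei, hsys e hei hef₁, hw']
    simp only [rsgn_add]
    have h2 := rsgn_mul_self (c.under e f₁)
    linear_combination (rsgn (c.sideVertex O (Sum.inl v)) * rsgn (c.under e f₀) *
      weight O w e * y f₁) * h2

/-- A change of orientation multiplies the solutions of the gauged system by edge factors. -/
theorem isSolution_flip (hw : ∀ e, 0 < w e) (hO : G.IsPerfect O) (hy : c.IsSolution w y) :
    (c.reorient O hO).IsSolution w fun e => c.flipFactor O w e * y e := by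
  intro e v he
  change G.tgt O e = Sum.inl v at he
  change c.flipFactor O w e * y e = weight O w e *
    ∑ f ∈ G.outEdges O v, rsgn (c.under e f) * (c.flipFactor O w f * y f)
  by_cases hf : ∀ d, G.Inc d (Sum.inl v) → d ∉ c.flips O
  · exact isSolution_flip_of_unflipped hO hf he hy
  · rcases IsPerfect.card_inEdges_eq_or G v with h | h
    · exact isSolution_flip_of_card_inEdges hw hO (h _ c.perfect) (h _ hO) hf he hy
    · exact isSolution_flip_of_card_outEdges hw hO (h _ c.perfect) (h _ hO) hf he hy

end Gauged

end Frame

end PBDTPGraph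

end

/-! ### Edge vectors as gauged solutions, and the transition between orientations. -/

noncomputable section

namespace PBDTPGraph

variable {n : ℕ} {V E : Type*} {G : PBDTPGraph n V E}

/-- The edge at the boundary vertex `b_i`. -/
def boundaryEdge [Finite E] (G : PBDTPGraph n V E) (i : Fin n) : E :=
  (G.exists_boundary_edge i).choose

theorem exists_joins_boundaryEdge [Finite E] (G : PBDTPGraph n V E) (i : Fin n) :
    ∃ v : V, G.Joins (G.boundaryEdge i) (Sum.inr i) (Sum.inl v) :=
  let ⟨v, h, _⟩ := (G.exists_boundary_edge i).choose_spec
  ⟨v, h⟩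

theorem inc_boundaryEdge [Finite E] (G : PBDTPGraph n V E) (i : Fin n) :
    G.Inc (G.boundaryEdge i) (Sum.inr i) :=
  (G.exists_joins_boundaryEdge i).choose_spec.inc_left

namespace Frame

variable {c : G.Frame} {w : E → ℝ}

/-! ### The edge vectors as solutions of the gauged system -/

section Expansion

variable [Fintype E]

theorem realTransfer_eq_zero_of_sink [DecidableEq E] {e : E} {k : Fin n}
    (h : G.tgt c.orient e = Sum.inr k) (f : E) : c.realTransfer w e f = 0 := by
  rw [realTransfer_apply, if_neg fun h' => ?_]
  exact notMem_sources_of_tgt h ⟨f, h'.symm.trans h⟩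

/-- All edges leaving `v` have `rho` equal to `gamma` at `v`, so conjugation by `rho` absorbs the
crossings and only `under` remains. -/
theorem sum_realTransfer [DecidableEq E] {e : E} {v : V} (h : G.tgt c.orient e = Sum.inl v)
    (y : E → ℝ) : ∑ f, c.realTransfer w e f * y f = rsgn (c.rho e) * (weight c.orient w e *
      ∑ f ∈ G.outEdges c.orient v, rsgn (c.under e f) * (rsgn (c.rho f) * y f)) := by
  classical
  rw [Finset.mul_sum, Finset.mul_sum, ← Finset.sum_subset (Finset.subset_univ (G.outEdges c.orient v))]
  · refine Finset.sum_congr rfl fun f hf => ?_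
    have hf' := mem_outEdges.1 hf
    rw [realTransfer_apply, if_pos (h.trans hf'.symm), edgeSign, edgeInt_eq, h, rho_of_internal hf']
    change rsgn _ * _ * _ = _
    rw [rsgn_add, rsgn_add]
    ring
  · intro f _ hf
    rw [realTransfer_apply, if_neg, zero_mul]
    exact fun h' => hf (mem_outEdges.2 (h'.symm.trans h))

theorem edgeVector_of_sink (hw : ∀ e, 0 < w e) {e : E} {k : Fin n}
    (h : G.tgt c.orient e = Sum.inr k) :
    c.edgeVector w e = Pi.single k (rsgn (c.edgeInt e) * weight c.orient w e) := by
  classical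
  funext j
  rw [edgeVector_system hw, Finset.sum_eq_zero, add_zero, h, Pi.single_apply]
  · by_cases hj : j = k
    · subst hj
      rw [if_pos rfl, if_pos rfl]
      rfl
    · rw [if_neg hj, if_neg fun h => hj (Sum.inr_injective h).symm]
  · exact fun f _ => by rw [realTransfer_eq_zero_of_sink h, zero_mul]

/-- No edge ends at a source, so this component satisfies the homogeneous system. -/
theorem edgeVector_eq_zero_of_source (hw : ∀ e, 0 < w e) {i : Fin n} (hi : i ∈ G.sources c.orient)
    (e : E) : c.edgeVector w e i = 0 := by
  classical
  refine congrFun (eq_zero_of_system (c := c) hw (y := fun e => c.edgeVector w e i) fun e => ?_) e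
  rw [edgeVector_system hw, if_neg, zero_add]
  exact fun h => notMem_sources_of_tgt h hi

theorem isSolution_edgeVector (hw : ∀ e, 0 < w e) (j : Fin n) :
    c.IsSolution w fun e => rsgn (c.rho e) * c.edgeVector w e j := by
  classical
  intro e v h
  change rsgn (c.rho e) * c.edgeVector w e j = _
  rw [edgeVector_system hw, if_neg, zero_add, sum_realTransfer h, ← mul_assoc, rsgn_mul_self,
    one_mul]
  rw [h]
  exact Sum.inl_ne_inr

variable (c w) in
/-- The coefficient of a solution of the gauged system at a boundary sink. -/
def sinkValue (y : E → ℝ) (j : Fin n) : ℝ :=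
  rsgn (c.gamma (Sum.inr j)) * (weight c.orient w (G.boundaryEdge j))⁻¹ * y (G.boundaryEdge j)

/-- A solution of the gauged system is determined by its values at the boundary sinks. -/
theorem isSolution_expansion (hw : ∀ e, 0 < w e) {y : E → ℝ} (hy : c.IsSolution w y) (e : E) :
    rsgn (c.rho e) * y e = ∑ j, c.edgeVector w e j * c.sinkValue w y j := by
  classical
  rw [← sub_eq_zero]
  -- The difference of the two sides satisfies the homogeneous system: at internal vertices by the
  -- relations, at sinks by the choice of `sinkValue`.
  refine congrFun (eq_zero_of_system (c := c) hw
    (y := fun e => rsgn (c.rho e) * y e - ∑ j, c.edgeVector w e j * c.sinkValue w y j)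
    fun e => ?_) e
  simp only [mul_sub, Finset.sum_sub_distrib]
  have hcomm : ∑ f, c.realTransfer w e f * ∑ j, c.edgeVector w f j * c.sinkValue w y j =
      ∑ j, (∑ f, c.realTransfer w e f * c.edgeVector w f j) * c.sinkValue w y j := by
    simp only [Finset.mul_sum, Finset.sum_mul]
    rw [Finset.sum_comm]
    exact Finset.sum_congr rfl fun j _ => Finset.sum_congr rfl fun f _ => by ring
  rw [hcomm]
  rcases h : G.tgt c.orient e with v | k
  · congr 1
    · rw [sum_realTransfer h, hy e v h]
      congr 2
      refine Finset.sum_congr rfl fun f _ => ?_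
      rw [← mul_assoc (rsgn (c.rho f)), rsgn_mul_self, one_mul]
    · refine Finset.sum_congr rfl fun j _ => ?_
      rw [edgeVector_system hw, if_neg, zero_add]
      rw [h]
      exact Sum.inl_ne_inr
  · have h0 : ∀ f, c.realTransfer w e f = 0 := realTransfer_eq_zero_of_sink h
    simp only [h0, zero_mul, Finset.sum_const_zero, sub_zero]
    obtain rfl : G.boundaryEdge k = e :=
      eq_of_inc_boundary (G.inc_boundaryEdge k) (h ▸ inc_tgt c.orient e)
    have hne := (weight_pos (O := c.orient) hw (G.boundaryEdge k)).ne'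
    rw [edgeVector_of_sink hw h, Finset.sum_eq_single k]
    · rw [Pi.single_eq_same, sinkValue, edgeInt_eq, h, rsgn_add]
      have h1 := rsgn_mul_self (c.gamma (Sum.inr k))
      field_simp
      linear_combination (-(rsgn (c.rho (G.boundaryEdge k)) * y (G.boundaryEdge k))) * h1
    · intro j _ hj
      rw [Pi.single_eq_of_ne hj, zero_mul]
    · exact fun h => absurd (Finset.mem_univ k) h

end Expansion

/-! ### The transition between two orientations -/

section Transition

variable [Fintype E] {O : E → Bool}

variable (c w) in
/-- The factor relating the edge vectors of two orientations. -/
def frameFactor (hO : G.IsPerfect O) (e : E) : ℝ :=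
  rsgn ((c.reorient O hO).rho e) * (c.flipFactor O w e * rsgn (c.rho e))

theorem frameFactor_ne_zero (hw : ∀ e, 0 < w e) (hO : G.IsPerfect O) (e : E) :
    c.frameFactor w hO e ≠ 0 :=
  mul_ne_zero (rsgn_ne_zero _) (mul_ne_zero (flipFactor_ne_zero hw e) (rsgn_ne_zero _))

open Classical in
variable (c w) in
/-- The images of the canonical basis vectors in the coordinate subspace of the sinks of `c`. -/
def transition (hO : G.IsPerfect O) (k : Fin n) : Fin n → ℝ :=
  if k ∈ G.sources O then -(c.frameFactor w hO (G.boundaryEdge k) • c.edgeVector w (G.boundaryEdge k))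
  else fun i => (c.reorient O hO).sinkValue w
    (fun e => c.flipFactor O w e * (rsgn (c.rho e) * c.edgeVector w e i)) k

theorem transition_eq_zero (hw : ∀ e, 0 < w e) (hO : G.IsPerfect O) (k : Fin n) {i : Fin n}
    (hi : i ∈ G.sources c.orient) : c.transition w hO k i = 0 := by
  have h := edgeVector_eq_zero_of_source (c := c) hw hi
  unfold transition
  split_ifs
  · rw [Pi.neg_apply, Pi.smul_apply, h, smul_zero, neg_zero]
  · simp only [sinkValue, h, mul_zero]

variable [Fintype V]

/-- The flipped components solve the system for `O` and are expanded at its sinks. At the sources of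
`O` the coefficients vanish, so the values of `transition` there do not matter. -/
theorem frameFactor_smul_edgeVector (hw : ∀ e, 0 < w e) (hO : G.IsPerfect O) (e : E) :
    c.frameFactor w hO e • c.edgeVector w e =
      ∑ k, (c.reorient O hO).edgeVector w e k • c.transition w hO k := by
  classical
  funext i
  have h := isSolution_expansion hw (isSolution_flip hw hO (isSolution_edgeVector (c := c) hw i)) e
  rw [Pi.smul_apply, Finset.sum_apply, smul_eq_mul, frameFactor, mul_assoc, mul_assoc, h]
  refine Finset.sum_congr rfl fun k _ => ?_
  by_cases hk : k ∈ G.sources O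
  · rw [edgeVector_eq_zero_of_source (c := c.reorient O hO) hw hk, Pi.smul_apply, zero_mul,
      zero_smul]
  · rw [transition, if_neg hk, Pi.smul_apply, smul_eq_mul]

/-- At a boundary edge `side` and `rho` are known explicitly, so the signs can be compared; the
weights cancel whether or not the edge is reversed. -/
theorem transition_eq_single (hw : ∀ e, 0 < w e) (hO : G.IsPerfect O) {k : Fin n}
    (hk : k ∉ G.sources c.orient) : c.transition w hO k = Pi.single k 1 := by
  classical
  obtain ⟨v, hv⟩ := G.exists_joins_boundaryEdge k
  have ht := tgt_of_notMem_sources hk hv.inc_left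
  have hX := edgeVector_of_sink (c := c) hw ht
  have hside := side_boundary (c := c) hO hv
  have hrho : (c.edgeInt (G.boundaryEdge k) : ZMod 2) =
      c.rho (G.boundaryEdge k) + c.gamma (Sum.inr k) := by rw [edgeInt_eq, ht]
  unfold transition
  by_cases hk' : k ∈ G.sources O
  · have hs := src_of_mem_sources hk' hv.inc_left
    have hne := c.ne_of_tgt_eq_src ht hs
    have hmem : G.boundaryEdge k ∈ c.flips O := mem_flips.2 hne
    have hrho' := rho_of_boundary (c := c.reorient O hO) hs
    have htO : G.tgt O (G.boundaryEdge k) = Sum.inl v := by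
      have := joins_src_tgt (G := G) O (G.boundaryEdge k)
      rw [hs] at this
      rcases this with h1 | h1 <;> rcases hv with h2 | h2
      · exact h1.2.symm.trans h2.2
      · exact absurd (h1.1.symm.trans h2.1) Sum.inr_ne_inl
      · exact absurd (h1.2.symm.trans h2.2) Sum.inr_ne_inl
      · exact h1.1.symm.trans h2.1
    rw [if_pos hk', hX, frameFactor, flipFactor_of_mem hmem]
    rw [if_pos hmem] at hside
    -- The odd parity cancels the minus sign in `transition` at a source of `O`.
    have hsum : (c.reorient O hO).rho (G.boundaryEdge k) + c.side O (G.boundaryEdge k) +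
        c.rho (G.boundaryEdge k) + c.edgeInt (G.boundaryEdge k) = 1 := by
      rw [hrho, hside, hrho']
      change _ + c.left k (G.tgt O _) + _ + _ + _ = _
      rw [htO]
      linear_combination add_self_zmod_two (c.left k (Sum.inl v)) +
        add_self_zmod_two (c.gamma (Sum.inr k)) + add_self_zmod_two (c.rho (G.boundaryEdge k)) +
        add_self_zmod_two ((c.reorient O hO).gamma (Sum.inr k))
    have hmul := weight_mul_of_ne hw hne
    have hr := congrArg rsgn hsum
    rw [rsgn_add, rsgn_add, rsgn_add, rsgn_one] at hr
    funext i
    rw [Pi.neg_apply, Pi.smul_apply]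
    by_cases hi : i = k
    · subst hi
      rw [Pi.single_eq_same, Pi.single_eq_same, smul_eq_mul]
      linear_combination (-(weight O w (G.boundaryEdge i) * weight c.orient w (G.boundaryEdge i))) *
        hr + hmul
    · rw [Pi.single_eq_of_ne hi, Pi.single_eq_of_ne hi, smul_zero, neg_zero]
  · have htO := tgt_of_notMem_sources hk' hv.inc_left
    have heq := c.eq_of_tgt_eq ht htO
    have hmem : G.boundaryEdge k ∉ c.flips O := fun h => mem_flips.1 h heq
    rw [if_neg hmem, zero_add] at hside
    rw [if_neg hk']
    have hsum : (c.reorient O hO).gamma (Sum.inr k) + c.side O (G.boundaryEdge k) +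
        c.rho (G.boundaryEdge k) + c.edgeInt (G.boundaryEdge k) = 0 := by
      rw [hrho, hside]
      linear_combination add_self_zmod_two (c.gamma (Sum.inr k)) +
        add_self_zmod_two (c.rho (G.boundaryEdge k)) +
        add_self_zmod_two ((c.reorient O hO).gamma (Sum.inr k))
    have hr := congrArg rsgn hsum
    rw [rsgn_add, rsgn_add, rsgn_add, rsgn_zero] at hr
    have hpos := (weight_pos (O := O) hw (G.boundaryEdge k)).ne'
    funext i
    rw [sinkValue, flipFactor_of_notMem hmem, hX, weight_congr heq]
    change _ * (weight O w _)⁻¹ * _ = _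
    by_cases hi : i = k
    · subst hi
      rw [Pi.single_eq_same, Pi.single_eq_same]
      field_simp
      linear_combination hr
    · rw [Pi.single_eq_of_ne hi, Pi.single_eq_of_ne hi, mul_zero, mul_zero, mul_zero]

end Transition

end Frame

end PBDTPGraph

end

/-! ### Subtraction-free functions, weight gauge, and projections along the measurement plane. -/

noncomputable section

/-! ### Subtraction-free functions -/

namespace IsSubtractionFree

variable {E : Type*} {f g : (E → ℝ) → ℝ}

theorem zero : IsSubtractionFree fun _ : E → ℝ => (0 : ℝ) :=
  ⟨0, 1, one_ne_zero, fun w _ => by simp⟩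

theorem one : IsSubtractionFree fun _ : E → ℝ => (1 : ℝ) :=
  ⟨1, 1, one_ne_zero, fun w _ => by simp⟩

theorem coordinate (e : E) : IsSubtractionFree fun w : E → ℝ => w e :=
  ⟨MvPolynomial.X e, 1, one_ne_zero, fun w _ => by simp⟩

theorem coordinate_inv (e : E) : IsSubtractionFree fun w : E → ℝ => (w e)⁻¹ :=
  ⟨1, MvPolynomial.X e, MvPolynomial.X_ne_zero e, fun w _ => by simp⟩

theorem mul_ne_zero_of_ne_zero {P Q : MvPolynomial E ℕ} (hP : P ≠ 0) (hQ : Q ≠ 0) : P * Q ≠ 0 := by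
  intro h
  have h1 := MvPolynomial.aeval_pos_of_ne_zero hP (w := fun _ => 1) fun _ => one_pos
  have h2 := MvPolynomial.aeval_pos_of_ne_zero hQ (w := fun _ => 1) fun _ => one_pos
  have h3 := mul_pos h1 h2
  rw [← map_mul, h, map_zero] at h3
  exact lt_irrefl _ h3

theorem mul (hf : IsSubtractionFree f) (hg : IsSubtractionFree g) :
    IsSubtractionFree fun w => f w * g w := by
  obtain ⟨P, Q, hQ, h⟩ := hf
  obtain ⟨P', Q', hQ', h'⟩ := hg
  refine ⟨P * P', Q * Q', mul_ne_zero_of_ne_zero hQ hQ', fun w hw => ?_⟩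
  change f w * g w = _
  rw [h w hw, h' w hw, map_mul, map_mul, div_mul_div_comm]

theorem add (hf : IsSubtractionFree f) (hg : IsSubtractionFree g) :
    IsSubtractionFree fun w => f w + g w := by
  obtain ⟨P, Q, hQ, h⟩ := hf
  obtain ⟨P', Q', hQ', h'⟩ := hg
  refine ⟨P * Q' + Q * P', Q * Q', mul_ne_zero_of_ne_zero hQ hQ', fun w hw => ?_⟩
  change f w + g w = _
  rw [h w hw, h' w hw, div_add_div _ _ (MvPolynomial.aeval_pos_of_ne_zero hQ hw).ne'
    (MvPolynomial.aeval_pos_of_ne_zero hQ' hw).ne']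
  simp only [map_mul, map_add]

theorem sum {ι : Type*} (s : Finset ι) {f : ι → (E → ℝ) → ℝ} (hf : ∀ i, IsSubtractionFree (f i)) :
    IsSubtractionFree fun w => ∑ i ∈ s, f i w := by
  classical
  induction s using Finset.induction_on with
  | empty => simpa using zero
  | insert a s ha ih => simpa only [Finset.sum_insert ha] using (hf a).add ih

theorem weight (O : E → Bool) (e : E) : IsSubtractionFree fun w => PBDTPGraph.weight O w e := by
  unfold PBDTPGraph.weight
  by_cases h : O e = true
  · simpa only [if_pos h] using coordinate e
  · simpa only [if_neg h] using coordinate_inv e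

theorem weight_inv (O : E → Bool) (e : E) :
    IsSubtractionFree fun w => (PBDTPGraph.weight O w e)⁻¹ := by
  unfold PBDTPGraph.weight
  by_cases h : O e = true
  · simpa only [if_pos h] using coordinate_inv e
  · simpa only [if_neg h, inv_inv] using coordinate e

theorem prod_weight (O : E → Bool) (P : List E) :
    IsSubtractionFree fun w => (P.map (PBDTPGraph.weight O w)).prod := by
  induction P with
  | nil => simpa using one
  | cons e P ih => simpa only [List.map_cons, List.prod_cons] using (weight O e).mul ih

theorem weightSum (O : E → Bool) {S : Set (List E)} (hS : S.Finite) :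
    IsSubtractionFree fun w => PBDTPGraph.weightSum O w S := by
  unfold PBDTPGraph.weightSum
  simp only [finsum_mem_eq_finite_toFinset_sum _ hS]
  exact sum _ fun P => prod_weight O P

end IsSubtractionFree

namespace PBDTPGraph

variable {n : ℕ} {V E : Type*} {G : PBDTPGraph n V E}

/-! ### Weight gauge -/

theorem regauge_pos {t : V → ℝ} {w : E → ℝ} (ht : ∀ v, 0 < t v) (hw : ∀ e, 0 < w e) (e : E) :
    0 < G.regauge t w e := by
  have h : ∀ x : V ⊕ Fin n, 0 < (Sum.elim t (fun _ => 1) x : ℝ) := by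
    rintro (v | i)
    · exact ht v
    · exact one_pos
  exact mul_pos (mul_pos (hw e) (h _)) (inv_pos.2 (h _))

theorem weight_regauge (O : E → Bool) (t : V → ℝ) (w : E → ℝ) (e : E) :
    weight O (G.regauge t w) e = weight O w e * Sum.elim t (fun _ => 1) (G.src O e) *
      (Sum.elim t (fun _ => 1) (G.tgt O e))⁻¹ := by
  unfold weight regauge src tgt
  split_ifs
  · rfl
  · rw [mul_inv, mul_inv, inv_inv]; ring

/-- The gauge factors cancel between consecutive edges, and at the final boundary vertex the factor
is one; only the initial vertex remains. -/
theorem IsWalk.prod_weight_regauge {O : E → Bool} {t : V → ℝ} (ht : ∀ v, 0 < t v) (w : E → ℝ)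
    {e : E} {j : Fin n} {P : List E} (h : G.IsWalk O e j P) :
    (P.map (weight O (G.regauge t w))).prod =
      Sum.elim t (fun _ => 1) (G.src O e) * (P.map (weight O w)).prod := by
  have hne : ∀ x : V ⊕ Fin n, (Sum.elim t (fun _ => 1) x : ℝ) ≠ 0 := by
    rintro (v | i)
    · exact (ht v).ne'
    · exact one_ne_zero
  induction P generalizing e with
  | nil => exact absurd h not_isWalk_nil
  | cons d P ih =>
    obtain ⟨rfl, ⟨rfl, h1⟩ | ⟨f, h1, h2⟩⟩ := isWalk_cons.1 h
    · rw [List.map_singleton, List.map_singleton, List.prod_singleton, List.prod_singleton,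
        weight_regauge, h1]
      simp [mul_comm]
    · have := hne (G.src O f)
      rw [List.map_cons, List.map_cons, List.prod_cons, List.prod_cons, ih h2, weight_regauge, h1]
      field_simp

theorem weightSum_regauge {O : E → Bool} {t : V → ℝ} (ht : ∀ v, 0 < t v) (w : E → ℝ)
    (e : E) (j : Fin n) : weightSum O (G.regauge t w) {P | G.IsWalk O e j P} =
      Sum.elim t (fun _ => 1) (G.src O e) * weightSum O w {P | G.IsWalk O e j P} := by
  unfold weightSum
  rw [mul_finsum_mem]
  exact finsum_mem_congr rfl fun P hP => IsWalk.prod_weight_regauge ht w hP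

/-- The walks in the rows also start at the boundary, so not even the initial factor survives. -/
theorem measurementPlane_regauge {O : E → Bool} {t : V → ℝ} (ht : ∀ v, 0 < t v) (w : E → ℝ) :
    G.measurementPlane O (G.regauge t w) = G.measurementPlane O w := by
  unfold measurementPlane
  congr 2
  funext i
  funext j
  unfold measurementRow
  by_cases hj : j = i
  · rw [if_pos hj, if_pos hj]
  · rw [if_neg hj, if_neg hj]
    congr 1
    refine finsum_mem_congr rfl fun P hP => ?_
    obtain ⟨e, he, hP⟩ := hP
    rw [hP.prod_weight_regauge ht, he]
    exact one_mul _

theorem weightSum_pos [Finite E] {O : E → Bool} (hac : G.IsAcyclic O) {w : E → ℝ}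
    (hw : ∀ e, 0 < w e) {e : E} {j : Fin n} {P : List E} (hP : G.IsWalk O e j P) :
    0 < weightSum O w {P | G.IsWalk O e j P} := by
  unfold weightSum
  rw [finsum_mem_eq_finite_toFinset_sum _ (hac.finite_walks e j)]
  refine Finset.sum_pos (fun Q _ => List.prod_pos ?_) ⟨P, (hac.finite_walks e j).mem_toFinset.2 hP⟩
  intro a ha
  obtain ⟨d, -, rfl⟩ := List.mem_map.1 ha
  exact weight_pos hw d

/-! ### Projections along the measurement plane -/

/-- `Φ` is the projection along `W` onto the coordinate subspace of the sinks of `O`. -/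
structure IsSinkProjection (G : PBDTPGraph n V E) (W : Submodule ℝ (Fin n → ℝ)) (O : E → Bool)
    (Φ : (Fin n → ℝ) →ₗ[ℝ] (Fin n → ℝ)) : Prop where
  apply_eq_zero_iff : ∀ x, Φ x = 0 ↔ x ∈ W
  apply_source : ∀ x, ∀ i ∈ G.sources O, Φ x i = 0
  apply_of_sink : ∀ x, (∀ i ∈ G.sources O, x i = 0) → Φ x = x

theorem sum_sink {M : Type*} [AddCommMonoid M] {O : E → Bool} {f : Fin n → M}
    (hf : ∀ i ∈ G.sources O, f i = 0) : ∑ i, f i = ∑ j : G.Sink O, f j := by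
  classical
  rw [← Finset.sum_subtype (Finset.univ.filter fun j => j ∉ G.sources O) (by simp) f,
    Finset.sum_filter]
  refine Finset.sum_congr rfl fun i _ => ?_
  split_ifs with hi
  · exact hf i hi
  · rfl

namespace IsSinkProjection

variable {W : Submodule ℝ (Fin n → ℝ)} {O O' : E → Bool} {Φ Φ' : (Fin n → ℝ) →ₗ[ℝ] (Fin n → ℝ)}

theorem sub_mem (h : G.IsSinkProjection W O Φ) (x : Fin n → ℝ) : Φ x - x ∈ W := by
  rw [← h.apply_eq_zero_iff, map_sub, h.apply_of_sink _ (h.apply_source x), sub_self]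

theorem apply_eq (h : G.IsSinkProjection W O Φ) {x y : Fin n → ℝ} (hxy : x - y ∈ W) :
    Φ x = Φ y := by
  rw [← sub_eq_zero, ← map_sub]
  exact (h.apply_eq_zero_iff _).2 hxy

theorem apply_sum (x : Fin n → ℝ) (hx : ∀ i ∈ G.sources O, x i = 0) :
    Φ x = ∑ j : G.Sink O, x j • Φ (Pi.single (j : Fin n) 1) := by
  rw [← sum_sink (G := G) (O := O) (f := fun j => x j • Φ (Pi.single j 1))
    fun i hi => by rw [hx i hi, zero_smul]]
  conv_lhs => rw [pi_eq_sum_univ' x]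
  rw [map_sum]
  exact Finset.sum_congr rfl fun j _ => map_smul _ _ _

/-- Both projections have kernel `W`. Hence `Φ'` maps the sink subspace of `O` isomorphically onto
that of `O'`, with inverse given by `Φ`, and it changes vectors only by elements of `W`. -/
theorem isAdaptedBasis (h : G.IsSinkProjection W O Φ) (h' : G.IsSinkProjection W O' Φ') :
    G.IsAdaptedBasis W O O' fun j => Φ' (Pi.single (j : Fin n) 1) := by
  classical
  have hext : ∀ a : G.Sink O → ℝ, ∃ x : Fin n → ℝ, (∀ i ∈ G.sources O, x i = 0) ∧
      ∀ j : G.Sink O, x j = a j := fun a =>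
    ⟨fun i => if hi : i ∈ G.sources O then 0 else a ⟨i, hi⟩, fun i hi => dif_pos hi,
      fun j => dif_neg j.2⟩
  refine ⟨Fintype.linearIndependent_iff.2 fun a ha j => ?_, ?_, fun j => ?_⟩
  · obtain ⟨x, hx, hxa⟩ := hext a
    simp only [← hxa] at ha ⊢
    rw [← apply_sum x hx, h'.apply_eq_zero_iff, ← h.apply_eq_zero_iff, h.apply_of_sink x hx] at ha
    rw [ha, Pi.zero_apply]
  · ext x
    rw [SetLike.mem_coe, Submodule.mem_span_range_iff_exists_fun, Set.mem_ofPred_eq]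
    constructor
    · rintro ⟨a, rfl⟩ i hi
      rw [Finset.sum_apply]
      exact Finset.sum_eq_zero fun j _ => by
        rw [Pi.smul_apply, h'.apply_source _ i hi, smul_zero]
    · intro hx
      refine ⟨fun j => Φ x j, ?_⟩
      rw [← apply_sum (Φ x) (h.apply_source x), h'.apply_eq (h.sub_mem x), h'.apply_of_sink x hx]
  · convert h'.sub_mem (Pi.single (j : Fin n) 1) using 2
    funext i
    rw [Pi.single_apply]

end IsSinkProjection

namespace Frame

variable {c : G.Frame} {w : E → ℝ}

/-! ### Edge vectors in acyclic orientations -/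

theorem prod_content (x : E → ℝ) (P : List E) :
    (content P).prod (fun e k => x e ^ k) = (P.map x).prod := by
  induction P with
  | nil => simp [content]
  | cons d P ih =>
    rw [content_cons, Finsupp.prod_add_index' (fun _ => pow_zero _) fun _ _ _ => pow_add _ _ _,
      ih, List.map_cons, List.prod_cons, Finsupp.prod_single_index (h := fun e k => x e ^ k)
        (pow_zero _), pow_one]

/-- There are finitely many walks, so the series is a polynomial and the denominator one can be
used. -/
theorem edgeVector_of_isAcyclic [Finite E] (hac : G.IsAcyclic c.orient) {e : E} {j : Fin n} (σ : ℤˣ)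
    (hσ : ∀ P, G.IsWalk c.orient e j P → (c.wind P + c.walkInt P).negOnePow = σ) :
    c.edgeVector w e j = (σ : ℤ) * weightSum c.orient w {P | G.IsWalk c.orient e j P} := by
  classical
  have hfin := hac.finite_walks e j
  refine rationalValue_eq ⟨∑ P ∈ hfin.toFinset, MvPolynomial.monomial (content P) (σ : ℤ), 1,
    ?_, by simp, ?_⟩
  · rw [MvPolynomial.coe_one, one_mul]
    ext m
    rw [coeff_edgeSeries, MvPolynomial.coeff_coe, MvPolynomial.coeff_sum]
    simp only [MvPolynomial.coeff_monomial]
    rw [← Finset.sum_filter, finsum_mem_eq_finite_toFinset_sum _ (finite_walks e j m)]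
    refine Finset.sum_congr ?_ fun P hP => ?_
    · ext P
      simp [walks]
    · have := (Finset.mem_filter.1 hP).1
      rw [walkSign, hσ P (hfin.mem_toFinset.1 this)]
  · rw [map_one, div_one, map_sum, weightSum, finsum_mem_eq_finite_toFinset_sum _ hfin,
      Finset.mul_sum]
    refine Finset.sum_congr rfl fun P _ => ?_
    rw [MvPolynomial.aeval_monomial]
    congr 1
    exact (prod_content _ P).symm

/-- Walks from a source have the sign of the measurement matrix in every drawing; this identity
links the edge vectors of the frame to the plane, which does not depend on it. -/
theorem measurementRow_eq [Fintype E] (hac : G.IsAcyclic c.orient) (hw : ∀ e, 0 < w e) {i : Fin n}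
    (hi : i ∈ G.sources c.orient) :
    G.measurementRow c.orient w i = Pi.single i 1 + c.edgeVector w (G.boundaryEdge i) := by
  have hs := src_of_mem_sources hi (G.inc_boundaryEdge i)
  funext j
  unfold measurementRow
  rw [Pi.add_apply]
  split_ifs with hj
  · subst hj
    rw [Pi.single_eq_same, edgeVector_eq_zero_of_source hw hi, add_zero]
  · rw [Pi.single_eq_of_ne hj, zero_add,
      edgeVector_of_isAcyclic hac (sgn (G.sourcesBetween c.orient i j : ZMod 2)) fun P hP => by
        rw [negOnePow_eq_sgn, sign_of_source_walk hac hs hP],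
      neg_one_pow_eq_sgn]
    congr 2
    ext P
    constructor
    · rintro ⟨e, he, hP⟩
      obtain rfl : e = G.boundaryEdge i :=
        eq_of_inc_boundary (he ▸ inc_src c.orient e) (G.inc_boundaryEdge i)
      exact hP
    · exact fun hP => ⟨_, hs, hP⟩

/-! ### The projection defined by the transition between two orientations -/

/-- The edge vectors are, up to edge factors, projections of those of an acyclic orientation. -/
theorem exists_isSinkProjection [Fintype V] [Fintype E] (c : G.Frame) (hw : ∀ e, 0 < w e)
    {O : E → Bool} (hO : G.IsPerfect O) (hac : G.IsAcyclic O) :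
    ∃ Φ, G.IsSinkProjection (G.measurementPlane O w) c.orient Φ ∧ ∀ e,
      c.frameFactor w hO e • c.edgeVector w e = Φ ((c.reorient O hO).edgeVector w e) := by
  classical
  set c₀ := c.reorient O hO with hc₀
  set Φ : (Fin n → ℝ) →ₗ[ℝ] (Fin n → ℝ) := Fintype.linearCombination ℝ (c.transition w hO) with hΦ
  have hΦs : ∀ k, Φ (Pi.single k 1) = c.transition w hO k := fun k => by
    rw [hΦ, Fintype.linearCombination_apply_single, one_smul]
  have hX : ∀ e, c.frameFactor w hO e • c.edgeVector w e = Φ (c₀.edgeVector w e) :=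
    frameFactor_smul_edgeVector hw hO
  have hsource : ∀ x, ∀ i ∈ G.sources c.orient, Φ x i = 0 := by
    intro x i hi
    rw [hΦ, Fintype.linearCombination_apply, Finset.sum_apply]
    exact Finset.sum_eq_zero fun k _ => by
      rw [Pi.smul_apply, transition_eq_zero hw hO k hi, smul_zero]
  have hsink : ∀ x : Fin n → ℝ, (∀ i ∈ G.sources c.orient, x i = 0) → Φ x = x := by
    intro x hx
    conv_rhs => rw [pi_eq_sum_univ' x]
    rw [hΦ, Fintype.linearCombination_apply]
    refine Finset.sum_congr rfl fun k _ => ?_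
    by_cases hk : k ∈ G.sources c.orient
    · rw [hx k hk, zero_smul, zero_smul]
    · rw [transition_eq_single hw hO hk]
  have hrow_eq : ∀ i ∈ G.sources O,
      G.measurementRow O w i = Pi.single i 1 + c₀.edgeVector w (G.boundaryEdge i) :=
    fun i hi => measurementRow_eq (c := c₀) hac hw hi
  -- `transition` at a source of `O` was defined to make this cancellation happen.
  have hrow : ∀ i ∈ G.sources O, Φ (G.measurementRow O w i) = 0 := by
    intro i hi
    rw [hrow_eq i hi, map_add, hΦs, ← hX, transition, if_pos hi,
      neg_add_cancel]
  have hle : ∀ x ∈ G.measurementPlane O w, Φ x = 0 := by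
    intro x hx
    have : G.measurementPlane O w ≤ LinearMap.ker Φ := by
      refine Submodule.span_le.2 ?_
      rintro _ ⟨i, rfl⟩
      exact hrow i i.2
    exact this hx
  -- The rows form an identity matrix in the source columns, so subtracting them with coefficients
  -- `x i` clears those entries.
  have hreduce : ∀ x, ∃ y ∈ G.measurementPlane O w, ∀ i ∈ G.sources O, (x - y) i = 0 := by
    intro x
    refine ⟨∑ i : G.sources O, x i • G.measurementRow O w i, Submodule.sum_mem _ fun i _ =>
      Submodule.smul_mem _ _ (Submodule.subset_span ⟨i, rfl⟩), fun k hk => ?_⟩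
    rw [Pi.sub_apply, Finset.sum_apply, Finset.sum_eq_single (⟨k, hk⟩ : G.sources O)]
    · rw [Pi.smul_apply, measurementRow, if_pos rfl, smul_eq_mul, mul_one, sub_self]
    · intro i _ hik
      have hik' : k ≠ i := fun h => hik (Subtype.ext h.symm)
      rw [Pi.smul_apply, hrow_eq i i.2, Pi.add_apply,
        Pi.single_eq_of_ne hik', edgeVector_eq_zero_of_source (c := c₀) hw hk, add_zero, smul_zero]
    · exact fun h => absurd (Finset.mem_univ _) h
  set ι : (G.Sink O → ℝ) →ₗ[ℝ] (Fin n → ℝ) :=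
    Fintype.linearCombination ℝ fun j : G.Sink O => Pi.single (j : Fin n) (1 : ℝ) with hι
  have hιx : ∀ x : Fin n → ℝ, (∀ i ∈ G.sources O, x i = 0) → ι (fun j => x j) = x := by
    intro x hx
    rw [hι, Fintype.linearCombination_apply,
      ← sum_sink (f := fun j => x j • Pi.single j (1 : ℝ)) fun i hi => by rw [hx i hi, zero_smul]]
    exact (pi_eq_sum_univ' x).symm
  set Ψ : (G.Sink O → ℝ) →ₗ[ℝ] (G.Sink c.orient → ℝ) :=
    LinearMap.funLeft ℝ ℝ (Subtype.val : G.Sink c.orient → Fin n) ∘ₗ Φ ∘ₗ ι with hΨ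
  have hcard : Module.finrank ℝ (G.Sink O → ℝ) = Module.finrank ℝ (G.Sink c.orient → ℝ) := by
    have h1 : ∀ O' : E → Bool, Fintype.card (G.Sink O') +
        (Finset.univ.filter fun i => i ∈ G.sources O').card = n := by
      intro O'
      have := Finset.card_filter_add_card_filter_not (s := (Finset.univ : Finset (Fin n)))
        fun i => i ∈ G.sources O'
      rw [Finset.card_univ, Fintype.card_fin] at this
      rw [Fintype.card_of_subtype (Finset.univ.filter fun i => ¬ i ∈ G.sources O') (by simp)]
      omega
    have h2 := h1 O
    have h3 := h1 c.orient
    have h4 := hO.card_sources_eq c.perfect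
    rw [Module.finrank_fintype_fun_eq_card, Module.finrank_fintype_fun_eq_card]
    omega
  -- A vector supported on the sinks of the frame is fixed by `Φ`, and modulo the plane it is
  -- supported on the sinks of `O`. As both sink sets have the same size, surjectivity gives
  -- injectivity, which shows that the kernel of `Φ` is no larger than the plane.
  have hsurj : Function.Surjective Ψ := by
    intro a
    set x : Fin n → ℝ := fun i => if hi : i ∈ G.sources c.orient then 0 else a ⟨i, hi⟩ with hx
    obtain ⟨y, hy, hxy⟩ := hreduce x
    refine ⟨fun j => (x - y) j, ?_⟩
    rw [hΨ, LinearMap.comp_apply, LinearMap.comp_apply, hιx _ hxy, map_sub, hle y hy, sub_zero,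
      hsink x fun i hi => dif_pos hi]
    funext j
    exact dif_neg j.2
  have hinj := (LinearMap.injective_iff_surjective_of_finrank_eq_finrank hcard).2 hsurj
  refine ⟨Φ, ⟨fun x => ⟨fun hx => ?_, hle x⟩, hsource, hsink⟩, hX⟩
  obtain ⟨y, hy, hxy⟩ := hreduce x
  have h0 : Ψ (fun j => (x - y) j) = Ψ 0 := by
    rw [map_zero, hΨ, LinearMap.comp_apply, LinearMap.comp_apply, hιx _ hxy, map_sub, hx, hle y hy,
      sub_zero, map_zero]
  have h1 := hinj h0
  have h2 : x - y = 0 := by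
    rw [← hιx _ hxy, h1, map_zero]
  rw [sub_eq_zero.1 h2]
  exact hy

end Frame

end PBDTPGraph

end

/-! ### Transport from the acyclic orientation to all frames. -/

noncomputable section

namespace PBDTPGraph

variable {n : ℕ} {V E : Type*} {G : PBDTPGraph n V E}

namespace Frame

/-- The signs of the components of the edge vectors in an acyclic orientation. -/
theorem exists_edgeVector_sign [Fintype E] {c : G.Frame} (hac : G.IsAcyclic c.orient) :
    ∃ σ : E → Fin n → ℤˣ,
      (∀ e j P, G.IsWalk c.orient e j P → (c.wind P + c.walkInt P).negOnePow = σ e j) ∧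
      ∀ w e j, c.edgeVector w e j =
        (σ e j : ℤ) * weightSum c.orient w {P | G.IsWalk c.orient e j P} := by
  obtain ⟨i, hi⟩ := exists_walk_sign c.perfect hac
  obtain ⟨τ, hτ⟩ := hi c rfl
  have h : ∀ e j P, G.IsWalk c.orient e j P → (c.wind P + c.walkInt P).negOnePow =
      sgn (τ e + (G.sourcesBetween c.orient (i e) j : ZMod 2)) := fun e j P hP => by
    rw [negOnePow_eq_sgn, hτ e j P hP]
  exact ⟨_, h, fun w e j => edgeVector_of_isAcyclic hac _ (h e j)⟩

/-- In acyclic orientations, changes of the drawing, of the ray direction and of the weight gauge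
multiply the edge vectors by edge factors. -/
theorem exists_edgeVector_regauge [Fintype E] {O : E → Bool} (hO : G.IsPerfect O)
    (hac : G.IsAcyclic O) {c c' : G.Frame} (hc : c.orient = O) (hc' : c'.orient = O) {t : V → ℝ}
    (ht : ∀ v, 0 < t v) (w : E → ℝ) : ∃ κ : E → ℝ, (∀ e, κ e ≠ 0) ∧
      ∀ e, c'.edgeVector (G.regauge t w) e = κ e • c.edgeVector w e := by
  obtain ⟨i, hi⟩ := exists_walk_sign hO hac
  obtain ⟨τ, hτ⟩ := hi c hc
  obtain ⟨τ', hτ'⟩ := hi c' hc'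
  subst hc
  refine ⟨fun e => rsgn (τ e + τ' e) * Sum.elim t (fun _ => 1) (G.src c.orient e), fun e => ?_,
    fun e => ?_⟩
  · refine mul_ne_zero (rsgn_ne_zero _) ?_
    rcases G.src c.orient e with v | k
    · exact (ht v).ne'
    · exact one_ne_zero
  · funext j
    have h := edgeVector_of_isAcyclic (w := w) hac (e := e) (j := j)
      (sgn (τ e + (G.sourcesBetween c.orient (i e) j : ZMod 2)))
      fun P hP => by rw [negOnePow_eq_sgn, hτ e j P hP]
    have h' := edgeVector_of_isAcyclic (w := G.regauge t w) (hc' ▸ hac) (e := e) (j := j)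
      (sgn (τ' e + (G.sourcesBetween c.orient (i e) j : ZMod 2)))
      fun P hP => by rw [negOnePow_eq_sgn, hτ' e j P (hc' ▸ hP)]
    rw [hc', weightSum_regauge ht] at h'
    rw [Pi.smul_apply, h, h', smul_eq_mul]
    change rsgn _ * _ = _ * _ * (rsgn _ * _)
    simp only [rsgn_add]
    have h1 := rsgn_mul_self (τ e)
    linear_combination (-(rsgn (τ' e) * rsgn (G.sourcesBetween c.orient (i e) j) *
      Sum.elim t (fun _ => 1) (G.src c.orient e) *
      weightSum c.orient w {P | G.IsWalk c.orient e j P})) * h1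

/-- Every edge reaches some sink, and the walks to that sink have one common sign, so nothing
cancels. -/
theorem edgeVector_ne_zero_of_isAcyclic [Fintype E] {c : G.Frame} (hac : G.IsAcyclic c.orient)
    {w : E → ℝ} (hw : ∀ e, 0 < w e) (e : E) : c.edgeVector w e ≠ 0 := by
  obtain ⟨σ, -, h⟩ := exists_edgeVector_sign hac
  obtain ⟨j, P, hP⟩ := c.perfect.exists_isWalk hac e
  intro h0
  have h1 := h w e j
  rw [h0, Pi.zero_apply, eq_comm, mul_eq_zero] at h1
  rcases h1 with h1 | h1
  · rcases Int.units_eq_one_or (σ e j) with h2 | h2 <;> simp [h2] at h1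
  · exact (weightSum_pos hac hw hP).ne' h1

section Acyclic

variable [Fintype V] [Fintype E] {O : E → Bool}

/-- A zero vector would put the edge vector of the acyclic orientation into the measurement plane.
The projection along that plane onto the sinks of `O` fixes this vector, so it would be zero. -/
theorem edgeVector_ne_zero (c : G.Frame) (hO : G.IsPerfect O) (hac : G.IsAcyclic O) {w : E → ℝ}
    (hw : ∀ e, 0 < w e) (e : E) : c.edgeVector w e ≠ 0 := by
  obtain ⟨Φ, hΦ, hX⟩ := c.exists_isSinkProjection hw hO hac
  obtain ⟨Φ₀, hΦ₀, -⟩ := (c.reorient O hO).exists_isSinkProjection hw hO hac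
  intro h
  refine edgeVector_ne_zero_of_isAcyclic (c := c.reorient O hO) hac hw e ?_
  have h1 := hX e
  rw [h, smul_zero, eq_comm, hΦ.apply_eq_zero_iff, ← hΦ₀.apply_eq_zero_iff,
    hΦ₀.apply_of_sink _ fun i hi => edgeVector_eq_zero_of_source hw hi e] at h1
  exact h1

/-- Each frame is compared with the acyclic orientation in its own drawing. Between these two
acyclic frames only edge factors `κ` occur, and the weight gauge does not move the plane, so both
frames are seen through projections along the same plane. -/
theorem exists_adaptedBasis_gauge (c c' : G.Frame) (hO : G.IsPerfect O) (hac : G.IsAcyclic O)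
    {w : E → ℝ} {t : V → ℝ} (hw : ∀ e, 0 < w e) (ht : ∀ v, 0 < t v) :
    ∃ (α : E → ℝ) (v : G.Sink c.orient → Fin n → ℝ), (∀ e, α e ≠ 0) ∧
      G.IsAdaptedBasis (G.measurementPlane O w) c.orient c'.orient v ∧
      ∀ e, c'.edgeVector (G.regauge t w) e =
        α e • ∑ j : G.Sink c.orient, c.edgeVector w e j • v j := by
  have hw' := regauge_pos (G := G) ht hw
  obtain ⟨Φ, hΦ, hX⟩ := c.exists_isSinkProjection hw hO hac
  obtain ⟨Φ', hΦ', hX'⟩ := c'.exists_isSinkProjection hw' hO hac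
  rw [measurementPlane_regauge ht] at hΦ'
  obtain ⟨κ, hκ, hX₀⟩ := exists_edgeVector_regauge hO hac (c := c.reorient O hO)
    (c' := c'.reorient O hO) rfl rfl ht w
  have hf' := fun e => frameFactor_ne_zero (c := c') hw' hO e
  refine ⟨fun e => (c'.frameFactor (G.regauge t w) hO e)⁻¹ * (κ e * c.frameFactor w hO e), _,
    fun e => mul_ne_zero (inv_ne_zero (hf' e)) (mul_ne_zero (hκ e) (frameFactor_ne_zero hw hO e)),
    hΦ.isAdaptedBasis hΦ', fun e => ?_⟩
  rw [← IsSinkProjection.apply_sum _ fun i hi => edgeVector_eq_zero_of_source hw hi e]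
  have h := hX' e
  rw [hX₀ e, map_smul, ← hΦ'.apply_eq (hΦ.sub_mem _), ← hX e, map_smul, smul_smul] at h
  rw [mul_smul, ← h, smul_smul, inv_mul_cancel₀ (hf' e), one_smul]

/-- Projecting the acyclic edge vector and dividing by `frameFactor` leaves the walk sums of `O`,
divided by the weight on reversed edges; the remaining signs do not depend on the weights. -/
theorem exists_adaptedBasis_subtractionFree (c : G.Frame) (hO : G.IsPerfect O)
    (hac : G.IsAcyclic O) :
    ∃ (σ : E → G.Sink O → ℤˣ) (R : E → G.Sink O → (E → ℝ) → ℝ),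
      (∀ e j, IsSubtractionFree (R e j)) ∧
      ∀ w : E → ℝ, (∀ e, 0 < w e) → ∃ v : G.Sink O → Fin n → ℝ,
        G.IsAdaptedBasis (G.measurementPlane O w) O c.orient v ∧
        ∀ e, c.edgeVector w e = ∑ j, ((σ e j : ℤ) * R e j w) • v j := by
  classical
  obtain ⟨σ, -, hσ⟩ := exists_edgeVector_sign (c := c.reorient O hO) hac
  change ∀ w e j, _ = (σ e j : ℤ) * weightSum O w {P | G.IsWalk O e j P} at hσ
  refine ⟨fun e j => sgn ((c.reorient O hO).rho e + c.side O e + c.rho e) * σ e j,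
    fun e j w => (if e ∈ c.flips O then (weight O w e)⁻¹ else 1) *
      weightSum O w {P | G.IsWalk O e j P}, fun e j => ?_, fun w hw => ?_⟩
  · refine IsSubtractionFree.mul ?_ (IsSubtractionFree.weightSum O (hac.finite_walks e j))
    by_cases he : e ∈ c.flips O
    · simpa only [if_pos he] using IsSubtractionFree.weight_inv O e
    · simpa only [if_neg he] using IsSubtractionFree.one
  · obtain ⟨Φ, hΦ, hX⟩ := c.exists_isSinkProjection hw hO hac
    obtain ⟨Φ₀, hΦ₀, -⟩ := (c.reorient O hO).exists_isSinkProjection hw hO hac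
    refine ⟨_, hΦ₀.isAdaptedBasis hΦ, fun e => ?_⟩
    have hf := frameFactor_ne_zero (c := c) hw hO e
    have h := hX e
    rw [IsSinkProjection.apply_sum (O := O) _ fun i hi =>
      edgeVector_eq_zero_of_source (c := c.reorient O hO) hw hi e] at h
    rw [← inv_smul_smul₀ hf (c.edgeVector w e), h, Finset.smul_sum]
    refine Finset.sum_congr rfl fun j _ => ?_
    rw [smul_smul, hσ w e j]
    congr 1
    have hfac : (c.frameFactor w hO e)⁻¹ =
        rsgn ((c.reorient O hO).rho e + c.side O e + c.rho e) *
          if e ∈ c.flips O then (weight O w e)⁻¹ else 1 := by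
      refine inv_eq_of_mul_eq_one_right ?_
      have h1 := rsgn_mul_self (((c.reorient O hO).rho e + c.side O e + c.rho e))
      simp only [rsgn_add] at h1 ⊢
      have hne := (weight_pos (O := O) hw e).ne'
      unfold frameFactor flipFactor
      split_ifs
      · field_simp
        linear_combination h1
      · linear_combination h1
    rw [hfac, Units.val_mul, Int.cast_mul]
    change _ = rsgn _ * _ * _
    ring

end Acyclic

end Frame

end PBDTPGraph

end
theorem mainTheorem11 {n : ℕ} {V E : Type*} [Finite V] [Finite E] (G : PBDTPGraph n V E)
    (hirr : G.IsIrreducible) (O₀ : E → Bool) (hO₀ : G.IsPerfect O₀) (hac : G.IsAcyclic O₀) :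
    -- the formal sums over walks are rational functions with subtraction-free denominators
    (∀ (c : G.Frame) (e : E) (j : Fin n), ∃ (P : MvPolynomial E ℤ) (Q : MvPolynomial E ℕ), Q ≠ 0 ∧
      (MvPolynomial.map (Nat.castRingHom ℤ) Q : MvPowerSeries E ℤ) * c.edgeSeries e j =
        (P : MvPowerSeries E ℤ)) ∧
    -- in acyclic orientations the canonical components are, up to a sign depending only on the edge
    -- and on the sink, the sums of the weights of the directed walks
    (∀ c : G.Frame, G.IsAcyclic c.orient → ∃ σ : E → Fin n → ℤˣ,
      (∀ e j P, G.IsWalk c.orient e j P → (c.wind P + c.walkInt P).negOnePow = σ e j) ∧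
      ∀ w : E → ℝ, (∀ e, 0 < w e) → ∀ (e : E) (j : Fin n),
        c.edgeVector w e j = (σ e j : ℤ) *
          PBDTPGraph.weightSum c.orient w {P | G.IsWalk c.orient e j P}) ∧
    -- in any orientation and gauge, the components in the adapted basis are, up to fixed signs,
    -- subtraction-free rational in the weights
    (∀ c : G.Frame, ∃ (σ : E → G.Sink O₀ → ℤˣ) (R : E → G.Sink O₀ → (E → ℝ) → ℝ),
      (∀ e j, IsSubtractionFree (R e j)) ∧
      ∀ w : E → ℝ, (∀ e, 0 < w e) → ∃ v : G.Sink O₀ → Fin n → ℝ,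
        G.IsAdaptedBasis (G.measurementPlane O₀ w) O₀ c.orient v ∧
        ∀ e, c.edgeVector w e = ∑ j, ((σ e j : ℤ) * R e j w) • v j) ∧
    -- any change of orientation, ray direction, vertex gauge and weight gauge multiplies the edge
    -- vectors, expressed in the adapted basis, by nonzero factors depending only on the edge
    (∀ (c c' : G.Frame) (w : E → ℝ) (t : V → ℝ), (∀ e, 0 < w e) → (∀ v, 0 < t v) →
      ∃ (α : E → ℝ) (v : G.Sink c.orient → Fin n → ℝ), (∀ e, α e ≠ 0) ∧
        G.IsAdaptedBasis (G.measurementPlane O₀ w) c.orient c'.orient v ∧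
        ∀ e, c'.edgeVector (G.regauge t w) e = α e • ∑ j : G.Sink c.orient, c.edgeVector w e j • v j) ∧
    -- there are no null edge vectors
    (∀ (c : G.Frame) (w : E → ℝ), (∀ e, 0 < w e) → ∀ e, c.edgeVector w e ≠ 0) := by
  classical
  cases nonempty_fintype V
  cases nonempty_fintype E
  refine ⟨fun c e j => ⟨_, c.flowPolynomial, c.flowPolynomial_ne_zero, c.det_mul_edgeSeries e j⟩,
    fun c hc => ?_, fun c => c.exists_adaptedBasis_subtractionFree hO₀ hac,
    fun c c' w t hw ht => c.exists_adaptedBasis_gauge c' hO₀ hac hw ht,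
    fun c w hw => c.edgeVector_ne_zero hO₀ hac hw⟩
  obtain ⟨σ, h, h'⟩ := PBDTPGraph.Frame.exists_edgeVector_sign hc
  exact ⟨σ, h, fun w _ => h' w⟩
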